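/- Let $T>0$. Let $w\in L^\infty(\mathbb R^3,\mathbb R)\cap W^{1,3}(\mathbb R^3,\mathbb R)$ be even. Let $V\in L^1(\mathbb R^3,\mathbb R)$ belong to the Rollnik class, i.e. $\iint_{\mathbb R^3\times\mathbb R^3}\frac{|V(x)||V(y)|}{|x-y|^2}\,dx\,dy<\infty$; if $w$ is not identically zero, assume in addition $V\in L^p(\mathbb R^3)+L^\infty(\mathbb R^3)$ for some $p>\frac32$. Let $\eta:[0,1]\to[0,+\infty)$ be smooth with $\eta(0)=\eta(1)=1$, let $a\in L^2(\mathbb R^3)$ and $\sigma\ge 0$, and for $\varepsilon\in(0,1]$ set $$V_\varepsilon(x)=\frac{\eta(\varepsilon)}{\varepsilon^\sigma}V\Big(\frac x\varepsilon\Big).$$ For a self-adjoint operator $H$ on $L^2(\mathbb R^3)$, a solution of the Cauchy problem $i\partial_t u=Hu+(w*|u|^2)u$, $u(0)=a$, is a function $u\in C(\mathbb R,L^2(\mathbb R^3))$ with $u(0)=a$ such that, for every $g\in\mathrm{dom}(H)$, the function $t\mapsto\langle g,u(t)\rangle$ is differentiable and $i\frac{d}{dt}\langle g,u(t)\rangle=\langle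 Hg,u(t)\rangle+\langle g,(w*|u(t)|^2)u(t)\rangle$ for all $t\in\mathbb R$. Let $-\Delta+V_\varepsilon$ be the form sum with form domain $H^1(\mathbb R^3)$. For every $\varepsilon\in(0,1]$ the Cauchy problem with $H=-\Delta+V_\varepsilon$ has a unique solution $u_\varepsilon$. Write $\mathsf v=\sqrt{|V|}$, $\mathsf u=\sqrt{|V|}\,\mathrm{sign}(V)$, let $(-\Delta)^{-1}$ be convolution with $\frac1{4\pi|x|}$, and consider the Birman–Schwinger operator $\mathsf u(-\Delta)^{-1}\mathsf v$ on $L^2(\mathbb R^3)$. (i) Let $\sigma\in[0,3]$. If $\sigma=2$, assume that $-1$ is not an eigenvalue of $\mathsf u(-\Delta)^{-1}\mathsf v$; if $\sigma\in(2,3]$, assume $V\ge0$ almost everywhere. Then the Cauchy problem with $H=-\Delta$, $\mathrm{dom}(H)=H^2(\mathbb R^3)$, has a unique solution $u$, and $$\lim_{\varepsilon\downarrow0}\|u_\varepsilon-u\|_{L^\infty([0,T],L^2(\mathbb R^3))}=0.$$ (ii) Let $\sigma=2$ and assume that $\mathsf u(-\Delta)^{-1}\mathsf v$ has the eigenvalue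 $-1$ with a one-dimensional eigenspace spanned by some $\phi\in L^2(\mathbb R^3)$, that $\psi:=(-\Delta)^{-1}\mathsf v\phi\in L^2_{\rm loc}(\mathbb R^3)\setminus L^2(\mathbb R^3)$, and that $\phi$ is normalised by $\int_{\mathbb R^3}\mathrm{sign}(V)|\phi|^2\,dx=-1$. Set $$\alpha=-\frac{\eta'(0)}{\big|\int_{\mathbb R^3}V\psi\,dx\big|^2}.$$ Then the Cauchy problem with $H=-\Delta_\alpha$ has a unique solution $v$, and $$\lim_{\varepsilon\downarrow0}\|u_\varepsilon-v\|_{L^\infty([0,T],L^2(\mathbb R^3))}=0.$$ Here $-\Delta_\alpha$ is the Hamiltonian of point interaction at the origin: with $G_\lambda(x)=\frac{e^{-\sqrt\lambda|x|}}{4\pi|x|}$ and any $\lambda>0$ such that $\alpha+\frac{\sqrt\lambda}{4\pi}\neq0$, its domain consists of the functions $g=f+\frac{f(0)}{\alpha+\sqrt\lambda/(4\pi)}G_\lambda$ with $f\in H^2(\mathbb R^3)$, and $(-\Delta_\alpha+\lambda)g=(-\Delta+\lambda)f$; domain and action do not depend on the choice of $\lambda$. -/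

import Mathlib

open MeasureTheory Set Filter Topology
open scoped ENNReal ContDiff ComplexConjugate Laplacian LineDeriv

noncomputable section

namespace ShrinkingHartree

/-- Three-dimensional Euclidean space. -/
abbrev E3 : Type := EuclideanSpace ℝ (Fin 3)

/-- The complex Hilbert space `L²(ℝ³)`. -/
abbrev L2 : Type := Lp ℂ 2 (volume : Measure E3)

/-! ### Function classes for the potentials -/

/-- The Sobolev space `W^{1,p}(ℝ³, ℝ)`: `w` and its weak first partial derivatives are in `L^p`. -/
def MemW1 (p : ℝ≥0∞) (w : E3 → ℝ) : Prop :=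
  MemLp w p volume ∧
    ∀ i : Fin 3, ∃ D : E3 → ℝ, MemLp D p volume ∧
      ∀ ϕ : E3 → ℝ, ContDiff ℝ ∞ ϕ → HasCompactSupport ϕ →
        ∫ x, w x * fderiv ℝ ϕ x (EuclideanSpace.single i 1) = -∫ x, D x * ϕ x

/-- The Rollnik class: `V` is measurable and `∬ |V(x)| |V(y)| / |x - y|² dx dy < ∞`. -/
def IsRollnik (V : E3 → ℝ) : Prop :=
  AEStronglyMeasurable V volume ∧
    ∫⁻ x, ∫⁻ y, ‖V x‖ₑ * ‖V y‖ₑ / ‖x - y‖ₑ ^ 2 < ⊤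

/-- `V ∈ L^p(ℝ³, ℝ) + L^∞(ℝ³, ℝ)`. -/
def MemLpAddLinfty (p : ℝ≥0∞) (V : E3 → ℝ) : Prop :=
  ∃ V₁ V₂ : E3 → ℝ, MemLp V₁ p volume ∧ MemLp V₂ ⊤ volume ∧ V =ᵐ[volume] V₁ + V₂

/-- The shrinking potential `V_ε(x) = η(ε) ε^{-σ} V(x / ε)`. -/
def scaledPotential (η : ℝ → ℝ) (σ : ℝ) (V : E3 → ℝ) (ε : ℝ) (x : E3) : ℝ :=
  η ε / ε ^ σ * V (ε⁻¹ • x)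

/-! ### Hamiltonians

An operator in `L²(ℝ³)` is given by its graph, the set of all pairs `(g, H g)` with `g ∈ dom H`. -/

/-- The graph of the self-adjoint negative Laplacian with domain `H²(ℝ³)`. -/
def freeGraph : Set (L2 × L2) :=
  {p | TemperedDistribution.MemSobolev 2 2 (Lp.toTemperedDistribution p.1) ∧
    -Δ (Lp.toTemperedDistribution p.1) = Lp.toTemperedDistribution p.2}

/-- `D` is the weak gradient of `g`, in `L²`. The functions `g ∈ L²(ℝ³)` that have one are the
elements of `H¹(ℝ³)`. -/
def IsWeakGradient (g : L2) (D : Fin 3 → L2) : Prop :=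
  ∀ i, ∂_{(EuclideanSpace.single i 1 : E3)} (Lp.toTemperedDistribution g) =
    Lp.toTemperedDistribution (D i)

/-- The graph of the form sum `-Δ + V`, the operator of the quadratic form
`∫ |∇g|² + ∫ V |g|²` with form domain `H¹(ℝ³)`: the pair `(g, h)` belongs to it when
`g ∈ H¹(ℝ³)` and `∫ conj(∇φ) · ∇g + ∫ V conj(φ) g = ⟨φ, h⟩` for all `φ ∈ H¹(ℝ³)`. -/
def formSumGraph (V : E3 → ℝ) : Set (L2 × L2) :=
  {p | ∃ D : Fin 3 → L2, IsWeakGradient p.1 D ∧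
    ∀ (φ : L2) (Dφ : Fin 3 → L2), IsWeakGradient φ Dφ →
      (∑ i, inner ℂ (Dφ i) (D i)) + (∫ x, (V x : ℂ) * (conj (φ x) * p.1 x)) = inner ℂ φ p.2}

/-- The Green function `G_μ(x) = exp(-√μ |x|) / (4π|x|)` of `-Δ + μ`. -/
def greenFunction (μ : ℝ) (x : E3) : ℝ :=
  Real.exp (-(‖x‖ * √μ)) / (4 * Real.pi * ‖x‖)

/-- The graph of the point interaction Hamiltonian `-Δ_α` supported at the origin. The domain
consists of the functions `g = f + f(0) / (α + √μ / 4π) G_μ` with `f ∈ H²(ℝ³)`, and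
`(-Δ_α + μ) g = (-Δ + μ) f`; neither depends on the choice of `μ > 0` with `α + √μ / 4π ≠ 0`.
Here `f(0)` is the value at the origin of the continuous representative `f₀` of `f`. -/
def pointInteractionGraph (α : ℝ) : Set (L2 × L2) :=
  {p | ∃ μ : ℝ, 0 < μ ∧ α + √μ / (4 * Real.pi) ≠ 0 ∧
    ∃ (f k : L2) (f₀ : E3 → ℂ), (f, k) ∈ freeGraph ∧ Continuous f₀ ∧ f =ᵐ[volume] f₀ ∧
      (p.1 =ᵐ[volume] fun x =>
        f₀ x + f₀ 0 / ((α + √μ / (4 * Real.pi) : ℝ) : ℂ) * (greenFunction μ x : ℂ)) ∧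
      p.2 + (μ : ℂ) • p.1 = k + (μ : ℂ) • f}

/-! ### The Hartree equation -/

/-- The Hartree potential `w * |f|²`. -/
def hartreePotential (w : E3 → ℝ) (f : E3 → ℂ) (x : E3) : ℝ :=
  ∫ y, w (x - y) * ‖f y‖ ^ 2

/-- `u ∈ C(ℝ, L²(ℝ³))` solves `i ∂ₜu = H u + (w * |u|²) u`, `u(0) = a`, where `A` is the graph of
the self-adjoint operator `H`. As `u(t)` need not belong to the domain of `H`, the equation is
tested against the elements `g` of the domain:
`i d/dt ⟨g, u(t)⟩ = ⟨H g, u(t)⟩ + ⟨g, (w * |u(t)|²) u(t)⟩`. -/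
def IsHartreeSolution (A : Set (L2 × L2)) (w : E3 → ℝ) (a : L2) (u : ℝ → L2) : Prop :=
  Continuous u ∧ u 0 = a ∧
    ∀ p ∈ A, ∀ t : ℝ,
      HasDerivAt (fun s : ℝ => inner ℂ p.1 (u s))
        (-Complex.I * (inner ℂ p.2 (u t) +
          ∫ x, conj (p.1 x) * ((hartreePotential w (u t) x : ℂ) * u t x))) t

/-- `u` is the unique solution in `C(ℝ, L²(ℝ³))` of the Cauchy problem. -/
def IsUniqueHartreeSolution (A : Set (L2 × L2)) (w : E3 → ℝ) (a : L2) (u : ℝ → L2) : Prop :=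
  IsHartreeSolution A w a u ∧ ∀ u', IsHartreeSolution A w a u' → u' = u

/-! ### Zero-energy resonances -/

/-- `v = √|V|`. -/
def absRoot (V : E3 → ℝ) (x : E3) : ℝ := √|V x|

/-- `u = √|V| sign(V)`. -/
def signedRoot (V : E3 → ℝ) (x : E3) : ℝ := √|V x| * Real.sign (V x)

/-- `(-Δ)⁻¹ f`, the convolution of `f` with `1 / (4π|x|)`. -/
def newtonPotential (f : E3 → ℂ) (x : E3) : ℂ :=
  ∫ y, (((4 * Real.pi * ‖x - y‖)⁻¹ : ℝ) : ℂ) * f y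

/-- `ψ = (-Δ)⁻¹ v φ`. -/
def resonanceFunction (V : E3 → ℝ) (φ : L2) : E3 → ℂ :=
  newtonPotential fun y => (absRoot V y : ℂ) * φ y

/-- `φ` is an eigenfunction of the Birman-Schwinger operator `u (-Δ)⁻¹ v` with eigenvalue `-1`. -/
def IsBirmanSchwingerEigenfunction (V : E3 → ℝ) (φ : L2) : Prop :=
  φ ≠ 0 ∧ ∀ᵐ x, (signedRoot V x : ℂ) * resonanceFunction V φ x = -φ x

/-- The (simple) resonance condition at zero energy for `-Δ + V`, with eigenfunction `φ`: the
eigenvalue `-1` of `u (-Δ)⁻¹ v` has the one-dimensional eigenspace spanned by `φ`, and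
`ψ = (-Δ)⁻¹ v φ` is in `L²_loc` but not in `L²`. -/
structure IsSimpleResonance (V : E3 → ℝ) (φ : L2) : Prop where
  eigen : IsBirmanSchwingerEigenfunction V φ
  simple : ∀ φ', IsBirmanSchwingerEigenfunction V φ' → ∃ c : ℂ, φ' = c • φ
  locally_L2 : ∀ K : Set E3, IsCompact K → MemLp (resonanceFunction V φ) 2 (volume.restrict K)
  not_L2 : ¬ MemLp (resonanceFunction V φ) 2 volume

end ShrinkingHartree

end

open ShrinkingHartree

/-! Everything is expressed through bounded resolvents. Each Hamiltonian is written as H = R⁻¹ - κ²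
with R bounded, self-adjoint and injective (`resolventGraph`). The unitary group of R⁻¹ comes from
the continuous functional calculus of R. Since w is bounded, the Hartree term is Lipschitz on balls
of L² and conserves the norm, so in the interaction picture the equation is a globally well-posed
ordinary differential equation in L². A Grönwall estimate shows that strong convergence of the
resolvents forces convergence of the solutions uniformly on [0, T] (`tendsto_hartreeSolution`). Both
limits are thereby reduced to linear statements about resolvents.

For the potential a(ε) V(·/ε), rescaling by ε gives R_ε = G - a ε³ Γ_ε* (1 + a ε² s K_{εκ})⁻¹ s Γ_ε
(`potRes_eq_sub`). Here G = (-Δ + κ²)⁻¹, s is the sign of V, K_m = √|V| (-Δ + m²)⁻¹ √|V| is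
Hilbert-Schmidt by the Rollnik condition, and Γ_ε h = √|V| (G h)(ε ·) tends in norm to ⟨G_κ, h⟩ √|V|
because V is integrable. The amplitude is a = η(ε) ε^{-σ}.

For σ < 2 the coupling a ε² tends to 0; for σ = 2 it tends to 1, and 1 + s K_0 is invertible by the
Fredholm alternative if -1 is not an eigenvalue. The inverse then stays bounded while a ε³ → 0, so
R_ε → G in norm (`tendsto_potResFam_free`). For 2 < σ ≤ 3 and V ≥ 0 the form operator 1 + B*B is
bounded below by 1. Because G_κ is not in H¹, the elements G h with ⟨G_κ, h⟩ = 0 are dense in H¹,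
and on them the perturbation disappears in the limit; this gives strong resolvent convergence
(`tendsto_potResFam_of_nonneg`).

In the resonant case the inverse has a pole of order one in ε with a rank-one residue, exactly
balanced by a ε³ ~ ε. The residue follows from η(ε) = 1 + η'(0) ε + o(ε) and K_m = K_0 - (m/4π)
|√|V|⟩⟨√|V|| + o(m): its denominator is η'(0) - κ|c|²/(4π) with c = ∫ √|V| φ. The limit is Krein's
formula for -Δ_α with α = -η'(0)/|c|² (`tendsto_potResFam_resonance`). That c ≠ 0 is a decay
statement: with zero charge, ψ would be square integrable at infinity
(`IsSimpleResonance.integral_ne_zero`). -/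

noncomputable section

namespace ShrinkingHartree

/-! ### The unitary group of a self-adjoint operator with a bounded inverse -/

section UnitaryGroup

variable {K : Type*} [NormedAddCommGroup K] [InnerProductSpace ℂ K]

/-- The symbol `x exp(-i t / x)`, a function of the real part. -/
def oscSymbol (t : ℝ) (z : ℂ) : ℂ := (z.re : ℂ) * Complex.exp (-((t / z.re : ℝ) : ℂ) * Complex.I)

theorem norm_exp_neg_ofReal_mul_I (s : ℝ) : ‖Complex.exp (-(s : ℂ) * Complex.I)‖ = 1 := by
  rw [← Complex.ofReal_neg, Complex.norm_exp_ofReal_mul_I]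

theorem norm_oscSymbol (t : ℝ) (z : ℂ) : ‖oscSymbol t z‖ = |z.re| := by
  rw [oscSymbol, norm_mul, norm_exp_neg_ofReal_mul_I, mul_one, Complex.norm_real, Real.norm_eq_abs]

theorem norm_exp_sub_one_le (s : ℝ) : ‖Complex.exp (-(s : ℂ) * Complex.I) - 1‖ ≤ |s| := by
  have := Real.norm_exp_I_mul_ofReal_sub_one_le (x := -s)
  rwa [norm_neg, Real.norm_eq_abs, mul_comm, Complex.ofReal_neg] at this

/-- The phase oscillates without limit at 0, but the factor x damps it, and the convention t / 0 = 0
gives the correct value there. This is why R exp(-itR⁻¹) is accessible to the continuous functional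
calculus while exp(-itR⁻¹) is not. -/
theorem continuous_oscSymbol (t : ℝ) : Continuous (oscSymbol t) := by
  rw [continuous_iff_continuousAt]
  intro z
  by_cases hz : z.re = 0
  · have h0 : oscSymbol t z = 0 := by simp [oscSymbol, hz]
    rw [ContinuousAt, h0, tendsto_zero_iff_norm_tendsto_zero]
    simp_rw [norm_oscSymbol]
    have : Continuous fun z : ℂ => |z.re| := by fun_prop
    simpa [hz] using this.tendsto z
  · unfold oscSymbol
    have : ContinuousAt (fun z : ℂ => t / z.re) z :=
      continuousAt_const.div Complex.continuous_re.continuousAt hz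
    fun_prop

theorem norm_oscSymbol_sub_le (s t : ℝ) (z : ℂ) :
    ‖oscSymbol s z - oscSymbol t z‖ ≤ |s - t| := by
  by_cases hz : z.re = 0
  · simp [oscSymbol, hz]
  have h : oscSymbol s z - oscSymbol t z =
      oscSymbol t z * (Complex.exp (-(((s - t) / z.re : ℝ) : ℂ) * Complex.I) - 1) := by
    unfold oscSymbol
    rw [mul_sub, mul_one, mul_assoc, ← Complex.exp_add]
    congr 3
    push_cast
    ring
  rw [h, norm_mul, norm_oscSymbol]
  calc |z.re| * _ ≤ |z.re| * |(s - t) / z.re| := by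
        gcongr; exact norm_exp_sub_one_le _
    _ = |s - t| := by
        rw [← abs_mul]; congr 1; field_simp

theorem oscSymbol_mul (s t : ℝ) (z : ℂ) :
    oscSymbol s z * oscSymbol t z = oscSymbol (s + t) z * (z.re : ℂ) := by
  unfold oscSymbol
  have : Complex.exp (-(((s + t) / z.re : ℝ) : ℂ) * Complex.I) =
      Complex.exp (-((s / z.re : ℝ) : ℂ) * Complex.I) *
        Complex.exp (-((t / z.re : ℝ) : ℂ) * Complex.I) := by
    rw [← Complex.exp_add]; congr 1; push_cast; ring
  rw [this]; ring

theorem star_oscSymbol_mul (t : ℝ) (z : ℂ) :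
    star (oscSymbol t z) * oscSymbol t z = (z.re : ℂ) * z.re := by
  have := Complex.conj_mul' (oscSymbol t z)
  rw [norm_oscSymbol] at this
  rw [← starRingEnd_apply, this, ← Complex.ofReal_pow, sq_abs]
  push_cast; ring

/-- Taylor's estimate serves for |s| ≤ 1; for larger s the crude bound 2|s| is already below 2s². -/
theorem norm_exp_sub_one_add_le (s : ℝ) :
    ‖Complex.exp (-(s : ℂ) * Complex.I) - 1 + s * Complex.I‖ ≤ 2 * s ^ 2 := by
  by_cases hs : |s| ≤ 1
  · have := Complex.norm_exp_sub_one_sub_id_le (x := -(s : ℂ) * Complex.I) (by simpa using hs)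
    have h2 : Complex.exp (-(s : ℂ) * Complex.I) - 1 - -(s : ℂ) * Complex.I =
      Complex.exp (-(s : ℂ) * Complex.I) - 1 + s * Complex.I := by ring
    rw [h2] at this
    have h3 : ‖-(s : ℂ) * Complex.I‖ ^ 2 = s ^ 2 := by simp
    nlinarith [sq_nonneg s]
  · push Not at hs
    calc _ ≤ ‖Complex.exp (-(s : ℂ) * Complex.I) - 1‖ + ‖(s : ℂ) * Complex.I‖ := norm_add_le _ _
      _ ≤ |s| + |s| := by
          gcongr
          · exact norm_exp_sub_one_le _
          · simp
      _ ≤ 2 * s ^ 2 := by rw [← sq_abs]; nlinarith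

/-- A second-order remainder uniform in x: the two factors x cancel the denominator of ((s - t)/x)².
It yields differentiability of the group on the range of R. -/
theorem norm_oscSymbol_increment_le (s t : ℝ) (z : ℂ) :
    ‖(oscSymbol s z - oscSymbol t z) * (z.re : ℂ) + ((s - t : ℝ) : ℂ) * Complex.I * oscSymbol t z‖
      ≤ 2 * (s - t) ^ 2 := by
  by_cases hz : z.re = 0
  · simp only [oscSymbol, hz]; simp; positivity
  have hz' : (z.re : ℂ) ≠ 0 := by exact_mod_cast hz
  have h : (oscSymbol s z - oscSymbol t z) * (z.re : ℂ)
        + ((s - t : ℝ) : ℂ) * Complex.I * oscSymbol t z =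
      oscSymbol t z * (z.re : ℂ) * (Complex.exp (-(((s - t) / z.re : ℝ) : ℂ) * Complex.I) - 1
        + (((s - t) / z.re : ℝ) : ℂ) * Complex.I) := by
    have h1 : oscSymbol s z = oscSymbol t z *
        Complex.exp (-(((s - t) / z.re : ℝ) : ℂ) * Complex.I) := by
      unfold oscSymbol
      rw [mul_assoc, ← Complex.exp_add]
      congr 2
      push_cast
      ring
    rw [h1]
    push_cast
    field_simp
  rw [h, norm_mul, norm_mul, norm_oscSymbol, Complex.norm_real, Real.norm_eq_abs]
  calc |z.re| * |z.re| * _ ≤ |z.re| * |z.re| * (2 * ((s - t) / z.re) ^ 2) := by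
        gcongr; exact norm_exp_sub_one_add_le _
    _ = 2 * (s - t) ^ 2 := by
        rw [abs_mul_abs_self]; field_simp

variable [CompleteSpace K] {R : K →L[ℂ] K}

/-- The operator `R exp(-i t R⁻¹)`. -/
def oscOp (R : K →L[ℂ] K) (t : ℝ) : K →L[ℂ] K := cfc (oscSymbol t) R

/-- The spectrum of a self-adjoint operator is real, so nothing is lost with symbols that depend on
the real part only. -/
theorem cfc_re_eq_self (hR : IsSelfAdjoint R) : cfc (fun z : ℂ => (z.re : ℂ)) R = R := by
  have := hR.isStarNormal
  conv_rhs => rw [← cfc_id ℂ R]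
  exact cfc_congr fun z hz => (hR.mem_spectrum_eq_re hz).symm

theorem oscOp_commute (hR : IsSelfAdjoint R) (t : ℝ) : oscOp R t * R = R * oscOp R t := by
  have := hR.isStarNormal
  have h := cfc_commute_cfc (oscSymbol t) (fun z : ℂ => (z.re : ℂ)) R
  rw [cfc_re_eq_self hR] at h
  exact h

theorem oscOp_mul (hR : IsSelfAdjoint R) (s t : ℝ) :
    oscOp R s * oscOp R t = oscOp R (s + t) * R := by
  have := hR.isStarNormal
  unfold oscOp
  conv_rhs => rw [← cfc_re_eq_self hR, cfc_re_eq_self hR]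
  rw [← cfc_mul _ _ R (continuous_oscSymbol s).continuousOn (continuous_oscSymbol t).continuousOn]
  simp_rw [oscSymbol_mul]
  rw [cfc_mul _ _ R (continuous_oscSymbol _).continuousOn (by fun_prop), cfc_re_eq_self hR]

/-- The symbol has modulus |x|, so both operators have the same A*A. This makes the extension from
the range of R isometric. -/
theorem norm_oscOp_apply (hR : IsSelfAdjoint R) (t : ℝ) (x : K) : ‖oscOp R t x‖ = ‖R x‖ := by
  have := hR.isStarNormal
  have h : star (oscOp R t) * oscOp R t = star R * R := by
    unfold oscOp
    rw [← cfc_star, ← cfc_mul _ _ R (continuous_oscSymbol t).star.continuousOn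
      (continuous_oscSymbol t).continuousOn]
    simp_rw [star_oscSymbol_mul]
    rw [cfc_mul _ _ R (by fun_prop) (by fun_prop), cfc_re_eq_self hR, hR.star_eq]
  have key (S : K →L[ℂ] K) : ((‖S x‖ : ℝ) : ℂ) ^ 2 = inner ℂ x ((star S * S) x) := by
    rw [ContinuousLinearMap.star_eq_adjoint, mul_apply_eq_comp,
      ContinuousLinearMap.adjoint_inner_right, inner_self_eq_norm_sq_to_K]
    rfl
  have h2 : ((‖oscOp R t x‖ : ℝ) : ℂ) ^ 2 = ((‖R x‖ : ℝ) : ℂ) ^ 2 := by rw [key, key, h]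
  have h3 : ‖oscOp R t x‖ ^ 2 = ‖R x‖ ^ 2 := by exact_mod_cast h2
  exact (sq_eq_sq₀ (norm_nonneg _) (norm_nonneg _)).1 h3

theorem norm_oscOp_sub_le (hR : IsSelfAdjoint R) (s t : ℝ) :
    ‖oscOp R s - oscOp R t‖ ≤ |s - t| := by
  have := hR.isStarNormal
  unfold oscOp
  rw [← cfc_sub _ _ R (continuous_oscSymbol s).continuousOn (continuous_oscSymbol t).continuousOn]
  exact norm_cfc_le (abs_nonneg _) fun z _ => norm_oscSymbol_sub_le s t z

theorem norm_oscOp_increment_le (hR : IsSelfAdjoint R) (s t : ℝ) :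
    ‖(oscOp R s - oscOp R t) * R + (((s - t : ℝ) : ℂ) * Complex.I) • oscOp R t‖
      ≤ 2 * (s - t) ^ 2 := by
  have := hR.isStarNormal
  have hs := (continuous_oscSymbol s).continuousOn (s := spectrum ℂ R)
  have ht := (continuous_oscSymbol t).continuousOn (s := spectrum ℂ R)
  have h : (oscOp R s - oscOp R t) * R + (((s - t : ℝ) : ℂ) * Complex.I) • oscOp R t =
      cfc (fun z => (oscSymbol s z - oscSymbol t z) * (z.re : ℂ)
        + ((s - t : ℝ) : ℂ) * Complex.I * oscSymbol t z) R := by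
    rw [cfc_add (a := R) _ _ (by fun_prop) (by fun_prop), cfc_mul _ _ R (by fun_prop) (by fun_prop),
      cfc_sub _ _ R hs ht, cfc_re_eq_self hR, cfc_const_mul _ _ R ht]
    rfl
  rw [h]
  exact norm_cfc_le (by positivity) fun z _ => norm_oscSymbol_increment_le s t z

theorem denseRange_of_injective (hR : IsSelfAdjoint R) (hi : Function.Injective R) :
    DenseRange R := by
  have h1 : R.rangeᗮ = ⊥ := by
    rw [ContinuousLinearMap.orthogonal_range, ContinuousLinearMap.isSelfAdjoint_iff'.1 hR]
    exact LinearMap.ker_eq_bot.2 hi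
  have h2 := (Submodule.topologicalClosure_eq_top_iff (K := R.range)).2 h1
  have h3 := (Submodule.dense_iff_topologicalClosure_eq_top (s := R.range)).2 h2
  exact h3.mono (fun x hx => hx)

/-- The unitary group `exp(-i t R⁻¹)`. -/
def evol (R : K →L[ℂ] K) (t : ℝ) : K →L[ℂ] K :=
  (oscOp R t : K →ₗ[ℂ] K).extendOfNorm (R : K →ₗ[ℂ] K)

theorem evol_apply (hR : IsSelfAdjoint R) (hi : Function.Injective R) (t : ℝ) (x : K) :
    evol R t (R x) = oscOp R t x :=
  LinearMap.extendOfNorm_eq (f := (oscOp R t : K →ₗ[ℂ] K)) (e := (R : K →ₗ[ℂ] K))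
    (denseRange_of_injective hR hi)
    ⟨1, fun x => by rw [one_mul]; exact (norm_oscOp_apply hR t x).le⟩ x

theorem norm_evol (hR : IsSelfAdjoint R) (hi : Function.Injective R) (t : ℝ) (x : K) :
    ‖evol R t x‖ = ‖x‖ := by
  have hd := denseRange_of_injective hR hi
  refine hd.induction_on (p := fun x => ‖evol R t x‖ = ‖x‖) x
    (isClosed_eq (by fun_prop) (by fun_prop)) fun y => ?_
  rw [evol_apply hR hi, norm_oscOp_apply hR]

theorem evol_comm (hR : IsSelfAdjoint R) (hi : Function.Injective R) (t : ℝ) (x : K) :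
    evol R t (R x) = R (evol R t x) := by
  have hd := denseRange_of_injective hR hi
  refine hd.induction_on (p := fun x => evol R t (R x) = R (evol R t x)) x
    (isClosed_eq (by fun_prop) (by fun_prop)) fun y => ?_
  rw [evol_apply hR hi, evol_apply hR hi]
  exact DFunLike.congr_fun (oscOp_commute hR t) y

/-- The functional calculus only yields the group law multiplied by R². It is therefore first seen
on the range of R² and extended by density, one factor R at a time. -/
theorem evol_add (hR : IsSelfAdjoint R) (hi : Function.Injective R) (s t : ℝ) (x : K) :
    evol R s (evol R t x) = evol R (s + t) x := by
  have hd := denseRange_of_injective hR hi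
  have h1 (y : K) : evol R s (evol R t (R (R y))) = evol R (s + t) (R (R y)) := by
    rw [evol_comm hR hi t, evol_comm hR hi, evol_apply hR hi t, ← evol_comm hR hi,
      evol_apply hR hi s, evol_apply hR hi]
    exact DFunLike.congr_fun (oscOp_mul hR s t) y
  have h2 (y : K) : evol R s (evol R t (R y)) = evol R (s + t) (R y) := by
    refine hd.induction_on (p := fun y => evol R s (evol R t (R y)) = evol R (s + t) (R y)) y
      (isClosed_eq (by fun_prop) (by fun_prop)) h1
  exact hd.induction_on (p := fun y => evol R s (evol R t y) = evol R (s + t) y) x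
      (isClosed_eq (by fun_prop) (by fun_prop)) h2

/-- An isometry U with U² = U is the identity, since U annihilates U x - x. -/
theorem evol_zero (hR : IsSelfAdjoint R) (hi : Function.Injective R) (x : K) :
    evol R 0 x = x := by
  have h := evol_add hR hi 0 0 x
  rw [add_zero] at h
  have h2 := norm_evol hR hi 0 (evol R 0 x - x)
  rw [map_sub, h, sub_self, norm_zero] at h2
  exact sub_eq_zero.1 (norm_eq_zero.1 h2.symm)

theorem evol_evol_neg (hR : IsSelfAdjoint R) (hi : Function.Injective R) (t : ℝ) (x : K) :
    evol R t (evol R (-t) x) = x := by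
  rw [evol_add hR hi, add_neg_cancel, evol_zero hR hi]

theorem inner_evol_evol (hR : IsSelfAdjoint R) (hi : Function.Injective R) (t : ℝ) (x y : K) :
    inner ℂ (evol R t x) (evol R t y) = inner ℂ x y :=
  (LinearMap.norm_map_iff_inner_map_map (evol R t)).1 (norm_evol hR hi t) x y

theorem inner_evol_left (hR : IsSelfAdjoint R) (hi : Function.Injective R) (t : ℝ) (x y : K) :
    inner ℂ (evol R t x) y = inner ℂ x (evol R (-t) y) := by
  rw [← inner_evol_evol hR hi t x, evol_evol_neg hR hi]

/-- On the range of R the group is Lipschitz in time; replacing x by R y costs its error twice. The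
constants do not involve R, which gives equicontinuity for families of resolvents. -/
theorem norm_evol_sub_le (hR : IsSelfAdjoint R) (hi : Function.Injective R) (s t : ℝ) (x y : K) :
    ‖evol R s x - evol R t x‖ ≤ 2 * ‖x - R y‖ + |s - t| * ‖y‖ := by
  have h : evol R s x - evol R t x = evol R s (x - R y) - evol R t (x - R y) +
      (oscOp R s - oscOp R t) y := by
    rw [sub_apply, ← evol_apply hR hi, ← evol_apply hR hi, map_sub, map_sub]
    abel
  rw [h]
  refine (norm_add_le _ _).trans (add_le_add ((norm_sub_le _ _).trans ?_) ?_)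
  · rw [norm_evol hR hi, norm_evol hR hi, two_mul]
  · exact ((oscOp R s - oscOp R t).le_opNorm y).trans (by gcongr; exact norm_oscOp_sub_le hR s t)

/-- Strong convergence of the resolvents and of the arguments implies convergence of the
propagators. -/
theorem tendsto_evol_of_tendsto_oscOp {ι : Type*} {l : Filter ι} {S : ι → K →L[ℂ] K}
    (hR : IsSelfAdjoint R) (hi : Function.Injective R)
    (hS : ∀ᶠ i in l, IsSelfAdjoint (S i) ∧ Function.Injective (S i))
    (h1 : ∀ x, Tendsto (fun i => S i x) l (𝓝 (R x))) {t : ℝ}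
    (h2 : ∀ x, Tendsto (fun i => oscOp (S i) t x) l (𝓝 (oscOp R t x)))
    {τ : ι → ℝ} {ξ : ι → K} {x : K} (hτ : Tendsto τ l (𝓝 t)) (hξ : Tendsto ξ l (𝓝 x)) :
    Tendsto (fun i => evol (S i) (τ i) (ξ i)) l (𝓝 (evol R t x)) := by
  rw [Metric.tendsto_nhds]
  intro ε hε
  -- The vector x is near R y, hence near S_i y; on these ranges the propagators are the operators
  -- `oscOp`.
  obtain ⟨y, hy⟩ := (denseRange_of_injective hR hi).exists_dist_lt x (show 0 < ε / 10 by positivity)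
  rw [dist_eq_norm] at hy
  have e1 := (Metric.tendsto_nhds.1 (h1 y)) (ε / 10) (by positivity)
  have e2 := (Metric.tendsto_nhds.1 (h2 y)) (ε / 10) (by positivity)
  have e3 := (Metric.tendsto_nhds.1 hξ) (ε / 10) (by positivity)
  have hm : Tendsto (fun i => |τ i - t| * ‖y‖) l (𝓝 0) := by
    have := ((hτ.sub_const t).abs).mul_const ‖y‖
    simpa using this
  have e4 := hm.eventually_lt_const (show 0 < ε / 10 by positivity)
  filter_upwards [hS, e1, e2, e3, e4] with i hi' d1 d2 d3 d4
  obtain ⟨hs, hsi⟩ := hi'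
  rw [dist_eq_norm] at d1 d2 d3 ⊢
  have k1 : ‖evol (S i) (τ i) (ξ i) - evol (S i) (τ i) x‖ < ε / 10 := by
    rw [← map_sub, norm_evol hs hsi]; exact d3
  have k2 := norm_evol_sub_le hs hsi (τ i) t x y
  have k4 : ‖x - S i y‖ ≤ ε / 10 + ε / 10 := by
    calc ‖x - S i y‖ = ‖(x - R y) - (S i y - R y)‖ := by congr 1; abel
      _ ≤ _ := (norm_sub_le _ _).trans (add_le_add hy.le d1.le)
  have k3 : ‖evol (S i) t x - evol R t x‖ ≤ 2 * (ε / 10) + ε / 10 + ε / 10 := by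
    have : evol (S i) t x - evol R t x = evol (S i) t (x - S i y) +
        (oscOp (S i) t y - oscOp R t y) - evol R t (x - R y) := by
      rw [map_sub, map_sub, evol_apply hs hsi, evol_apply hR hi]; abel
    rw [this]
    refine (norm_sub_le _ _).trans (add_le_add ((norm_add_le _ _).trans (add_le_add ?_ d2.le)) ?_)
    · rw [norm_evol hs hsi]; linarith
    · rw [norm_evol hR hi]; exact hy.le
  calc ‖evol (S i) (τ i) (ξ i) - evol R t x‖
      = ‖(evol (S i) (τ i) (ξ i) - evol (S i) (τ i) x) + (evol (S i) (τ i) x - evol (S i) t x)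
        + (evol (S i) t x - evol R t x)‖ := by congr 1; abel
    _ ≤ ‖evol (S i) (τ i) (ξ i) - evol (S i) (τ i) x‖ + ‖evol (S i) (τ i) x - evol (S i) t x‖
        + ‖evol (S i) t x - evol R t x‖ := norm_add₃_le
    _ < ε := by linarith

theorem continuous_evol (hR : IsSelfAdjoint R) (hi : Function.Injective R) :
    Continuous fun p : ℝ × K => evol R p.1 p.2 := by
  rw [continuous_iff_continuousAt]
  intro p
  exact tendsto_evol_of_tendsto_oscOp (l := 𝓝 p) (S := fun _ => R) hR hi
    (Eventually.of_forall fun _ => ⟨hR, hi⟩) (fun _ => tendsto_const_nhds)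
    (fun _ => tendsto_const_nhds) (continuous_fst.tendsto p) (continuous_snd.tendsto p)

/-- For x = R y the second-order remainder suffices. For general x, approximation by R y costs two
terms of size c|s - t|/4, because the difference quotients on the range of R are uniformly bounded.
-/
theorem hasDerivAt_evol (hR : IsSelfAdjoint R) (hi : Function.Injective R) (x : K) (t : ℝ) :
    HasDerivAt (fun s => evol R s (R x)) (-Complex.I • evol R t x) t := by
  rw [hasDerivAt_iff_isLittleO, Asymptotics.isLittleO_iff]
  intro c hc
  obtain ⟨y, hy⟩ := (denseRange_of_injective hR hi).exists_dist_lt x (show 0 < c / 4 by positivity)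
  rw [dist_eq_norm] at hy
  have hm : Tendsto (fun s => 2 * |s - t| * ‖y‖) (𝓝 t) (𝓝 0) := by
    have : Continuous fun s => 2 * |s - t| * ‖y‖ := by fun_prop
    simpa using this.tendsto t
  filter_upwards [hm.eventually_lt_const (show 0 < c / 4 by positivity)] with s hs
  have h : evol R s (R x) - evol R t (R x) - (s - t) • -Complex.I • evol R t x =
      (oscOp R s - oscOp R t) (x - R y) + (s - t) • Complex.I • evol R t (x - R y) +
      ((oscOp R s - oscOp R t) * R + (((s - t : ℝ) : ℂ) * Complex.I) • oscOp R t) y := by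
    simp only [sub_apply, add_apply,
      mul_apply_eq_comp, smul_apply, map_sub,
      evol_apply hR hi, mul_smul, Complex.coe_smul, neg_smul, smul_neg, smul_sub]
    abel
  rw [h]
  have a1 : ‖(oscOp R s - oscOp R t) (x - R y)‖ ≤ |s - t| * (c / 4) :=
    ((oscOp R s - oscOp R t).le_opNorm _).trans
      (mul_le_mul (norm_oscOp_sub_le hR s t) hy.le (norm_nonneg _) (abs_nonneg _))
  have a2 : ‖(s - t) • Complex.I • evol R t (x - R y)‖ ≤ |s - t| * (c / 4) := by
    rw [norm_smul, norm_smul, Complex.norm_I, one_mul, norm_evol hR hi, Real.norm_eq_abs]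
    gcongr
  have a3 : ‖((oscOp R s - oscOp R t) * R + (((s - t : ℝ) : ℂ) * Complex.I) • oscOp R t) y‖ ≤
      2 * (s - t) ^ 2 * ‖y‖ :=
    (ContinuousLinearMap.le_opNorm _ _).trans (by gcongr; exact norm_oscOp_increment_le hR s t)
  have a4 : 2 * (s - t) ^ 2 * ‖y‖ ≤ |s - t| * (c / 4) := by
    rw [← sq_abs]
    nlinarith [abs_nonneg (s - t)]
  rw [Real.norm_eq_abs]
  refine norm_add₃_le.trans ?_
  nlinarith [abs_nonneg (s - t)]

/-- Continuous functional calculus is continuous for strong convergence of self-adjoint operators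
that are uniformly bounded. -/
theorem tendsto_cfc_of_strong {ι : Type*} {l : Filter ι} {S : ι → K →L[ℂ] K} {C : ℝ}
    (hR : IsSelfAdjoint R) (hRC : ‖R‖ ≤ C)
    (hS : ∀ᶠ i in l, IsSelfAdjoint (S i) ∧ ‖S i‖ ≤ C)
    (h1 : ∀ x, Tendsto (fun i => S i x) l (𝓝 (R x))) {f : ℂ → ℂ} (hf : Continuous f) (x : K) :
    Tendsto (fun i => cfc f (S i) x) l (𝓝 (cfc f R x)) := by
  have hC : 0 ≤ C := (norm_nonneg _).trans hRC
  have hpow (n : ℕ) (x : K) : Tendsto (fun i => (S i ^ n) x) l (𝓝 ((R ^ n) x)) := by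
    induction n generalizing x with
    | zero => simpa using tendsto_const_nhds
    | succ n ih =>
      simp_rw [pow_succ']
      have e1 := (ih x)
      rw [tendsto_iff_norm_sub_tendsto_zero] at e1 ⊢
      have e2 := h1 ((R ^ n) x)
      rw [tendsto_iff_norm_sub_tendsto_zero] at e2
      have e3 := (e1.const_mul C).add e2
      rw [mul_zero, add_zero] at e3
      refine squeeze_zero' (Eventually.of_forall fun _ => norm_nonneg _) ?_ e3
      filter_upwards [hS] with i hi
      simp only [mul_apply_eq_comp]
      calc ‖S i ((S i ^ n) x) - R ((R ^ n) x)‖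
          = ‖S i ((S i ^ n) x - (R ^ n) x) + (S i ((R ^ n) x) - R ((R ^ n) x))‖ := by
            rw [map_sub]; congr 1; abel
        _ ≤ _ := (norm_add_le _ _).trans (by
            gcongr
            exact ((S i).le_opNorm _).trans (by gcongr; exact hi.2))
  have hpoly (p : Polynomial ℂ) (x : K) :
      Tendsto (fun i => Polynomial.aeval (S i) p x) l (𝓝 (Polynomial.aeval R p x)) := by
    induction p using Polynomial.induction_on' with
    | add p q hp hq => simpa using hp.add hq
    | monomial n c =>
      simp only [Polynomial.aeval_monomial, mul_apply_eq_comp,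
        Algebra.algebraMap_eq_smul_one, smul_apply,
        one_apply_eq_self]
      exact (hpow n x).const_smul c
  -- Weierstrass approximation of the real and imaginary parts on [-C, C], which contains the
  -- spectra of all the operators involved.
  have happrox : ∀ δ > 0, ∃ p : Polynomial ℂ, ∀ r : ℝ, |r| ≤ C → ‖p.eval (r : ℂ) - f r‖ ≤ δ := by
    intro δ hδ
    obtain ⟨p, hp⟩ := exists_polynomial_near_of_continuousOn (-C) C (fun r => (f r).re)
      (by fun_prop) (δ / 2) (by positivity)
    obtain ⟨q, hq⟩ := exists_polynomial_near_of_continuousOn (-C) C (fun r => (f r).im)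
      (by fun_prop) (δ / 2) (by positivity)
    refine ⟨p.map Complex.ofRealHom + Polynomial.C Complex.I * q.map Complex.ofRealHom,
      fun r hr => ?_⟩
    have e1 := hp r (abs_le.1 hr)
    have e2 := hq r (abs_le.1 hr)
    have ev (p : Polynomial ℝ) : (p.map Complex.ofRealHom).eval (r : ℂ) = (p.eval r : ℝ) := by
      rw [Polynomial.eval_map]
      exact Polynomial.eval₂_at_apply Complex.ofRealHom r
    simp only [Polynomial.eval_add, Polynomial.eval_mul, Polynomial.eval_C, ev]
    refine (Complex.norm_le_abs_re_add_abs_im _).trans ?_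
    simp
    linarith
  have hdiff (p : Polynomial ℂ) (δ : ℝ) (hδ : 0 ≤ δ)
      (hp : ∀ r : ℝ, |r| ≤ C → ‖p.eval (r : ℂ) - f r‖ ≤ δ) (A : K →L[ℂ] K)
      (hA : IsSelfAdjoint A) (hAC : ‖A‖ ≤ C) (x : K) :
      ‖Polynomial.aeval A p x - cfc f A x‖ ≤ δ * ‖x‖ := by
    have := hA.isStarNormal
    have e : ‖Polynomial.aeval A p - cfc f A‖ ≤ δ := by
      rw [← cfc_polynomial p A, ← cfc_sub _ _ A (by fun_prop) hf.continuousOn]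
      refine norm_cfc_le hδ fun z hz => ?_
      rw [hA.mem_spectrum_eq_re hz]
      refine hp _ ((Complex.abs_re_le_norm z).trans ((spectrum.norm_le_norm_mul_of_mem hz).trans ?_))
      calc ‖A‖ * ‖(1 : K →L[ℂ] K)‖ ≤ ‖A‖ * 1 := by gcongr; exact ContinuousLinearMap.norm_id_le
        _ ≤ C := by simpa using hAC
    rw [← sub_apply]
    exact (ContinuousLinearMap.le_opNorm _ _).trans (by gcongr)
  rw [Metric.tendsto_nhds]
  intro ε hε
  have hpos : 0 < ε / (4 * (‖x‖ + 1)) := by positivity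
  obtain ⟨p, hp⟩ := happrox _ hpos
  have hsmall : ε / (4 * (‖x‖ + 1)) * ‖x‖ ≤ ε / 4 := by
    rw [div_mul_eq_mul_div, div_le_div_iff₀ (by positivity) (by positivity)]
    nlinarith [norm_nonneg x]
  filter_upwards [hS, Metric.tendsto_nhds.1 (hpoly p x) (ε / 4) (by positivity)] with i hi hd
  rw [dist_eq_norm] at hd ⊢
  have d1 := hdiff p _ hpos.le hp (S i) hi.1 hi.2 x
  have d2 := hdiff p _ hpos.le hp R hR hRC x
  calc ‖cfc f (S i) x - cfc f R x‖
      = ‖-(Polynomial.aeval (S i) p x - cfc f (S i) x) +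
        (Polynomial.aeval (S i) p x - Polynomial.aeval R p x) +
        (Polynomial.aeval R p x - cfc f R x)‖ := by congr 1; abel
    _ ≤ _ := norm_add₃_le
    _ < ε := by rw [norm_neg]; linarith

theorem tendsto_evol {ι : Type*} {l : Filter ι} {S : ι → K →L[ℂ] K} {C : ℝ}
    (hR : IsSelfAdjoint R) (hi : Function.Injective R) (hRC : ‖R‖ ≤ C)
    (hS : ∀ᶠ i in l, (IsSelfAdjoint (S i) ∧ Function.Injective (S i)) ∧ ‖S i‖ ≤ C)
    (h1 : ∀ x, Tendsto (fun i => S i x) l (𝓝 (R x)))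
    {τ : ι → ℝ} {ξ : ι → K} {x : K} {t : ℝ} (hτ : Tendsto τ l (𝓝 t)) (hξ : Tendsto ξ l (𝓝 x)) :
    Tendsto (fun i => evol (S i) (τ i) (ξ i)) l (𝓝 (evol R t x)) :=
  tendsto_evol_of_tendsto_oscOp hR hi (hS.mono fun _ h => h.1) h1
    (tendsto_cfc_of_strong hR hRC (hS.mono fun _ h => ⟨h.1.1, h.2⟩) h1 (continuous_oscSymbol t))
    hτ hξ

end UnitaryGroup


/-! ### Semilinear evolution equations -/

section GlobalODE

variable {E : Type*} [NormedAddCommGroup E] [NormedSpace ℝ E] [CompleteSpace E]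

/-- A bounded, uniformly Lipschitz, time-continuous vector field has global integral curves. -/
theorem exists_global_solution {F : ℝ → E → E} {L B : NNReal}
    (hF : ∀ t, LipschitzWith L (F t)) (hc : ∀ x, Continuous fun t => F t x)
    (hB : ∀ t x, ‖F t x‖ ≤ B) (a : E) :
    ∃ v : ℝ → E, v 0 = a ∧ ∀ t, HasDerivAt v (F t (v t)) t := by
  have hloc (n : ℕ) : ∃ α : ℝ → E, α 0 = a ∧
      ∀ t ∈ Icc (-(n + 1 : ℝ)) (n + 1), HasDerivWithinAt α (F t (α t)) (Icc (-(n + 1 : ℝ)) (n + 1)) t := by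
    have h0 : (0 : ℝ) ∈ Icc (-(n + 1 : ℝ)) (n + 1) := ⟨by linarith [n.cast_nonneg (α := ℝ)], by positivity⟩
    -- The speed is at most B, so the ball of radius B(n + 1) is not left within time n + 1.
    have hPL : IsPicardLindelof F (⟨0, h0⟩ : Icc (-(n + 1 : ℝ)) (n + 1)) a (B * (n + 1)) 0 B L :=
      { lipschitzOnWith := fun t _ => (hF t).lipschitzOnWith
        continuousOn := fun x _ => (hc x).continuousOn
        norm_le := fun t _ x _ => hB t x
        mul_max_le := by simp }
    exact hPL.exists_eq_forall_mem_Icc_hasDerivWithinAt (by simp)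
  choose α hα0 hα using hloc
  have hder (n : ℕ) (t : ℝ) (ht : |t| < n + 1) : HasDerivAt (α n) (F t (α n t)) t := by
    rw [abs_lt] at ht
    exact (hα n t ⟨ht.1.le, ht.2.le⟩).hasDerivAt (Icc_mem_nhds ht.1 ht.2)
  have hagree (n m : ℕ) (hnm : n ≤ m) (t : ℝ) (ht : |t| < n + 1) : α n t = α m t := by
    have hnm' : (n : ℝ) ≤ m := by exact_mod_cast hnm
    have hsub : Icc (-(n + 1 : ℝ)) (n + 1) ⊆ Icc (-(m + 1 : ℝ)) (m + 1) :=
      Icc_subset_Icc (by linarith) (by linarith)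
    have := ODE_solution_unique_of_mem_Icc (v := F) (s := fun _ => univ) (K := L) (t₀ := 0)
      (f := α n) (g := α m) (a := -(n + 1 : ℝ)) (b := n + 1)
      (fun t _ => (hF t).lipschitzOnWith) ⟨by linarith [n.cast_nonneg (α := ℝ)], by positivity⟩
      (fun t ht => (hα n t ht).continuousWithinAt)
      (fun t ht => hder n t (abs_lt.2 ht)) (fun _ _ => mem_univ _)
      (fun t ht => ((hα m t (hsub ht)).mono hsub).continuousWithinAt)
      (fun t ht => hder m t ((abs_lt.2 ht).trans_le (by linarith))) (fun _ _ => mem_univ _)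
      (by rw [hα0, hα0])
    exact this (Ioo_subset_Icc_self (abs_lt.1 ht))
  -- The interval of index ⌊|t|⌋ has t in its interior. For s near t the index is at most ⌊|t|⌋ + 1,
  -- so by uniqueness the glued curve coincides there with one local solution.
  refine ⟨fun t => α ⌊|t|⌋₊ t, by simp [hα0], fun t => ?_⟩
  have hev : (fun s => α ⌊|s|⌋₊ s) =ᶠ[𝓝 t] α (⌊|t|⌋₊ + 2) := by
    have : ∀ᶠ s in 𝓝 t, |s| < |t| + 1 :=
      continuous_abs.continuousAt.eventually_lt continuousAt_const (by simp)
    filter_upwards [this] with s hs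
    refine hagree _ _ ?_ s (Nat.lt_floor_add_one _)
    have : ⌊|s|⌋₊ ≤ ⌊|t| + 1⌋₊ := Nat.floor_mono hs.le
    rw [Nat.floor_add_one (abs_nonneg t)] at this
    omega
  have hlt : |t| < ((⌊|t|⌋₊ + 2 : ℕ) : ℝ) + 1 := by
    have := Nat.lt_floor_add_one |t|
    push_cast
    linarith
  have h := (hder (⌊|t|⌋₊ + 2) t hlt).congr_of_eventuallyEq hev
  rwa [← hev.eq_of_nhds] at h

end GlobalODE

/-! ### The semilinear equation in the interaction picture: well-posedness and stability. -/

section Semilinear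

variable {K : Type*} [NormedAddCommGroup K] [InnerProductSpace ℂ K]

/-- Radial projection onto the ball of radius `ρ`. -/
def radialProj (ρ : ℝ) (x : K) : K := ((ρ / max ρ ‖x‖ : ℝ) : ℂ) • x

theorem norm_radialProj_le {ρ : ℝ} (hρ : 0 < ρ) (x : K) : ‖radialProj ρ x‖ ≤ ρ := by
  have hm : 0 < max ρ ‖x‖ := lt_max_of_lt_left hρ
  rw [radialProj, norm_smul, Complex.norm_real, Real.norm_of_nonneg (by positivity),
    div_mul_eq_mul_div, div_le_iff₀ hm]
  gcongr
  exact le_max_right _ _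

theorem radialProj_of_le {ρ : ℝ} (hρ : 0 < ρ) {x : K} (hx : ‖x‖ ≤ ρ) : radialProj ρ x = x := by
  rw [radialProj, max_eq_left hx, div_self hρ.ne']; simp

/-- The vector and the scaling factor are varied in turn, and each contributes at most ‖x - y‖. -/
theorem lipschitzWith_radialProj {ρ : ℝ} (hρ : 0 < ρ) :
    LipschitzWith 2 (radialProj ρ : K → K) := by
  refine LipschitzWith.of_dist_le_mul fun x y => ?_
  rw [dist_eq_norm, dist_eq_norm]
  set a := max ρ ‖x‖
  set b := max ρ ‖y‖
  have ha : 0 < a := lt_max_of_lt_left hρ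
  have hb : 0 < b := lt_max_of_lt_left hρ
  have h : radialProj ρ x - radialProj ρ y =
      ((ρ / a : ℝ) : ℂ) • (x - y) + ((ρ / a - ρ / b : ℝ) : ℂ) • y := by
    simp only [radialProj]
    push_cast
    simp only [smul_sub, sub_smul]
    abel
  have hab : |b - a| ≤ ‖x - y‖ := by
    have := abs_max_sub_max_le_abs ρ ‖y‖ ρ
    calc |b - a| ≤ |‖y‖ - ‖x‖| := by
          have := abs_max_sub_max_le_max ρ ‖y‖ ρ ‖x‖
          simpa using this
      _ ≤ ‖y - x‖ := abs_norm_sub_norm_le _ _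
      _ = ‖x - y‖ := norm_sub_rev _ _
  have h1 : ρ / a ≤ 1 := (div_le_one ha).2 (le_max_left _ _)
  have h2 : ‖y‖ / b ≤ 1 := (div_le_one hb).2 (le_max_right _ _)
  rw [h]
  refine (norm_add_le _ _).trans ?_
  rw [norm_smul, norm_smul, Complex.norm_real, Complex.norm_real, Real.norm_eq_abs,
    Real.norm_eq_abs, abs_of_nonneg (show 0 ≤ ρ / a by positivity)]
  have e : |ρ / a - ρ / b| * ‖y‖ = (ρ / a) * (‖y‖ / b) * |b - a| := by
    have : ρ / a - ρ / b = ρ / (a * b) * (b - a) := by field_simp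
    rw [this, abs_mul, abs_of_nonneg (by positivity)]
    field_simp
  rw [e]
  have e2 : (ρ / a) * (‖y‖ / b) ≤ 1 := mul_le_one₀ h1 (by positivity) h2
  have e3 : (ρ / a) * (‖y‖ / b) * |b - a| ≤ 1 * ‖x - y‖ :=
    mul_le_mul e2 hab (abs_nonneg _) zero_le_one
  have e4 : ρ / a * ‖x - y‖ ≤ 1 * ‖x - y‖ := by gcongr
  simp only [NNReal.coe_ofNat]
  linarith

/-- `u` solves `i ∂ₜu = R⁻¹ u + N(u)`, `u(0) = a` weakly. -/
def IsWeakSolution (R : K →L[ℂ] K) (N : K → K) (a : K) (u : ℝ → K) : Prop :=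
  Continuous u ∧ u 0 = a ∧ ∀ x t, HasDerivAt (fun s => inner ℂ (R x) (u s))
    (-Complex.I * (inner ℂ x (u t) + inner ℂ (R x) (N (u t)))) t

/-- Nonlinearities that are Lipschitz on balls and conserve the norm. -/
structure IsConservative (N : K → K) : Prop where
  lipschitz : ∀ ρ : ℝ, ∃ L : NNReal, LipschitzOnWith L N (Metric.closedBall 0 ρ)
  real : ∀ x, (inner ℂ x (N x)).im = 0

theorem IsConservative.continuous {N : K → K} (hN : IsConservative N) : Continuous N := by
  rw [continuous_iff_continuousAt]
  intro x
  obtain ⟨L, hL⟩ := hN.lipschitz (‖x‖ + 1)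
  refine hL.continuousOn.continuousAt (mem_of_superset (Metric.ball_mem_nhds x one_pos) ?_)
  intro y hy
  rw [Metric.mem_ball, dist_eq_norm] at hy
  rw [mem_closedBall_zero_iff]
  have := norm_sub_norm_le y x
  linarith

/-- A product rule for u merely continuous: freezing g at time t isolates the weak derivative, and
the difference quotient of g is paired with u(s) → u(t). -/
theorem hasDerivAt_inner_of_weak {g : ℝ → K} {g' : K} {u : ℝ → K} {c : ℂ} {t : ℝ}
    (hg : HasDerivAt g g' t) (hu : ContinuousAt u t)
    (hw : HasDerivAt (fun s => inner ℂ (g t) (u s)) c t) :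
    HasDerivAt (fun s => inner ℂ (g s) (u s)) (inner ℂ g' (u t) + c) t := by
  have h1 : HasDerivAt (fun s => inner ℂ (g s - g t) (u s)) (inner ℂ g' (u t)) t := by
    rw [hasDerivAt_iff_tendsto_slope] at hg ⊢
    have := hg.inner (𝕜 := ℂ) (hu.tendsto.mono_left (nhdsWithin_le_nhds (s := {t}ᶜ)))
    refine this.congr fun s => ?_
    simp only [slope, vsub_eq_sub, sub_self, inner_zero_left, sub_zero]
    rw [inner_smul_left_eq_smul]
  refine (h1.add hw).congr_of_eventuallyEq (Eventually.of_forall fun s => ?_)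
  simp

variable [CompleteSpace K] {R : K →L[ℂ] K} {N : K → K} {a : K}

/-- The vector field of the equation in the interaction picture. -/
def interactionField (R : K →L[ℂ] K) (N : K → K) (t : ℝ) (x : K) : K :=
  -Complex.I • evol R (-t) (N (evol R t x))

theorem lipschitzOnWith_interactionField (hR : IsSelfAdjoint R) (hi : Function.Injective R)
    {ρ : ℝ} {L : NNReal} (hL : LipschitzOnWith L N (Metric.closedBall 0 ρ)) (t : ℝ) :
    LipschitzOnWith L (interactionField R N t) (Metric.closedBall 0 ρ) := by
  refine LipschitzOnWith.of_dist_le_mul fun x hx y hy => ?_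
  rw [mem_closedBall_zero_iff] at hx hy
  rw [dist_eq_norm, interactionField, interactionField, ← smul_sub, ← map_sub, norm_smul,
    norm_evol hR hi, norm_neg, Complex.norm_I, one_mul, ← dist_eq_norm]
  refine (hL.dist_le_mul _ ?_ _ ?_).trans ?_
  · rwa [mem_closedBall_zero_iff, norm_evol hR hi]
  · rwa [mem_closedBall_zero_iff, norm_evol hR hi]
  · rw [dist_eq_norm, ← map_sub, norm_evol hR hi, ← dist_eq_norm]

/-- With U = exp(-itR⁻¹), the derivative of ‖v‖² is twice the imaginary part of ⟨Uv, N(Uv)⟩. -/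
theorem norm_eq_of_interaction (hR : IsSelfAdjoint R) (hi : Function.Injective R)
    (hN : ∀ x, (inner ℂ x (N x)).im = 0) {v : ℝ → K} (h0 : v 0 = a)
    (hv : ∀ t, HasDerivAt v (interactionField R N t (v t)) t) (t : ℝ) : ‖v t‖ = ‖a‖ := by
  have hd (t : ℝ) : HasDerivAt (fun s => inner ℂ (v s) (v s)) 0 t := by
    have h1 := (hv t).inner ℂ (hv t)
    have h2 : inner ℂ (v t) (interactionField R N t (v t)) +
        inner ℂ (interactionField R N t (v t)) (v t) = 0 := by
      rw [← inner_conj_symm (interactionField R N t (v t)) (v t), Complex.add_conj,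
        interactionField, inner_smul_right]
      have h3 := inner_evol_left hR hi t (v t) (N (evol R t (v t)))
      rw [← h3]
      have h4 := hN (evol R t (v t))
      simp [Complex.mul_re, h4]
    rwa [h2] at h1
  have hconst : inner ℂ (v t) (v t) = inner ℂ (v 0) (v 0) :=
    is_const_of_deriv_eq_zero (fun s => (hd s).differentiableAt) (fun s => (hd s).deriv) t 0
  rw [h0, inner_self_eq_norm_sq_to_K, inner_self_eq_norm_sq_to_K] at hconst
  have h5 : ‖v t‖ ^ 2 = ‖a‖ ^ 2 := by exact_mod_cast hconst
  exact (sq_eq_sq₀ (norm_nonneg _) (norm_nonneg _)).1 h5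

/-- Weak solutions become strong ones. Tested against the dense range of R, the curve exp(isR⁻¹)
u(s) has the continuous derivative f(s); it is therefore a plus the integral of f (Duhamel's
formula), and this is differentiable in norm. -/
theorem interaction_of_weak (hR : IsSelfAdjoint R) (hi : Function.Injective R)
    (hN : Continuous N) {u : ℝ → K} (hu : IsWeakSolution R N a u) (t : ℝ) :
    HasDerivAt (fun s => evol R (-s) (u s))
      (interactionField R N t (evol R (-t) (u t))) t := by
  obtain ⟨huc, hu0, hud⟩ := hu
  have hF (s : ℝ) : interactionField R N s (evol R (-s) (u s)) =
      -Complex.I • evol R (-s) (N (u s)) := by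
    rw [interactionField, evol_evol_neg hR hi]
  have hFc : Continuous fun s => interactionField R N s (evol R (-s) (u s)) := by
    simp_rw [hF]
    exact ((continuous_evol hR hi).comp
      (continuous_neg.prodMk (hN.comp huc))).const_smul (-Complex.I)
  set f : ℝ → K := fun s => interactionField R N s (evol R (-s) (u s)) with hf
  have hInt (t : ℝ) : HasDerivAt (fun s => ∫ r in (0 : ℝ)..s, f r) (f t) t :=
    intervalIntegral.integral_hasDerivAt_right (hFc.intervalIntegrable _ _)
      (hFc.stronglyMeasurableAtFilter _ _) hFc.continuousAt
  have hd (x : K) (t : ℝ) : HasDerivAt (fun s => inner ℂ (R x) (evol R (-s) (u s)))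
      (inner ℂ (R x) (f t)) t := by
    have h1 := hasDerivAt_inner_of_weak (hasDerivAt_evol hR hi x t) huc.continuousAt
      (c := -Complex.I * (inner ℂ (evol R t x) (u t) + inner ℂ (R (evol R t x)) (N (u t)))) (by
        have := hud (evol R t x) t
        rwa [← evol_comm hR hi] at this ⊢)
    have h2 : (fun s => inner ℂ (R x) (evol R (-s) (u s))) =
        fun s => inner ℂ (evol R s (R x)) (u s) := by
      funext s; rw [inner_evol_left hR hi]
    rw [h2]
    convert h1 using 1
    rw [hf]
    simp only [hF]
    rw [inner_smul_right, ← inner_evol_left hR hi, evol_comm hR hi, inner_smul_left]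
    simp only [map_neg, Complex.conj_I]
    ring
  have hz (t : ℝ) : evol R (-t) (u t) = a + ∫ r in (0 : ℝ)..t, f r := by
    rw [← sub_eq_zero]
    have horth (x : K) : inner ℂ (R x) (evol R (-t) (u t) - (a + ∫ r in (0 : ℝ)..t, f r)) = 0 := by
      have h1 (t : ℝ) : HasDerivAt (fun s => inner ℂ (R x) (evol R (-s) (u s)) -
          inner ℂ (R x) (∫ r in (0 : ℝ)..s, f r)) 0 t := by
        have h2 := (hasDerivAt_const t (R x)).inner ℂ (hInt t)
        simp only [inner_zero_left, add_zero] at h2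
        have h3 := (hd x t).sub h2
        rw [sub_self] at h3
        exact h3
      have h3 := is_const_of_deriv_eq_zero (fun s => (h1 s).differentiableAt)
        (fun s => (h1 s).deriv) t 0
      simp only [neg_zero, evol_zero hR hi, hu0, intervalIntegral.integral_same,
        inner_zero_right, sub_zero] at h3
      rw [inner_sub_right, inner_add_right, ← h3]
      ring
    refine (denseRange_of_injective hR hi).induction_on
      (p := fun y => inner ℂ y (evol R (-t) (u t) - (a + ∫ r in (0 : ℝ)..t, f r)) = 0)
      _ (isClosed_eq (by fun_prop) (by fun_prop)) horth |> inner_self_eq_zero.1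
  have : (fun s => evol R (-s) (u s)) = fun s => a + ∫ r in (0 : ℝ)..s, f r := funext hz
  rw [this]
  exact (hInt t).const_add a

/-- The group is moved onto the test vector, where it is differentiable because the vector lies in
the range of R. -/
theorem weak_of_interaction (hR : IsSelfAdjoint R) (hi : Function.Injective R)
    {v : ℝ → K} (h0 : v 0 = a) (hv : ∀ t, HasDerivAt v (interactionField R N t (v t)) t) :
    IsWeakSolution R N a fun t => evol R t (v t) := by
  have hvc : Continuous v := continuous_iff_continuousAt.2 fun t => (hv t).continuousAt
  have huc : Continuous fun t => evol R t (v t) := by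
    have := (continuous_evol hR hi).comp (continuous_id.prodMk hvc)
    exact this
  refine ⟨huc, by simp [evol_zero hR hi, h0], fun x t => ?_⟩
  have h2 : (fun s => inner ℂ (R x) (evol R s (v s))) =
      fun s => inner ℂ (evol R (-s) (R x)) (v s) := by
    funext s; rw [inner_evol_left hR hi, neg_neg]
  rw [h2]
  have h3 : HasDerivAt (fun s => evol R (-s) (R x)) (Complex.I • evol R (-t) x) t := by
    have := (hasDerivAt_evol hR hi x (-t)).scomp t (hasDerivAt_neg t)
    rw [neg_one_smul, neg_smul, neg_neg] at this
    exact this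
  refine (h3.inner ℂ (hv t)).congr_deriv ?_
  simp only [interactionField]
  rw [inner_smul_right, inner_smul_left, inner_evol_left hR hi, neg_neg,
    inner_evol_left hR hi, neg_neg, evol_evol_neg hR hi]
  simp only [Complex.conj_I]
  ring

theorem IsWeakSolution.norm_eq (hR : IsSelfAdjoint R) (hi : Function.Injective R)
    (hN : IsConservative N) {u : ℝ → K} (hu : IsWeakSolution R N a u) (t : ℝ) :
    ‖u t‖ = ‖a‖ := by
  have := norm_eq_of_interaction hR hi hN.real (a := a) (v := fun s => evol R (-s) (u s))
    (by simp [evol_zero hR hi, hu.2.1]) (interaction_of_weak hR hi hN.continuous hu) t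
  rwa [norm_evol hR hi] at this

/-- Conservation of the norm keeps both interaction curves in one ball, on which the field is
Lipschitz. -/
theorem IsWeakSolution.unique (hR : IsSelfAdjoint R) (hi : Function.Injective R)
    (hN : IsConservative N) {u u' : ℝ → K} (hu : IsWeakSolution R N a u)
    (hu' : IsWeakSolution R N a u') : u' = u := by
  obtain ⟨L, hL⟩ := hN.lipschitz ‖a‖
  have key (w : ℝ → K) (hw : IsWeakSolution R N a w) (t : ℝ) :
      HasDerivAt (fun s => evol R (-s) (w s)) (interactionField R N t (evol R (-t) (w t))) t ∧
        evol R (-t) (w t) ∈ Metric.closedBall (0 : K) ‖a‖ :=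
    ⟨interaction_of_weak hR hi hN.continuous hw t, by
      rw [mem_closedBall_zero_iff, norm_evol hR hi, hw.norm_eq hR hi hN]⟩
  have h := ODE_solution_unique_univ (t₀ := 0) (lipschitzOnWith_interactionField hR hi hL)
    (key u' hu') (key u hu) (by simp [hu.2.1, hu'.2.1])
  funext t
  have := congrArg (evol R t) (congrFun h t)
  simpa [evol_evol_neg hR hi] using this

/-- Composition with the radial projection makes the field bounded and globally Lipschitz. The
truncated nonlinearity still conserves the norm, so its solution keeps norm ‖a‖ < ρ and never meets
the truncation. -/
theorem exists_isWeakSolution (hR : IsSelfAdjoint R) (hi : Function.Injective R)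
    (hN : IsConservative N) (a : K) : ∃ u, IsWeakSolution R N a u := by
  set ρ := ‖a‖ + 1
  have hρ : 0 < ρ := by positivity
  obtain ⟨L, hL⟩ := hN.lipschitz ρ
  set M : K → K := fun x => N (radialProj ρ x) with hM
  have hmem (x : K) : radialProj ρ x ∈ Metric.closedBall (0 : K) ρ :=
    mem_closedBall_zero_iff.2 (norm_radialProj_le hρ x)
  have hMlip : LipschitzWith (L * 2) M := by
    have := hL.comp (lipschitzWith_radialProj hρ).lipschitzOnWith (s := univ) (fun x _ => hmem x)
    exact lipschitzOnWith_univ.1 this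
  -- The projection multiplies by a positive real number, which does not affect the vanishing of the
  -- imaginary part.
  have hMreal (x : K) : (inner ℂ x (M x)).im = 0 := by
    have h1 := hN.real (radialProj ρ x)
    have hc : 0 < ρ / max ρ ‖x‖ := div_pos hρ (lt_max_of_lt_left hρ)
    rw [radialProj, inner_smul_left, Complex.conj_ofReal, Complex.im_ofReal_mul] at h1
    exact (mul_eq_zero.1 h1).resolve_left hc.ne'
  have hMb (x : K) : ‖M x‖ ≤ L * (ρ + ρ) + ‖N 0‖ := by
    have h1 := hL.dist_le_mul _ (hmem x) 0 (by simp [hρ.le])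
    rw [dist_eq_norm, dist_eq_norm, sub_zero] at h1
    have h2 := norm_radialProj_le hρ x
    have h3 : (L : ℝ) * ‖radialProj ρ x‖ ≤ L * (ρ + ρ) := by gcongr; linarith
    have h4 := norm_sub_norm_le (N (radialProj ρ x)) (N 0)
    have : M x = N (radialProj ρ x) := rfl
    rw [this]
    linarith
  have hBnn : 0 ≤ L * (ρ + ρ) + ‖N 0‖ := by positivity
  obtain ⟨v, hv0, hv⟩ := exists_global_solution (F := interactionField R M) (L := L * 2)
    (B := ⟨_, hBnn⟩) (a := a)
    (fun t => by
      refine LipschitzWith.of_dist_le_mul fun x y => ?_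
      rw [dist_eq_norm, interactionField, interactionField, ← smul_sub, ← map_sub, norm_smul,
        norm_evol hR hi, norm_neg, Complex.norm_I, one_mul, ← dist_eq_norm]
      refine (hMlip.dist_le_mul _ _).trans ?_
      rw [dist_eq_norm, ← map_sub, norm_evol hR hi, ← dist_eq_norm])
    (fun x => ((continuous_evol hR hi).comp (continuous_neg.prodMk
      (hMlip.continuous.comp ((continuous_evol hR hi).comp
        (continuous_id.prodMk continuous_const))))).const_smul (-Complex.I))
    (fun t x => by
      rw [interactionField, norm_smul, norm_neg, Complex.norm_I, one_mul, norm_evol hR hi]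
      exact hMb _)
  have hnorm := norm_eq_of_interaction hR hi hMreal hv0 hv
  refine ⟨_, weak_of_interaction hR hi hv0 fun t => ?_⟩
  have : interactionField R N t (v t) = interactionField R M t (v t) := by
    simp only [interactionField, hM]
    rw [radialProj_of_le hρ]
    rw [norm_evol hR hi, hnorm]
    exact le_add_of_nonneg_right zero_le_one
  rw [this]
  exact hv t

/-- Joint convergence in index and time is locally uniform convergence, which is uniform on compact
sets. It applies because propagators converge also along moving times. -/
theorem tendstoUniformlyOn_of_continuous_convergence {ι E : Type*} [NormedAddCommGroup E]
    {l : Filter ι} {f : ι → ℝ → E} {g : ℝ → E} {s : Set ℝ} (hs : IsCompact s) (hg : Continuous g)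
    (h : ∀ t, Tendsto (fun p : ι × ℝ => f p.1 p.2) (l ×ˢ 𝓝 t) (𝓝 (g t))) :
    TendstoUniformlyOn f g l s := by
  rw [← tendstoLocallyUniformlyOn_iff_tendstoUniformlyOn_of_compact hs,
    tendstoLocallyUniformlyOn_iff_forall_tendsto]
  intro t _
  have h1 : Tendsto (fun p : ι × ℝ => g p.2) (l ×ˢ 𝓝 t) (𝓝 (g t)) :=
    (hg.tendsto t).comp tendsto_snd
  have h2 := (h1.prodMk_nhds (h t)).mono_left
    (prod_mono le_rfl (nhdsWithin_le_nhds (a := t) (s := s)))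
  exact h2.mono_right (nhds_le_uniformity (g t))

theorem tendstoUniformlyOn_evol {ι : Type*} {l : Filter ι} {S : ι → K →L[ℂ] K} {C : ℝ}
    (hR : IsSelfAdjoint R) (hi : Function.Injective R) (hRC : ‖R‖ ≤ C)
    (hS : ∀ᶠ i in l, (IsSelfAdjoint (S i) ∧ Function.Injective (S i)) ∧ ‖S i‖ ≤ C)
    (h1 : ∀ x, Tendsto (fun i => S i x) l (𝓝 (R x))) {v : ℝ → K} (hv : Continuous v) (T : ℝ) :
    TendstoUniformlyOn (fun i t => evol (S i) t (v t)) (fun t => evol R t (v t)) l (Icc 0 T) := by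
  have hc : Continuous fun t => evol R t (v t) := by
    have := (continuous_evol hR hi).comp (continuous_id.prodMk hv)
    exact this
  refine tendstoUniformlyOn_of_continuous_convergence isCompact_Icc hc fun t => ?_
  exact tendsto_evol (l := l ×ˢ 𝓝 t) (S := fun p : ι × ℝ => S p.1) hR hi hRC
    (tendsto_fst.eventually hS) (fun x => (h1 x).comp tendsto_fst) tendsto_snd
    ((hv.tendsto t).comp tendsto_snd)

theorem tendstoUniformlyOn_interactionField {ι : Type*} {l : Filter ι} {S : ι → K →L[ℂ] K} {C : ℝ}
    (hR : IsSelfAdjoint R) (hi : Function.Injective R) (hRC : ‖R‖ ≤ C)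
    (hS : ∀ᶠ i in l, (IsSelfAdjoint (S i) ∧ Function.Injective (S i)) ∧ ‖S i‖ ≤ C)
    (h1 : ∀ x, Tendsto (fun i => S i x) l (𝓝 (R x))) (hN : Continuous N) {v : ℝ → K}
    (hv : Continuous v) (T : ℝ) :
    TendstoUniformlyOn (fun i t => interactionField (S i) N t (v t))
      (fun t => interactionField R N t (v t)) l (Icc 0 T) := by
  have hc : Continuous fun t => evol R t (v t) := by
    have := (continuous_evol hR hi).comp (continuous_id.prodMk hv)
    exact this
  have hc' : Continuous fun t => evol R (-t) (N (evol R t (v t))) := by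
    have := (continuous_evol hR hi).comp (continuous_neg.prodMk (hN.comp hc))
    exact this
  have hc'' : Continuous fun t => interactionField R N t (v t) := hc'.const_smul (-Complex.I)
  refine tendstoUniformlyOn_of_continuous_convergence isCompact_Icc hc'' fun t => ?_
  have e1 : Tendsto (fun p : ι × ℝ => evol (S p.1) p.2 (v p.2)) (l ×ˢ 𝓝 t)
      (𝓝 (evol R t (v t))) :=
    tendsto_evol (S := fun p : ι × ℝ => S p.1) hR hi hRC
      (tendsto_fst.eventually hS) (fun x => (h1 x).comp tendsto_fst) tendsto_snd
      ((hv.tendsto t).comp tendsto_snd)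
  have e2 : Tendsto (fun p : ι × ℝ => evol (S p.1) (-p.2) (N (evol (S p.1) p.2 (v p.2))))
      (l ×ˢ 𝓝 t) (𝓝 (evol R (-t) (N (evol R t (v t))))) :=
    tendsto_evol (S := fun p : ι × ℝ => S p.1) hR hi hRC
      (tendsto_fst.eventually hS) (fun x => (h1 x).comp tendsto_fst)
      ((continuous_neg.tendsto t).comp tendsto_snd) ((hN.tendsto _).comp e1)
  exact e2.const_smul (-Complex.I)

theorem exists_gronwallBound_lt (L T : ℝ) {ε : ℝ} (hε : 0 < ε) :
    ∃ δ > 0, gronwallBound 0 L δ T < ε := by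
  have hgb : Tendsto (fun δ : ℝ => gronwallBound 0 L δ T) (𝓝 0) (𝓝 0) := by
    have hcont : Continuous fun δ : ℝ => gronwallBound 0 L δ T := by
      unfold gronwallBound
      split_ifs <;> fun_prop
    have := hcont.tendsto 0
    rwa [show gronwallBound 0 L 0 T = 0 by unfold gronwallBound; split_ifs <;> simp] at this
  have := (hgb.mono_left (nhdsWithin_le_nhds (s := Ioi 0))).eventually_lt_const hε
  obtain ⟨δ, h1, h2⟩ := (this.and (self_mem_nhdsWithin : Ioi (0 : ℝ) ∈ 𝓝[>] 0)).exists
  exact ⟨δ, h2, h1⟩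

/-- The limit curve v in its interaction picture solves the i-th interaction equation up to an error
uniformly small on [0, T]. Grönwall's inequality, with a Lipschitz constant common to all i on the
ball of radius ‖a‖, compares it with the i-th curve. Returning to u costs the uniform convergence of
the propagators along v. -/
theorem tendstoUniformlyOn_weakSolution {ι : Type*} {l : Filter ι} {S : ι → K →L[ℂ] K} {C : ℝ}
    (hR : IsSelfAdjoint R) (hi : Function.Injective R) (hRC : ‖R‖ ≤ C)
    (hS : ∀ᶠ i in l, (IsSelfAdjoint (S i) ∧ Function.Injective (S i)) ∧ ‖S i‖ ≤ C)
    (h1 : ∀ x, Tendsto (fun i => S i x) l (𝓝 (R x)))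
    (hN : IsConservative N) {u : ℝ → K} (hu : IsWeakSolution R N a u) {w : ι → ℝ → K}
    (hw : ∀ᶠ i in l, IsWeakSolution (S i) N a (w i)) (T : ℝ) :
    TendstoUniformlyOn w u l (Icc 0 T) := by
  set v : ℝ → K := fun t => evol R (-t) (u t) with hvdef
  have hv := interaction_of_weak hR hi hN.continuous hu
  have hvc : Continuous v := continuous_iff_continuousAt.2 fun t => (hv t).continuousAt
  have hvn (t : ℝ) : ‖v t‖ = ‖a‖ := by
    rw [hvdef]; simp only; rw [norm_evol hR hi, hu.norm_eq hR hi hN]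
  have hA := tendstoUniformlyOn_evol hR hi hRC hS h1 hvc T
  have hB := tendstoUniformlyOn_interactionField hR hi hRC hS h1 hN.continuous hvc T
  obtain ⟨L, hL⟩ := hN.lipschitz ‖a‖
  rw [Metric.tendstoUniformlyOn_iff] at hA hB ⊢
  intro ε hε
  obtain ⟨δ, hδpos, hδ⟩ := exists_gronwallBound_lt L T (half_pos hε)
  filter_upwards [hA (ε / 2) (by positivity), hB δ hδpos, hS, hw] with i hAi hBi hSi hwi t ht
  obtain ⟨⟨hs, hsi⟩, -⟩ := hSi
  set vi : ℝ → K := fun t => evol (S i) (-t) (w i t) with hvi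
  have hvid := interaction_of_weak hs hsi hN.continuous hwi
  have hvic : Continuous vi := continuous_iff_continuousAt.2 fun t => (hvid t).continuousAt
  have hvin (t : ℝ) : ‖vi t‖ = ‖a‖ := by
    rw [hvi]; simp only; rw [norm_evol hs hsi, hwi.norm_eq hs hsi hN]
  have hG := dist_le_of_approx_trajectories_ODE_of_mem (v := interactionField (S i) N)
    (s := fun _ => Metric.closedBall (0 : K) ‖a‖) (K := L) (f := v) (g := vi) (a := 0) (b := T)
    (εf := δ) (εg := 0) (δ := 0)
    (fun t _ => lipschitzOnWith_interactionField hs hsi hL t)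
    hvc.continuousOn (fun t _ => (hv t).hasDerivWithinAt)
    (fun t ht => (hBi t (Ico_subset_Icc_self ht)).le)
    (fun t _ => by rw [mem_closedBall_zero_iff, hvn])
    hvic.continuousOn (fun t _ => (hvid t).hasDerivWithinAt) (fun t _ => by simp [hvi])
    (fun t _ => by rw [mem_closedBall_zero_iff, hvin])
    (by simp [hvdef, hvi, hu.2.1, hwi.2.1, evol_zero hR hi, evol_zero hs hsi]) t ht
  have hmono : gronwallBound 0 L (δ + 0) (t - 0) ≤ gronwallBound 0 L δ T := by
    rw [add_zero, sub_zero]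
    exact gronwallBound_mono le_rfl hδpos.le L.coe_nonneg ht.2
  have e1 : u t = evol R t (v t) := by rw [hvdef]; simp [evol_evol_neg hR hi]
  have e2 : w i t = evol (S i) t (vi t) := by rw [hvi]; simp [evol_evol_neg hs hsi]
  have e3 : dist (evol (S i) t (v t)) (evol (S i) t (vi t)) = dist (v t) (vi t) := by
    rw [dist_eq_norm, ← map_sub, norm_evol hs hsi, dist_eq_norm]
  calc dist (u t) (w i t) ≤ dist (evol R t (v t)) (evol (S i) t (v t)) +
        dist (evol (S i) t (v t)) (evol (S i) t (vi t)) := by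
          rw [e1, e2]; exact dist_triangle _ _ _
    _ < ε / 2 + ε / 2 := by
        rw [e3]
        exact add_lt_add_of_lt_of_le (hAi t ht) (by linarith)
    _ = ε := by ring

end Semilinear


/-! ### Square integrable functions -/

section L2General

variable {X : Type*} [MeasurableSpace X] {μ : Measure X}

theorem L2_inner_eq (f g : Lp ℂ 2 μ) : inner ℂ f g = ∫ x, conj (f x) * g x ∂μ := by
  rw [L2.inner_def]
  refine integral_congr_ae (Eventually.of_forall fun x => ?_)
  simp [mul_comm]

theorem integrable_norm_sq (f : Lp ℂ 2 μ) : Integrable (fun x => ‖f x‖ ^ 2) μ :=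
  (memLp_two_iff_integrable_sq_norm (Lp.aestronglyMeasurable f)).1 (Lp.memLp f)

theorem L2_norm_sq (f : Lp ℂ 2 μ) : ‖f‖ ^ 2 = ∫ x, ‖f x‖ ^ 2 ∂μ := by
  have h1 := L2_inner_eq f f
  rw [inner_self_eq_norm_sq_to_K] at h1
  have h2 : ∀ x, conj (f x) * f x = ((‖f x‖ ^ 2 : ℝ) : ℂ) := fun x => by
    rw [Complex.conj_mul']; push_cast; rfl
  simp_rw [h2] at h1
  rw [integral_complex_ofReal] at h1
  rw [← Complex.ofReal_inj, ← h1]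
  push_cast
  rfl

theorem memLp_two_of_integral {f : X → ℂ} (hf : AEStronglyMeasurable f μ)
    (h : Integrable (fun x => ‖f x‖ ^ 2) μ) : MemLp f 2 μ :=
  (memLp_two_iff_integrable_sq_norm hf).2 h

theorem L2_norm_toLp_sq {f : X → ℂ} (hf : MemLp f 2 μ) :
    ‖hf.toLp f‖ ^ 2 = ∫ x, ‖f x‖ ^ 2 ∂μ := by
  rw [L2_norm_sq]
  refine integral_congr_ae ?_
  filter_upwards [hf.coeFn_toLp] with x hx
  rw [hx]

theorem integrable_mul_of_memLp_two {f g : X → ℝ} (hf : MemLp f 2 μ) (hg : MemLp g 2 μ) :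
    Integrable (fun x => f x * g x) μ := MemLp.integrable_mul hf hg

/-- The Cauchy-Schwarz inequality for integrals of nonnegative products. -/
theorem integral_norm_mul_norm_le {f g : X → ℂ} (hf : MemLp f 2 μ) (hg : MemLp g 2 μ) :
    (∫ x, ‖f x‖ * ‖g x‖ ∂μ) ^ 2 ≤ (∫ x, ‖f x‖ ^ 2 ∂μ) * ∫ x, ‖g x‖ ^ 2 ∂μ := by
  have hf' : MemLp (fun x => (‖f x‖ : ℂ)) 2 μ := hf.norm.ofReal
  have hg' : MemLp (fun x => (‖g x‖ : ℂ)) 2 μ := hg.norm.ofReal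
  have h := norm_inner_le_norm (𝕜 := ℂ) (hf'.toLp _) (hg'.toLp _)
  rw [L2_inner_eq] at h
  have h2 : ∫ x, conj (hf'.toLp _ x) * hg'.toLp _ x ∂μ = ((∫ x, ‖f x‖ * ‖g x‖ ∂μ : ℝ) : ℂ) := by
    rw [← integral_complex_ofReal]
    refine integral_congr_ae ?_
    filter_upwards [hf'.coeFn_toLp, hg'.coeFn_toLp] with x h1 h2
    rw [h1, h2]; simp
  rw [h2, Complex.norm_real, Real.norm_of_nonneg (integral_nonneg fun x => by positivity)] at h
  have h3 : 0 ≤ ∫ x, ‖f x‖ * ‖g x‖ ∂μ := integral_nonneg fun x => by positivity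
  have h4 := pow_le_pow_left₀ h3 h 2
  rw [mul_pow, L2_norm_toLp_sq, L2_norm_toLp_sq] at h4
  simpa using h4

theorem integral_norm_mul_norm_le_norm (f g : Lp ℂ 2 μ) :
    ∫ x, ‖f x‖ * ‖g x‖ ∂μ ≤ ‖f‖ * ‖g‖ := by
  have h := integral_norm_mul_norm_le (Lp.memLp f) (Lp.memLp g)
  rw [← L2_norm_sq, ← L2_norm_sq, ← mul_pow] at h
  exact le_of_sq_le_sq h (by positivity)

theorem integrable_norm_mul_norm (f g : Lp ℂ 2 μ) : Integrable (fun x => ‖f x‖ * ‖g x‖) μ :=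
  integrable_mul_of_memLp_two (Lp.memLp f).norm (Lp.memLp g).norm

theorem memLp_two_bdd_mul {m f : X → ℂ} {C : ℝ} (hm : AEStronglyMeasurable m μ)
    (hC : ∀ᵐ x ∂μ, ‖m x‖ ≤ C) (hf : MemLp f 2 μ) : MemLp (fun x => m x * f x) 2 μ := by
  refine MemLp.of_le_mul (c := C) hf (hm.mul hf.1) ?_
  filter_upwards [hC] with x hx
  rw [norm_mul]
  gcongr

theorem L2_norm_le_of_ae_le {f : Lp ℂ 2 μ} {g : Lp ℂ 2 μ} {C : ℝ}
    (h : ∀ᵐ x ∂μ, ‖f x‖ ≤ C * ‖g x‖) : ‖f‖ ≤ C * ‖g‖ :=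
  Lp.norm_le_mul_norm_of_ae_le_mul h

end L2General

/-! ### The Hartree nonlinearity -/

section Nonlinearity

variable {w : E3 → ℝ} {C : ℝ}

theorem exists_ae_norm_le_of_memLp_top (hw : MemLp w ⊤ volume) :
    ∃ C : ℝ, 0 ≤ C ∧ ∀ᵐ x, ‖w x‖ ≤ C := by
  refine ⟨(eLpNormEssSup w volume).toReal, ENNReal.toReal_nonneg, ?_⟩
  have ht : eLpNormEssSup w volume ≠ ⊤ := by
    rw [← eLpNorm_exponent_top]; exact hw.2.ne
  filter_upwards [enorm_ae_le_eLpNormEssSup w volume] with x hx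
  have := ENNReal.toReal_mono ht hx
  simpa using this

theorem ae_norm_sub_le (hC : ∀ᵐ x, ‖w x‖ ≤ C) (x : E3) : ∀ᵐ y, ‖w (x - y)‖ ≤ C :=
  (Measure.measurePreserving_sub_left volume x).quasiMeasurePreserving.ae hC

theorem integrable_hartree_integrand (hw : AEStronglyMeasurable w volume)
    (hC : ∀ᵐ x, ‖w x‖ ≤ C) (x : E3) {g : E3 → ℝ} (hg : Integrable g) :
    Integrable fun y => w (x - y) * g y :=
  hg.bdd_mul (c := C)
    (hw.comp_quasiMeasurePreserving (Measure.measurePreserving_sub_left volume x).quasiMeasurePreserving)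
    (ae_norm_sub_le hC x)

theorem aestronglyMeasurable_hartreePotential (hw : AEStronglyMeasurable w volume) (f : L2) :
    AEStronglyMeasurable (hartreePotential w f) volume := by
  have h := (AEStronglyMeasurable.convolution_integrand (L := ContinuousLinearMap.mul ℝ ℝ)
    (integrable_norm_sq f).1 hw).integral_prod_right'
  refine h.congr (Eventually.of_forall fun x => ?_)
  simp only [hartreePotential, ContinuousLinearMap.mul_apply']
  exact integral_congr_ae (Eventually.of_forall fun y => mul_comm _ _)

/-- From |f|² - |g|² = (|f| - |g|)(|f| + |g|), boundedness of w and Cauchy-Schwarz, a bound uniform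
in x. -/
theorem abs_hartreePotential_sub_le (hw : AEStronglyMeasurable w volume) (hC0 : 0 ≤ C)
    (hC : ∀ᵐ x, ‖w x‖ ≤ C) (f g : L2) (x : E3) :
    |hartreePotential w f x - hartreePotential w g x| ≤ C * (‖f - g‖ * (‖f‖ + ‖g‖)) := by
  have hf := integrable_hartree_integrand hw hC x (integrable_norm_sq f)
  have hg := integrable_hartree_integrand hw hC x (integrable_norm_sq g)
  rw [hartreePotential, hartreePotential, ← integral_sub hf hg]
  have hInt : Integrable fun y => C * (‖(f - g) y‖ * ‖f y‖ + ‖(f - g) y‖ * ‖g y‖) :=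
    ((integrable_norm_mul_norm _ _).add (integrable_norm_mul_norm _ _)).const_mul C
  calc |∫ y, w (x - y) * ‖f y‖ ^ 2 - w (x - y) * ‖g y‖ ^ 2|
      ≤ ∫ y, C * (‖(f - g) y‖ * ‖f y‖ + ‖(f - g) y‖ * ‖g y‖) := by
        rw [← Real.norm_eq_abs]
        refine norm_integral_le_of_norm_le hInt ?_
        filter_upwards [ae_norm_sub_le hC x, Lp.coeFn_sub f g] with y hy hfg
        rw [← mul_sub, norm_mul, hfg, Pi.sub_apply, ← mul_add]
        have h1 : ‖‖f y‖ ^ 2 - ‖g y‖ ^ 2‖ ≤ ‖f y - g y‖ * (‖f y‖ + ‖g y‖) := by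
          rw [sq_sub_sq, norm_mul, mul_comm, Real.norm_eq_abs, Real.norm_eq_abs,
            abs_of_nonneg (show 0 ≤ ‖f y‖ + ‖g y‖ by positivity)]
          gcongr
          exact abs_norm_sub_norm_le _ _
        gcongr
    _ = C * ((∫ y, ‖(f - g) y‖ * ‖f y‖) + ∫ y, ‖(f - g) y‖ * ‖g y‖) := by
        rw [integral_const_mul, integral_add (integrable_norm_mul_norm _ _)
          (integrable_norm_mul_norm _ _)]
    _ ≤ C * (‖f - g‖ * ‖f‖ + ‖f - g‖ * ‖g‖) := by
        gcongr <;> exact integral_norm_mul_norm_le_norm _ _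
    _ = _ := by ring

theorem abs_hartreePotential_le (hw : AEStronglyMeasurable w volume) (hC0 : 0 ≤ C)
    (hC : ∀ᵐ x, ‖w x‖ ≤ C) (f : L2) (x : E3) :
    |hartreePotential w f x| ≤ C * ‖f‖ ^ 2 := by
  have h := abs_hartreePotential_sub_le hw hC0 hC f 0 x
  have h0 : hartreePotential w (0 : L2) x = 0 := by
    have := integrable_hartree_integrand hw hC x (integrable_norm_sq (0 : L2))
    rw [hartreePotential]
    refine integral_eq_zero_of_ae (Eventually.of_forall fun y => ?_)
    simp
  rw [h0, sub_zero, sub_zero, norm_zero, add_zero] at h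
  linarith [h, sq ‖f‖]

theorem memLp_hartree (hw : AEStronglyMeasurable w volume) (hC0 : 0 ≤ C)
    (hC : ∀ᵐ x, ‖w x‖ ≤ C) (f g : L2) :
    MemLp (fun x => (hartreePotential w f x : ℂ) * g x) 2 volume := by
  refine memLp_two_bdd_mul (C := C * ‖f‖ ^ 2)
    (Complex.continuous_ofReal.comp_aestronglyMeasurable
      (aestronglyMeasurable_hartreePotential hw f)) ?_ (Lp.memLp g)
  refine Eventually.of_forall fun x => ?_
  rw [Complex.norm_real]
  exact abs_hartreePotential_le hw hC0 hC f x

open Classical in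
/-- The map `f ↦ (w * |f|²) f` on `L²`. -/
def hartreeMap (w : E3 → ℝ) (f : L2) : L2 :=
  if h : MemLp (fun x => (hartreePotential w f x : ℂ) * f x) 2 volume then h.toLp _ else 0

theorem coeFn_hartreeMap (hw : AEStronglyMeasurable w volume) (hC0 : 0 ≤ C)
    (hC : ∀ᵐ x, ‖w x‖ ≤ C) (f : L2) :
    hartreeMap w f =ᵐ[volume] fun x => (hartreePotential w f x : ℂ) * f x := by
  rw [hartreeMap, dif_pos (memLp_hartree hw hC0 hC f f)]
  exact MemLp.coeFn_toLp _

theorem norm_hartreeMap_sub_le (hw : AEStronglyMeasurable w volume) (hC0 : 0 ≤ C)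
    (hC : ∀ᵐ x, ‖w x‖ ≤ C) (f g : L2) :
    ‖hartreeMap w f - hartreeMap w g‖ ≤
      (C * (‖f‖ + ‖g‖) * ‖f‖ + C * ‖g‖ ^ 2) * ‖f - g‖ := by
  -- With W_f = w * |f|²: W_f f - W_g g = (W_f - W_g) f + W_g (f - g).
  have h1 : hartreeMap w f - hartreeMap w g =
      ((memLp_hartree hw hC0 hC f f).sub (memLp_hartree hw hC0 hC g f)).toLp _ +
      (memLp_hartree hw hC0 hC g (f - g)).toLp _ := by
    refine Lp.ext ?_
    filter_upwards [Lp.coeFn_sub (hartreeMap w f) (hartreeMap w g), coeFn_hartreeMap hw hC0 hC f,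
      coeFn_hartreeMap hw hC0 hC g, Lp.coeFn_sub f g,
      Lp.coeFn_add (((memLp_hartree hw hC0 hC f f).sub (memLp_hartree hw hC0 hC g f)).toLp _)
        ((memLp_hartree hw hC0 hC g (f - g)).toLp _),
      ((memLp_hartree hw hC0 hC f f).sub (memLp_hartree hw hC0 hC g f)).coeFn_toLp,
      (memLp_hartree hw hC0 hC g (f - g)).coeFn_toLp] with x h1 h2 h3 h4 h5 h6 h7
    rw [h1, h5, Pi.sub_apply, Pi.add_apply, h2, h3, h6, h7, h4]
    simp only [Pi.sub_apply]
    ring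
  rw [h1]
  refine (norm_add_le _ _).trans ?_
  have e1 : ‖((memLp_hartree hw hC0 hC f f).sub (memLp_hartree hw hC0 hC g f)).toLp _‖ ≤
      C * (‖f - g‖ * (‖f‖ + ‖g‖)) * ‖f‖ := by
    refine L2_norm_le_of_ae_le ?_
    filter_upwards [((memLp_hartree hw hC0 hC f f).sub
      (memLp_hartree hw hC0 hC g f)).coeFn_toLp] with x h6
    rw [h6, Pi.sub_apply, ← sub_mul, norm_mul, ← Complex.ofReal_sub, Complex.norm_real]
    gcongr
    exact abs_hartreePotential_sub_le hw hC0 hC f g x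
  have e2 : ‖(memLp_hartree hw hC0 hC g (f - g)).toLp _‖ ≤ C * ‖g‖ ^ 2 * ‖f - g‖ := by
    refine L2_norm_le_of_ae_le ?_
    filter_upwards [(memLp_hartree hw hC0 hC g (f - g)).coeFn_toLp] with x h6
    rw [h6, norm_mul, Complex.norm_real]
    gcongr
    exact abs_hartreePotential_le hw hC0 hC g x
  linarith

theorem inner_hartreeMap (hw : AEStronglyMeasurable w volume) (hC0 : 0 ≤ C)
    (hC : ∀ᵐ x, ‖w x‖ ≤ C) (f g : L2) :
    inner ℂ g (hartreeMap w f) = ∫ x, conj (g x) * ((hartreePotential w f x : ℂ) * f x) := by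
  rw [L2_inner_eq]
  refine integral_congr_ae ?_
  filter_upwards [coeFn_hartreeMap hw hC0 hC f] with x hx
  rw [hx]

/-- The term b f absorbs the spectral shift: with b = κ², the invertible operator H + κ² can take
the place of H. The imaginary part vanishes because w and b are real. -/
theorem isConservative_hartreeMap (hw : AEStronglyMeasurable w volume) (hC0 : 0 ≤ C)
    (hC : ∀ᵐ x, ‖w x‖ ≤ C) (b : ℝ) :
    IsConservative fun f : L2 => hartreeMap w f - (b : ℂ) • f where
  lipschitz ρ := by
    by_cases hρ : 0 ≤ ρ
    swap
    · refine ⟨0, ?_⟩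
      rw [Metric.closedBall_eq_empty.2 (not_le.1 hρ)]
      exact fun x hx => absurd hx (notMem_empty x)
    have hL : 0 ≤ C * (ρ + ρ) * ρ + C * ρ ^ 2 + |b| := by positivity
    refine ⟨NNReal.mk _ hL, LipschitzOnWith.of_dist_le_mul fun f hf g hg => ?_⟩
    rw [mem_closedBall_zero_iff] at hf hg
    rw [dist_eq_norm, dist_eq_norm]
    have : hartreeMap w f - (b : ℂ) • f - (hartreeMap w g - (b : ℂ) • g) =
        (hartreeMap w f - hartreeMap w g) - (b : ℂ) • (f - g) := by
      rw [smul_sub]; abel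
    rw [this]
    refine (norm_sub_le _ _).trans ?_
    rw [norm_smul, Complex.norm_real, Real.norm_eq_abs, NNReal.coe_mk, add_mul _ |b|]
    gcongr
    refine (norm_hartreeMap_sub_le hw hC0 hC f g).trans ?_
    gcongr
  real f := by
    rw [inner_sub_right, inner_smul_right, inner_self_eq_norm_sq_to_K, inner_hartreeMap hw hC0 hC]
    have : ∀ x, conj (f x) * ((hartreePotential w f x : ℂ) * f x) =
        ((hartreePotential w f x * ‖f x‖ ^ 2 : ℝ) : ℂ) := fun x => by
      push_cast
      rw [mul_left_comm, Complex.conj_mul']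
    simp_rw [this]
    rw [integral_complex_ofReal, Complex.sub_im]
    simp [← Complex.ofReal_pow]

/-- The graph of the operator with resolvent `R` at `-κ²`. -/
def resolventGraph (κ : ℝ) (R : L2 →L[ℂ] L2) : Set (L2 × L2) :=
  {p | ∃ h, p = (R h, h - ((κ ^ 2 : ℝ) : ℂ) • R h)}

theorem isHartreeSolution_resolventGraph_iff (hw : AEStronglyMeasurable w volume) (hC0 : 0 ≤ C)
    (hC : ∀ᵐ x, ‖w x‖ ≤ C) {κ : ℝ} {R : L2 →L[ℂ] L2} {a : L2} {u : ℝ → L2} :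
    IsHartreeSolution (resolventGraph κ R) w a u ↔
      IsWeakSolution R (fun f : L2 => hartreeMap w f - ((κ ^ 2 : ℝ) : ℂ) • f) a u := by
  have key (h : L2) (t : ℝ) : inner ℂ h (u t) +
      inner ℂ (R h) (hartreeMap w (u t) - ((κ ^ 2 : ℝ) : ℂ) • u t) =
      inner ℂ (h - ((κ ^ 2 : ℝ) : ℂ) • R h) (u t) +
        ∫ x, conj (R h x) * ((hartreePotential w (u t) x : ℂ) * u t x) := by
    rw [← inner_hartreeMap hw hC0 hC, inner_sub_right, inner_sub_left, inner_smul_left,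
      inner_smul_right, Complex.conj_ofReal]
    ring
  unfold IsHartreeSolution IsWeakSolution
  refine and_congr_right fun _ => and_congr_right fun _ => ⟨fun h x t => ?_, ?_⟩
  · rw [key]
    exact h _ ⟨x, rfl⟩ t
  · rintro h _ ⟨x, rfl⟩ t
    have := h x t
    rwa [key] at this

/-- Well-posedness of the Hartree equation. -/
theorem exists_isUniqueHartreeSolution (hw : MemLp w ⊤ volume) {κ : ℝ} {R : L2 →L[ℂ] L2}
    (hR : IsSelfAdjoint R) (hi : Function.Injective R) (a : L2) :
    ∃ u, IsUniqueHartreeSolution (resolventGraph κ R) w a u := by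
  obtain ⟨C, hC0, hC⟩ : ∃ C : ℝ, 0 ≤ C ∧ ∀ᵐ x, ‖w x‖ ≤ C :=
    exists_ae_norm_le_of_memLp_top hw
  have hN := isConservative_hartreeMap hw.1 hC0 hC (κ ^ 2)
  obtain ⟨u, hu⟩ := exists_isWeakSolution hR hi hN a
  refine ⟨u, (isHartreeSolution_resolventGraph_iff hw.1 hC0 hC).2 hu, fun u' hu' => ?_⟩
  exact hu.unique hR hi hN ((isHartreeSolution_resolventGraph_iff hw.1 hC0 hC).1 hu')

/-- Strong resolvent convergence implies convergence of the solutions of the Hartree equation. -/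
theorem tendsto_hartreeSolution (hw : MemLp w ⊤ volume) {κ : ℝ} {R : L2 →L[ℂ] L2}
    (hR : IsSelfAdjoint R) (hi : Function.Injective R) {S : ℝ → L2 →L[ℂ] L2} {M : ℝ}
    {A : ℝ → Set (L2 × L2)}
    (hS : ∀ᶠ ε in 𝓝[>] (0 : ℝ), IsSelfAdjoint (S ε) ∧ Function.Injective (S ε) ∧ ‖S ε‖ ≤ M ∧
      A ε = resolventGraph κ (S ε))
    (hlim : ∀ x, Tendsto (fun ε => S ε x) (𝓝[>] 0) (𝓝 (R x)))
    {a : L2} {u : ℝ → L2} (hu : IsHartreeSolution (resolventGraph κ R) w a u) {v : ℝ → ℝ → L2}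
    (hv : ∀ᶠ ε in 𝓝[>] (0 : ℝ), IsHartreeSolution (A ε) w a (v ε)) (T : ℝ) :
    Tendsto (fun ε => eLpNorm (fun t => v ε t - u t) ⊤ (volume.restrict (Icc 0 T)))
      (𝓝[>] 0) (𝓝 0) := by
  obtain ⟨C, hC0, hC⟩ : ∃ C : ℝ, 0 ≤ C ∧ ∀ᵐ x, ‖w x‖ ≤ C :=
    exists_ae_norm_le_of_memLp_top hw
  have hN := isConservative_hartreeMap hw.1 hC0 hC (κ ^ 2)
  have h := tendstoUniformlyOn_weakSolution hR hi (le_max_right M ‖R‖) (S := S) (l := 𝓝[>] 0)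
    (hS.mono fun ε h => ⟨⟨h.1, h.2.1⟩, h.2.2.1.trans (le_max_left _ _)⟩) hlim hN
    ((isHartreeSolution_resolventGraph_iff hw.1 hC0 hC).1 hu) (w := v) (by
      filter_upwards [hS, hv] with ε h1 h2
      rw [h1.2.2.2] at h2
      exact (isHartreeSolution_resolventGraph_iff hw.1 hC0 hC).1 h2) T
  rw [Metric.tendstoUniformlyOn_iff] at h
  rw [ENNReal.tendsto_nhds_zero]
  intro δ hδ
  by_cases hδt : δ = ⊤
  · simp [hδt]
  have hδ' : 0 < δ.toReal := ENNReal.toReal_pos hδ.ne' hδt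
  filter_upwards [h _ hδ'] with ε hε
  rw [eLpNorm_exponent_top]
  have hb : ∀ᵐ t ∂(volume.restrict (Icc 0 T)), ‖v ε t - u t‖ ≤ δ.toReal := by
    refine (ae_restrict_iff' measurableSet_Icc).2 (Eventually.of_forall fun t ht => ?_)
    have := hε t ht
    rw [dist_comm, dist_eq_norm] at this
    exact this.le
  refine (eLpNormEssSup_le_of_ae_bound hb).trans ?_
  rw [ENNReal.ofReal_toReal hδt]

end Nonlinearity


/-! ### Hilbert-Schmidt integral operators -/

/-- Square integrable kernels on `ℝ³ × ℝ³`. -/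
abbrev KernelSpace : Type := Lp ℂ 2 ((volume : Measure E3).prod (volume : Measure E3))

theorem ae_memLp_section {k : E3 × E3 → ℂ} (hk : MemLp k 2 (volume.prod volume)) :
    ∀ᵐ x : E3, MemLp (fun y => k (x, y)) 2 volume := by
  have h1 := (memLp_two_iff_integrable_sq_norm hk.1).1 hk
  filter_upwards [h1.prod_right_ae, hk.1.prodMk_left] with x h2 h3
  exact memLp_two_of_integral h3 h2

theorem integrable_kernel_mul {k f : E3 → ℂ} (hk : MemLp k 2 volume) (hf : MemLp f 2 volume) :
    Integrable (fun y => k y * f y) := MemLp.integrable_mul hk hf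

theorem norm_integral_mul_sq_le {k : E3 → ℂ} (hk : MemLp k 2 volume) (f : L2) :
    ‖∫ y, k y * f y‖ ^ 2 ≤ (∫ y, ‖k y‖ ^ 2) * ‖f‖ ^ 2 := by
  rw [L2_norm_sq]
  refine le_trans ?_ (integral_norm_mul_norm_le hk (Lp.memLp f))
  gcongr
  refine (norm_integral_le_integral_norm _).trans (le_of_eq ?_)
  simp_rw [norm_mul]

theorem memLp_kernel_integral {k : E3 × E3 → ℂ} (hk : MemLp k 2 (volume.prod volume)) (f : L2) :
    MemLp (fun x => ∫ y, k (x, y) * f y) 2 volume := by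
  have hm : AEStronglyMeasurable (fun x => ∫ y, k (x, y) * f y) volume :=
    (hk.1.mul (Lp.aestronglyMeasurable f).comp_snd).integral_prod_right'
  have h1 := (memLp_two_iff_integrable_sq_norm hk.1).1 hk
  refine memLp_two_of_integral hm (Integrable.mono' (h1.integral_prod_left.mul_const (‖f‖ ^ 2))
    (hm.norm.pow 2) ?_)
  filter_upwards [ae_memLp_section hk] with x hx
  rw [Real.norm_of_nonneg (by positivity)]
  exact norm_integral_mul_sq_le hx f

theorem norm_toLp_kernel_integral_le {k : E3 × E3 → ℂ} (hk : MemLp k 2 (volume.prod volume))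
    (f : L2) : ‖(memLp_kernel_integral hk f).toLp _‖ ^ 2 ≤
      (∫ p, ‖k p‖ ^ 2 ∂(volume.prod volume)) * ‖f‖ ^ 2 := by
  have h1 := (memLp_two_iff_integrable_sq_norm hk.1).1 hk
  rw [L2_norm_toLp_sq, integral_prod _ h1, ← integral_mul_const]
  refine integral_mono_ae ((memLp_two_iff_integrable_sq_norm
    (memLp_kernel_integral hk f).1).1 (memLp_kernel_integral hk f))
    (h1.integral_prod_left.mul_const (‖f‖ ^ 2)) ?_
  filter_upwards [ae_memLp_section hk] with x hx
  exact norm_integral_mul_sq_le hx f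

/-- The integral operator with a square integrable kernel. -/
def intOp : KernelSpace →L[ℂ] L2 →L[ℂ] L2 :=
  LinearMap.mkContinuous₂
    (LinearMap.mk₂ ℂ (fun k f => (memLp_kernel_integral (Lp.memLp k) f).toLp _)
      (fun k k' f => by
        rw [← MemLp.toLp_add]
        refine MemLp.toLp_congr _ _ ?_
        have h := Measure.ae_ae_of_ae_prod (Lp.coeFn_add k k')
        filter_upwards [h, ae_memLp_section (Lp.memLp k), ae_memLp_section (Lp.memLp k')]
          with x hx h1 h2
        simp only [Pi.add_apply]
        rw [← integral_add (integrable_kernel_mul h1 (Lp.memLp f))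
          (integrable_kernel_mul h2 (Lp.memLp f))]
        refine integral_congr_ae ?_
        filter_upwards [hx] with y hy
        rw [hy, Pi.add_apply, add_mul])
      (fun c k f => by
        rw [← MemLp.toLp_const_smul]
        refine MemLp.toLp_congr _ _ ?_
        have h := Measure.ae_ae_of_ae_prod (Lp.coeFn_smul c k)
        filter_upwards [h] with x hx
        simp only [Pi.smul_apply]
        rw [← integral_smul]
        refine integral_congr_ae ?_
        filter_upwards [hx] with y hy
        rw [hy, Pi.smul_apply, smul_mul_assoc])
      (fun k f f' => by
        rw [← MemLp.toLp_add]
        refine MemLp.toLp_congr _ _ ?_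
        filter_upwards [ae_memLp_section (Lp.memLp k)] with x h1
        simp only [Pi.add_apply]
        rw [← integral_add (integrable_kernel_mul h1 (Lp.memLp f))
          (integrable_kernel_mul h1 (Lp.memLp f'))]
        refine integral_congr_ae ?_
        filter_upwards [Lp.coeFn_add f f'] with y hy
        rw [hy, Pi.add_apply, mul_add])
      (fun c k f => by
        rw [← MemLp.toLp_const_smul]
        refine MemLp.toLp_congr _ _ (Eventually.of_forall fun x => ?_)
        simp only [Pi.smul_apply]
        rw [← integral_smul]
        refine integral_congr_ae ?_
        filter_upwards [Lp.coeFn_smul c f] with y hy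
        rw [hy, Pi.smul_apply, mul_smul_comm])) 1
    (fun k f => by
      have h := norm_toLp_kernel_integral_le (Lp.memLp k) f
      rw [← L2_norm_sq, ← mul_pow] at h
      rw [one_mul]
      exact le_of_sq_le_sq h (by positivity))

theorem norm_intOp_le (k : KernelSpace) : ‖intOp k‖ ≤ ‖k‖ := by
  have h : ‖intOp‖ ≤ 1 := LinearMap.mkContinuous₂_norm_le _ zero_le_one _
  exact (intOp.le_opNorm k).trans (by simpa using mul_le_mul_of_nonneg_right h (norm_nonneg k))

theorem coeFn_intOp (k : KernelSpace) (f : L2) :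
    intOp k f =ᵐ[volume] fun x => ∫ y, k (x, y) * f y :=
  (memLp_kernel_integral (Lp.memLp k) f).coeFn_toLp

theorem coeFn_intOp_toLp {k : E3 × E3 → ℂ} (hk : MemLp k 2 (volume.prod volume)) (f : L2) :
    intOp (hk.toLp k) f =ᵐ[volume] fun x => ∫ y, k (x, y) * f y := by
  filter_upwards [coeFn_intOp (hk.toLp k) f, Measure.ae_ae_of_ae_prod hk.coeFn_toLp] with x h1 h2
  rw [h1]
  refine integral_congr_ae ?_
  filter_upwards [h2] with y hy
  rw [hy]

theorem norm_intOp_toLp_sq_le {k : E3 × E3 → ℂ} (hk : MemLp k 2 (volume.prod volume)) :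
    ‖intOp (hk.toLp k)‖ ^ 2 ≤ ∫ p, ‖k p‖ ^ 2 ∂(volume.prod volume) := by
  rw [← L2_norm_toLp_sq hk]
  gcongr
  exact norm_intOp_le _

theorem memLp_swap_conj {k : E3 × E3 → ℂ} (hk : MemLp k 2 (volume.prod volume)) :
    MemLp (fun p : E3 × E3 => conj (k p.swap)) 2 (volume.prod volume) := by
  have := (hk.comp_measurePreserving Measure.measurePreserving_swap).star
  exact this

theorem memLp_tensor {g f : E3 → ℂ} (hg : MemLp g 2 volume) (hf : MemLp f 2 volume) :
    MemLp (fun p : E3 × E3 => g p.1 * f p.2) 2 (volume.prod volume) := by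
  refine memLp_two_of_integral (hg.1.comp_fst.mul hf.1.comp_snd) ?_
  have := ((memLp_two_iff_integrable_sq_norm hg.1).1 hg).mul_prod
    ((memLp_two_iff_integrable_sq_norm hf.1).1 hf)
  simpa only [norm_mul, mul_pow] using this

theorem inner_intOp {k : E3 × E3 → ℂ} (hk : MemLp k 2 (volume.prod volume)) (g f : L2) :
    inner ℂ g (intOp (hk.toLp k) f) =
      ∫ p, conj (g p.1) * f p.2 * k p ∂(volume.prod volume) := by
  have hgf := memLp_tensor (Lp.memLp g).star (Lp.memLp f)
  have hInt : Integrable (fun p : E3 × E3 => conj (g p.1) * f p.2 * k p) (volume.prod volume) :=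
    MemLp.integrable_mul hgf hk
  rw [integral_prod _ hInt, L2_inner_eq]
  refine integral_congr_ae ?_
  filter_upwards [coeFn_intOp_toLp hk f] with x hx
  rw [hx, ← integral_const_mul]
  refine integral_congr_ae (Eventually.of_forall fun y => ?_)
  simp only
  ring

theorem adjoint_intOp {k : E3 × E3 → ℂ} (hk : MemLp k 2 (volume.prod volume)) :
    ContinuousLinearMap.adjoint (intOp (hk.toLp k)) =
      intOp ((memLp_swap_conj hk).toLp _) := by
  symm
  rw [ContinuousLinearMap.eq_adjoint_iff]
  intro f g
  rw [← inner_conj_symm, inner_intOp, inner_intOp, ← integral_conj,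
    ← integral_prod_swap]
  refine integral_congr_ae (Eventually.of_forall fun p => ?_)
  simp only [Prod.swap_swap, Prod.fst_swap, Prod.snd_swap, map_mul, Complex.conj_conj]
  ring

theorem isCompactOperator_intOp_tensor {g f : E3 → ℂ} (hg : MemLp g 2 volume)
    (hf : MemLp f 2 volume) :
    IsCompactOperator (intOp ((memLp_tensor hg hf).toLp _)) := by
  have h : (intOp ((memLp_tensor hg hf).toLp _) : L2 → L2) =
      (fun c : ℂ => c • hg.toLp g) ∘ (fun h : L2 => inner ℂ (hf.star.toLp _) h) := by
    funext h
    refine Lp.ext ?_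
    filter_upwards [coeFn_intOp_toLp (memLp_tensor hg hf) h,
      Lp.coeFn_smul (inner ℂ (hf.star.toLp _) h) (hg.toLp g), hg.coeFn_toLp] with x h1 h2 h3
    rw [h1, Function.comp_apply, h2, Pi.smul_apply, h3, L2_inner_eq, smul_eq_mul,
      ← integral_mul_const]
    refine integral_congr_ae ?_
    filter_upwards [hf.star.coeFn_toLp] with y hy
    rw [hy]
    simp only [Pi.star_apply, RCLike.star_def, Complex.conj_conj]
    ring
  rw [h]
  have h2 : IsCompactOperator (fun h : L2 => inner ℂ (hf.star.toLp _) h) := by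
    have h3 : IsCompactOperator (id : ℂ → ℂ) :=
      (isCompactOperator_id_iff_finiteDimensional (𝕜 := ℂ)).2 inferInstance
    exact h3.comp_clm (innerSL ℂ (hf.star.toLp _))
  exact h2.clm_comp ((ContinuousLinearMap.id ℂ ℂ).smulRight (hg.toLp g))

/-- The exceptional null set of x depends on f. A countable dense set of f leaves a single null set,
outside which k(x, ·) is orthogonal to all of L². -/
theorem ae_eq_zero_of_intOp_eq_zero {k : KernelSpace} (h : intOp k = 0) : k = 0 := by
  have : Fact ((2 : ℝ≥0∞) ≠ ⊤) := ⟨by simp⟩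
  obtain ⟨s, hsc, hsd⟩ := TopologicalSpace.exists_countable_dense L2
  have h1 : ∀ᵐ x : E3, ∀ f ∈ s, ∫ y, k (x, y) * f y = 0 := by
    rw [ae_ball_iff hsc]
    intro f _
    filter_upwards [coeFn_intOp k f] with x hx
    rw [← hx, h]
    simp
  have h2 : ∀ᵐ x : E3, ∀ᵐ y : E3, k (x, y) = 0 := by
    filter_upwards [h1, ae_memLp_section (Lp.memLp k)] with x hx hk
    have e1 : ∀ f : L2, inner ℂ (hk.star.toLp _) f = 0 := by
      intro f
      refine hsd.induction (P := fun f : L2 => inner ℂ (hk.star.toLp _) f = 0) (fun f hf => ?_)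
        (isClosed_eq (by fun_prop) (by fun_prop)) f
      rw [L2_inner_eq, ← hx f hf]
      refine integral_congr_ae ?_
      filter_upwards [hk.star.coeFn_toLp] with y hy
      rw [hy]; simp
    have e2 : hk.star.toLp _ = 0 := inner_self_eq_zero.1 (e1 _)
    have e3 := hk.star.coeFn_toLp
    rw [e2] at e3
    filter_upwards [e3, Lp.coeFn_zero ℂ 2 (volume : Measure E3)] with y h3 h4
    rw [h4] at h3
    simpa using h3.symm
  rw [Lp.eq_zero_iff_ae_eq_zero]
  have hms : MeasurableSet {p : E3 × E3 | k p = 0} :=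
    (Lp.stronglyMeasurable k).measurable (measurableSet_singleton 0)
  exact (Measure.ae_prod_iff_ae_ae hms).2 h2

/-- The kernels of compact operators form a closed subspace that contains all tensors. A kernel
orthogonal to it has ⟨g, K f⟩ = 0 for all f and g, where K is its operator; the choice g = K f gives
K = 0. -/
theorem isCompactOperator_intOp (k : KernelSpace) : IsCompactOperator (intOp k) := by
  set S : Submodule ℂ KernelSpace :=
    (compactOperator (RingHom.id ℂ) L2 L2).comap (intOp : KernelSpace →ₗ[ℂ] L2 →L[ℂ] L2) with hS
  have hcl : IsClosed (S : Set KernelSpace) :=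
    (isClosed_setOfPred_isCompactOperator (𝕜₁ := ℂ) (σ₁₂ := RingHom.id ℂ) (M₁ := L2)
      (M₂ := L2)).preimage intOp.continuous
  have horth : Sᗮ = ⊥ := by
    rw [Submodule.eq_bot_iff]
    intro k hk
    apply ae_eq_zero_of_intOp_eq_zero
    ext1 f
    rw [zero_apply]
    rw [← inner_self_eq_zero (𝕜 := ℂ)]
    set g := intOp k f
    have hg := memLp_tensor (Lp.memLp g) (Lp.memLp f).star
    have h1 : hg.toLp _ ∈ S := isCompactOperator_intOp_tensor (Lp.memLp g) (Lp.memLp f).star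
    have h2 := hk _ h1
    have h3 : intOp k = intOp ((Lp.memLp k).toLp _) := by rw [Lp.toLp_coeFn]
    rw [L2_inner_eq] at h2
    conv_lhs => rw [show inner ℂ g g = inner ℂ g (intOp k f) from rfl, h3, inner_intOp]
    rw [← h2]
    refine integral_congr_ae ?_
    filter_upwards [hg.coeFn_toLp] with p hp
    rw [hp]
    simp
  have htop : S = ⊤ := by
    rw [← Submodule.topologicalClosure_eq_top_iff, hcl.submodule_topologicalClosure_eq] at horth
    exact horth
  have : k ∈ S := htop ▸ Submodule.mem_top
  exact this

/-- Dominated convergence for integral operators. -/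
theorem tendsto_intOp_of_dominated {k : ℝ → E3 × E3 → ℂ} {k₀ : E3 × E3 → ℂ} {F : E3 × E3 → ℝ}
    {l : Filter ℝ} [l.IsCountablyGenerated]
    (hk : ∀ ε, MemLp (k ε) 2 (volume.prod volume)) (hk₀ : MemLp k₀ 2 (volume.prod volume))
    (hF : Integrable (fun p => F p ^ 2) (volume.prod volume))
    (hle : ∀ᶠ ε in l, ∀ᵐ p ∂(volume.prod volume), ‖k ε p‖ ≤ F p)
    (hle₀ : ∀ᵐ p ∂(volume.prod volume), ‖k₀ p‖ ≤ F p)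
    (hlim : ∀ᵐ p ∂(volume.prod volume), Tendsto (fun ε => k ε p) l (𝓝 (k₀ p))) :
    Tendsto (fun ε => intOp ((hk ε).toLp _)) l (𝓝 (intOp (hk₀.toLp _))) := by
  have h1 : Tendsto (fun ε => ∫ p, ‖k ε p - k₀ p‖ ^ 2 ∂(volume.prod volume)) l (𝓝 0) := by
    have := tendsto_integral_filter_of_dominated_convergence (μ := volume.prod volume) (l := l)
      (F := fun ε p => ‖k ε p - k₀ p‖ ^ 2) (f := fun _ => 0) (fun p => 4 * F p ^ 2)
      (Eventually.of_forall fun ε => (((hk ε).1.sub hk₀.1).norm.pow 2)) ?_ (hF.const_mul 4) ?_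
    · simpa using this
    · filter_upwards [hle] with ε hε
      filter_upwards [hε, hle₀] with p h1 h2
      rw [Real.norm_of_nonneg (by positivity)]
      have h3 : ‖k ε p - k₀ p‖ ≤ 2 * F p := (norm_sub_le _ _).trans (by linarith)
      calc _ ≤ (2 * F p) ^ 2 := by gcongr
        _ = 4 * F p ^ 2 := by ring
    · filter_upwards [hlim] with p hp
      have := (tendsto_iff_norm_sub_tendsto_zero.1 hp).pow 2
      simpa using this
  rw [tendsto_iff_norm_sub_tendsto_zero]
  have h2 := h1.sqrt
  rw [Real.sqrt_zero] at h2
  refine squeeze_zero (fun _ => norm_nonneg _) (fun ε => ?_) h2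
  rw [← map_sub, ← MemLp.toLp_sub]
  exact Real.le_sqrt_of_sq_le (norm_intOp_toLp_sq_le ((hk ε).sub hk₀))


/-! ### The Yukawa kernel -/

open scoped SchwartzMap

/-- The Yukawa kernel `exp(-κ|x|) / (4π|x|)`. -/
def yukawa (κ : ℝ) (x : E3) : ℝ := Real.exp (-(κ * ‖x‖)) / (4 * Real.pi * ‖x‖)

theorem greenFunction_eq_yukawa (μ : ℝ) : greenFunction μ = yukawa √μ := by
  funext x
  simp only [greenFunction, yukawa, mul_comm]

theorem measurable_yukawa (κ : ℝ) : Measurable (yukawa κ) := by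
  unfold yukawa; fun_prop

theorem yukawa_nonneg (κ : ℝ) (x : E3) : 0 ≤ yukawa κ x := by unfold yukawa; positivity

theorem yukawa_neg (κ : ℝ) (x : E3) : yukawa κ (-x) = yukawa κ x := by
  simp [yukawa]

theorem yukawa_sub_comm (κ : ℝ) (x y : E3) : yukawa κ (x - y) = yukawa κ (y - x) := by
  rw [← yukawa_neg, neg_sub]

theorem yukawa_zero_eq (x : E3) : yukawa 0 x = (4 * Real.pi * ‖x‖)⁻¹ := by
  simp [yukawa]

theorem yukawa_le_yukawa_zero {κ : ℝ} (hκ : 0 ≤ κ) (x : E3) : yukawa κ x ≤ yukawa 0 x := by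
  unfold yukawa
  gcongr

theorem yukawa_smul {ε : ℝ} (hε : 0 < ε) (κ : ℝ) (x : E3) :
    yukawa κ (ε • x) = ε⁻¹ * yukawa (ε * κ) x := by
  unfold yukawa
  rw [norm_smul, Real.norm_of_nonneg hε.le]
  by_cases hx : ‖x‖ = 0
  · simp [hx]
  · rw [show κ * (ε * ‖x‖) = ε * κ * ‖x‖ by ring]
    field_simp

theorem finrank_E3 : Module.finrank ℝ E3 = 3 := by simp

theorem integral_radial (f : ℝ → ℝ) :
    ∫ x : E3, f ‖x‖ = 4 * Real.pi * ∫ r in Ioi (0 : ℝ), r ^ 2 * f r := by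
  rw [integral_fun_norm_addHaar, finrank_E3, Measure.real, EuclideanSpace.volume_ball_fin_three]
  simp only [ENNReal.ofReal_one, one_pow, one_mul, nsmul_eq_mul, smul_eq_mul, Nat.cast_ofNat,
    Nat.add_one_sub_one]
  rw [ENNReal.toReal_ofReal (by positivity)]
  ring

theorem integrable_radial_iff (f : ℝ → ℝ) :
    Integrable (fun x : E3 => f ‖x‖) ↔ IntegrableOn (fun r => r ^ 2 * f r) (Ioi 0) := by
  rw [integrable_fun_norm_addHaar, finrank_E3]
  simp only [smul_eq_mul, Nat.add_one_sub_one]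

theorem yukawa_mul_eq (κ m r : ℝ) (hr : 0 < r) :
    r ^ 2 * (Real.exp (-(κ * r)) / (4 * Real.pi * r) * (Real.exp (-(m * r)) / (4 * Real.pi * r))) =
      (16 * Real.pi ^ 2)⁻¹ * Real.exp (-(κ + m) * r) := by
  have : Real.exp (-(κ + m) * r) = Real.exp (-(κ * r)) * Real.exp (-(m * r)) := by
    rw [← Real.exp_add]; congr 1; ring
  rw [this]
  field_simp
  ring

theorem integrable_yukawa_mul {κ m : ℝ} (h : 0 < κ + m) :
    Integrable fun x : E3 => yukawa κ x * yukawa m x := by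
  have := (integrable_radial_iff (fun r => Real.exp (-(κ * r)) / (4 * Real.pi * r) *
    (Real.exp (-(m * r)) / (4 * Real.pi * r)))).2 (by
      refine IntegrableOn.congr_fun (f := fun r => (16 * Real.pi ^ 2)⁻¹ * Real.exp (-(κ + m) * r))
        ?_ (fun r hr => (yukawa_mul_eq κ m r hr).symm) measurableSet_Ioi
      exact (exp_neg_integrableOn_Ioi 0 h).const_mul _)
  exact this

/-- In polar coordinates r² cancels both singularities and an exponential integral remains. All
explicit constants of the point interaction come from this value. -/
theorem integral_yukawa_mul {κ m : ℝ} (h : 0 < κ + m) :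
    ∫ x : E3, yukawa κ x * yukawa m x = 1 / (4 * Real.pi * (κ + m)) := by
  have h1 := integral_radial (fun r => Real.exp (-(κ * r)) / (4 * Real.pi * r) *
    (Real.exp (-(m * r)) / (4 * Real.pi * r)))
  rw [setIntegral_congr_fun measurableSet_Ioi (fun r hr => yukawa_mul_eq κ m r hr),
    integral_const_mul, integral_exp_mul_Ioi (by linarith)] at h1
  refine h1.trans ?_
  rw [mul_zero, Real.exp_zero, neg_div_neg_eq]
  field_simp
  norm_num

theorem memLp_yukawa {κ : ℝ} (hκ : 0 < κ) : MemLp (fun x => (yukawa κ x : ℂ)) 2 volume := by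
  refine memLp_two_of_integral
    (Complex.measurable_ofReal.comp (measurable_yukawa κ)).aestronglyMeasurable ?_
  refine (integrable_yukawa_mul (κ := κ) (m := κ) (by positivity)).congr
    (Eventually.of_forall fun x => ?_)
  simp [sq]

/-- The Yukawa kernel as an element of `L²`. -/
def yukawaLp (κ : ℝ) : L2 := if h : 0 < κ then (memLp_yukawa h).toLp _ else 0

theorem coeFn_yukawaLp {κ : ℝ} (hκ : 0 < κ) :
    yukawaLp κ =ᵐ[volume] fun x => (yukawa κ x : ℂ) := by
  rw [yukawaLp, dif_pos hκ]
  exact MemLp.coeFn_toLp _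

theorem inner_yukawaLp {κ m : ℝ} (hκ : 0 < κ) (hm : 0 < m) :
    inner ℂ (yukawaLp κ) (yukawaLp m) = ((1 / (4 * Real.pi * (κ + m)) : ℝ) : ℂ) := by
  rw [L2_inner_eq, ← integral_yukawa_mul (by positivity), ← integral_complex_ofReal]
  refine integral_congr_ae ?_
  filter_upwards [coeFn_yukawaLp hκ, coeFn_yukawaLp hm] with x h1 h2
  rw [h1, h2]
  simp

/-! ### The fundamental solution property -/

section Regularised

theorem mul_exp_neg_le_one (t : ℝ) : (t + 1) * Real.exp (-t) ≤ 1 := by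
  rw [Real.exp_neg, ← div_eq_mul_inv, div_le_one (Real.exp_pos t)]
  exact Real.add_one_le_exp t

theorem quadratic_mul_exp_neg_le {t : ℝ} (ht : 0 ≤ t) :
    (t ^ 2 + 3 * t + 3) * Real.exp (-t) ≤ 3 := by
  rw [Real.exp_neg, ← div_eq_mul_inv, div_le_iff₀ (Real.exp_pos t)]
  nlinarith [Real.quadratic_le_exp_of_nonneg ht, sq_nonneg t]

/-- `exp(-κρ)/ρ` with `ρ² = s + δ²`. -/
def regA (κ δ s : ℝ) : ℝ := Real.exp (-(κ * √(s + δ ^ 2))) / √(s + δ ^ 2)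

/-- The derivative of `regA` in `s`. -/
def regB (κ δ s : ℝ) : ℝ :=
  -((κ * √(s + δ ^ 2) + 1) * Real.exp (-(κ * √(s + δ ^ 2)))) / (2 * √(s + δ ^ 2) ^ 3)

/-- The second derivative of `regA` in `s`. -/
def regC (κ δ s : ℝ) : ℝ :=
  ((κ * √(s + δ ^ 2)) ^ 2 + 3 * (κ * √(s + δ ^ 2)) + 3) * Real.exp (-(κ * √(s + δ ^ 2))) /
    (4 * √(s + δ ^ 2) ^ 5)

variable {κ δ : ℝ}

theorem hasDerivAt_sqrt_add {s : ℝ} (hs : 0 < s + δ ^ 2) :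
    HasDerivAt (fun s => √(s + δ ^ 2)) (1 / (2 * √(s + δ ^ 2))) s := by
  have := ((hasDerivAt_id s).add_const (δ ^ 2)).sqrt hs.ne'
  simpa using this

theorem hasDerivAt_regA {s : ℝ} (hs : 0 < s + δ ^ 2) :
    HasDerivAt (regA κ δ) (regB κ δ s) s := by
  have h := hasDerivAt_sqrt_add hs
  have hp : 0 < √(s + δ ^ 2) := Real.sqrt_pos.2 hs
  have he : HasDerivAt (fun s => Real.exp (-(κ * √(s + δ ^ 2))))
      (Real.exp (-(κ * √(s + δ ^ 2))) * -(κ * (1 / (2 * √(s + δ ^ 2))))) s :=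
    (h.const_mul κ).fun_neg.exp
  have h2 := he.div h hp.ne'
  refine h2.congr_deriv ?_
  unfold regB
  field_simp
  ring

theorem hasDerivAt_regB {s : ℝ} (hs : 0 < s + δ ^ 2) :
    HasDerivAt (regB κ δ) (regC κ δ s) s := by
  have h := hasDerivAt_sqrt_add hs
  have hp : 0 < √(s + δ ^ 2) := Real.sqrt_pos.2 hs
  have he : HasDerivAt (fun s => Real.exp (-(κ * √(s + δ ^ 2))))
      (Real.exp (-(κ * √(s + δ ^ 2))) * -(κ * (1 / (2 * √(s + δ ^ 2))))) s :=
    (h.const_mul κ).fun_neg.exp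
  have hc : HasDerivAt (fun s => 2 * √(s + δ ^ 2) ^ 3)
      (2 * (3 * √(s + δ ^ 2) ^ 2 * (1 / (2 * √(s + δ ^ 2))))) s := by
    simpa using (h.fun_pow 3).const_mul 2
  have h2 := (((h.const_mul κ).add_const 1).fun_mul he).fun_neg.fun_div hc
    (mul_ne_zero two_ne_zero (pow_ne_zero 3 hp.ne'))
  refine h2.congr_deriv ?_
  unfold regC
  field_simp
  ring

theorem continuous_regA (hδ : 0 < δ) : Continuous fun x : E3 => regA κ δ (‖x‖ ^ 2) := by
  unfold regA
  refine Continuous.div (by fun_prop) (by fun_prop) fun x => ?_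
  positivity

theorem continuous_regB (hδ : 0 < δ) : Continuous fun x : E3 => regB κ δ (‖x‖ ^ 2) := by
  unfold regB
  refine Continuous.div (by fun_prop) (by fun_prop) fun x => ?_
  positivity

theorem continuous_regC (hδ : 0 < δ) : Continuous fun x : E3 => regC κ δ (‖x‖ ^ 2) := by
  unfold regC
  refine Continuous.div (by fun_prop) (by fun_prop) fun x => ?_
  positivity

theorem le_sqrt_norm_sq_add (x : E3) : ‖x‖ ≤ √(‖x‖ ^ 2 + δ ^ 2) :=
  Real.le_sqrt_of_sq_le (by nlinarith [sq_nonneg δ])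

theorem delta_le_sqrt (x : E3) : δ ≤ √(‖x‖ ^ 2 + δ ^ 2) :=
  Real.le_sqrt_of_sq_le (by nlinarith [sq_nonneg ‖x‖])

/-- This bound and the next three, uniform in x for fixed δ, only serve to justify integration by
parts against Schwartz functions; their growth as δ → 0 is harmless. -/
theorem abs_regA_le (hκ : 0 ≤ κ) (hδ : 0 < δ) (x : E3) : |regA κ δ (‖x‖ ^ 2)| ≤ 1 / δ := by
  have hp : 0 < √(‖x‖ ^ 2 + δ ^ 2) := by positivity
  unfold regA
  rw [abs_of_nonneg (by positivity)]
  gcongr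
  · simp only [Real.exp_le_one_iff, Left.neg_nonpos_iff]; positivity
  · exact delta_le_sqrt x

theorem abs_regB_mul_le (hκ : 0 ≤ κ) (hδ : 0 < δ) (x : E3) :
    |regB κ δ (‖x‖ ^ 2)| * ‖x‖ ≤ 1 / δ ^ 2 := by
  have hp : 0 < √(‖x‖ ^ 2 + δ ^ 2) := by positivity
  have h1 := mul_exp_neg_le_one (κ * √(‖x‖ ^ 2 + δ ^ 2))
  have hx := le_sqrt_norm_sq_add (δ := δ) x
  have hd := delta_le_sqrt (δ := δ) x
  unfold regB
  set ρ := √(‖x‖ ^ 2 + δ ^ 2)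
  rw [abs_div, abs_neg, abs_of_nonneg (show 0 ≤ (κ * ρ + 1) * Real.exp (-(κ * ρ)) by positivity),
    abs_of_nonneg (show 0 ≤ 2 * ρ ^ 3 by positivity)]
  calc (κ * ρ + 1) * Real.exp (-(κ * ρ)) / (2 * ρ ^ 3) * ‖x‖ ≤ 1 / (2 * ρ ^ 3) * ρ := by
        gcongr
    _ ≤ 1 / ρ ^ 2 := by
        rw [div_mul_eq_mul_div, div_le_div_iff₀ (by positivity) (by positivity)]
        nlinarith [pow_pos hp 3]
    _ ≤ 1 / δ ^ 2 := by gcongr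

theorem abs_regB_le (hκ : 0 ≤ κ) (hδ : 0 < δ) (x : E3) :
    |regB κ δ (‖x‖ ^ 2)| ≤ 1 / δ ^ 3 := by
  have hp : 0 < √(‖x‖ ^ 2 + δ ^ 2) := by positivity
  have h1 := mul_exp_neg_le_one (κ * √(‖x‖ ^ 2 + δ ^ 2))
  have hd := delta_le_sqrt (δ := δ) x
  unfold regB
  set ρ := √(‖x‖ ^ 2 + δ ^ 2)
  rw [abs_div, abs_neg, abs_of_nonneg (show 0 ≤ (κ * ρ + 1) * Real.exp (-(κ * ρ)) by positivity),
    abs_of_nonneg (show 0 ≤ 2 * ρ ^ 3 by positivity)]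
  gcongr
  have := pow_le_pow_left₀ hδ.le hd 3
  nlinarith [pow_pos hp 3]

theorem abs_regC_mul_le (hκ : 0 ≤ κ) (hδ : 0 < δ) (x : E3) :
    |regC κ δ (‖x‖ ^ 2)| * ‖x‖ ^ 2 ≤ 1 / δ ^ 3 := by
  have hp : 0 < √(‖x‖ ^ 2 + δ ^ 2) := by positivity
  have h1 := quadratic_mul_exp_neg_le (t := κ * √(‖x‖ ^ 2 + δ ^ 2)) (by positivity)
  have hx := le_sqrt_norm_sq_add (δ := δ) x
  have hd := delta_le_sqrt (δ := δ) x
  unfold regC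
  set ρ := √(‖x‖ ^ 2 + δ ^ 2)
  rw [abs_of_nonneg (by positivity)]
  calc ((κ * ρ) ^ 2 + 3 * (κ * ρ) + 3) * Real.exp (-(κ * ρ)) / (4 * ρ ^ 5) * ‖x‖ ^ 2
      ≤ 3 / (4 * ρ ^ 5) * ρ ^ 2 := by gcongr
    _ ≤ 1 / ρ ^ 3 := by
        rw [div_mul_eq_mul_div, div_le_div_iff₀ (by positivity) (by positivity)]
        nlinarith [pow_pos hp 5]
    _ ≤ 1 / δ ^ 3 := by gcongr

theorem hasLineDerivAt_norm_sq (x v : E3) :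
    HasLineDerivAt ℝ (fun x : E3 => ‖x‖ ^ 2) (2 * inner ℝ x v) x v := by
  have := ((hasStrictFDerivAt_norm_sq x).hasFDerivAt).hasLineDerivAt v
  simpa using this

theorem hasLineDerivAt_regA (hδ : 0 < δ) (x v : E3) :
    HasLineDerivAt ℝ (fun x : E3 => regA κ δ (‖x‖ ^ 2))
      (regB κ δ (‖x‖ ^ 2) * (2 * inner ℝ x v)) x v := by
  have h1 : HasDerivAt (fun t : ℝ => ‖x + t • v‖ ^ 2) (2 * inner ℝ x v) 0 :=
    hasLineDerivAt_norm_sq x v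
  have h2 : HasDerivAt (regA κ δ) (regB κ δ (‖x + (0 : ℝ) • v‖ ^ 2)) (‖x + (0 : ℝ) • v‖ ^ 2) :=
    hasDerivAt_regA (by positivity)
  have h3 := h2.comp (0 : ℝ) h1
  rw [zero_smul, add_zero] at h3
  exact h3

theorem hasLineDerivAt_regB (hδ : 0 < δ) (x v : E3) :
    HasLineDerivAt ℝ (fun x : E3 => regB κ δ (‖x‖ ^ 2) * (2 * inner ℝ x v))
      (4 * regC κ δ (‖x‖ ^ 2) * inner ℝ x v ^ 2 + 2 * regB κ δ (‖x‖ ^ 2) * ‖v‖ ^ 2) x v := by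
  have h1 : HasDerivAt (fun t : ℝ => ‖x + t • v‖ ^ 2) (2 * inner ℝ x v) 0 :=
    hasLineDerivAt_norm_sq x v
  have h2 : HasDerivAt (regB κ δ) (regC κ δ (‖x + (0 : ℝ) • v‖ ^ 2)) (‖x + (0 : ℝ) • v‖ ^ 2) :=
    hasDerivAt_regB (by positivity)
  have h3 := h2.comp (0 : ℝ) h1
  have h4 : HasDerivAt (fun t : ℝ => 2 * inner ℝ (x + t • v) v) (2 * ‖v‖ ^ 2) 0 := by
    have h5 : (fun t : ℝ => 2 * inner ℝ (x + t • v) v) =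
        fun t : ℝ => 2 * (inner ℝ x v + t * ‖v‖ ^ 2) := by
      funext t
      rw [inner_add_left, real_inner_smul_left, real_inner_self_eq_norm_sq]
    rw [h5]
    have := (((hasDerivAt_id (0 : ℝ)).mul_const (‖v‖ ^ 2)).const_add (inner ℝ x v)).const_mul 2
    simpa using this
  have h6 := h3.mul h4
  unfold HasLineDerivAt
  refine h6.congr_deriv ?_
  simp only [Function.comp_apply, zero_smul, add_zero]
  ring

theorem integrable_bdd_smul_schwartz {f : E3 → ℝ} (hf : Continuous f) {C : ℝ}
    (hC : ∀ x, |f x| ≤ C) (u : 𝓢(E3, ℂ)) : Integrable fun x => f x • u x := by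
  refine (u.integrable (μ := volume)).bdd_smul C hf.aestronglyMeasurable
    (Eventually.of_forall hC)

theorem integral_smul_lineDeriv_schwartz {f f' : E3 → ℝ} {v : E3} {C : ℝ} (hf : Continuous f)
    (hC : ∀ x, |f x| ≤ C) (hf' : Continuous f') (hC' : ∀ x, |f' x| ≤ C)
    (hd : ∀ x, HasLineDerivAt ℝ f (f' x) x v) (u : 𝓢(E3, ℂ)) :
    ∫ x, f x • (∂_{v} u) x = -∫ x, f' x • u x := by
  have hld (x : E3) : HasLineDerivAt ℝ u ((∂_{v} u) x) x v := by
    rw [SchwartzMap.lineDerivOp_apply]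
    exact (u.differentiable.differentiableAt).lineDifferentiableAt.hasLineDerivAt
  have := integral_bilinear_hasLineDerivAt_right_eq_neg_left_of_integrable
    (μ := (volume : Measure E3)) (f := f) (f' := f') (g := u) (g' := fun x => (∂_{v} u) x) (v := v)
    (B := (ContinuousLinearMap.lsmul ℝ ℝ : ℝ →L[ℝ] ℂ →L[ℝ] ℂ))
    (integrable_bdd_smul_schwartz hf' hC' _) (integrable_bdd_smul_schwartz hf hC _)
    (integrable_bdd_smul_schwartz hf hC _) (fun x _ => hd x) (fun x _ => hld x)
  simpa only [ContinuousLinearMap.lsmul_apply] using this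

/-- The second derivative of the regularised kernel in the direction `v`. -/
def regSecond (κ δ : ℝ) (v x : E3) : ℝ :=
  4 * regC κ δ (‖x‖ ^ 2) * inner ℝ x v ^ 2 + 2 * regB κ δ (‖x‖ ^ 2)

theorem continuous_regSecond (hδ : 0 < δ) (v : E3) : Continuous (regSecond κ δ v) :=
  (((continuous_regC hδ).const_mul 4).mul (by fun_prop)).add ((continuous_regB hδ).const_mul 2)

theorem abs_regSecond_le (hκ : 0 ≤ κ) (hδ : 0 < δ) {v : E3} (hv : ‖v‖ = 1) (x : E3) :
    |regSecond κ δ v x| ≤ 4 * (1 / δ ^ 3) + 2 * (1 / δ ^ 3) := by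
  have h1 := abs_regC_mul_le hκ hδ x
  have h2 := abs_real_inner_le_norm x v
  rw [hv, mul_one] at h2
  have h3 := abs_regB_le hκ hδ x
  unfold regSecond
  refine (abs_add_le _ _).trans (add_le_add ?_ ?_)
  · rw [abs_mul, abs_mul, abs_of_nonneg (show (0 : ℝ) ≤ 4 by norm_num), abs_pow, mul_assoc]
    gcongr
    refine le_trans ?_ h1
    gcongr
  · rw [abs_mul, abs_two]
    gcongr

/-- Green's identity for the regularised Yukawa kernel, in one direction. -/
theorem integral_regA_lineDeriv (hκ : 0 ≤ κ) (hδ : 0 < δ) (u : 𝓢(E3, ℂ)) {v : E3} (hv : ‖v‖ = 1) :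
    ∫ x, regA κ δ (‖x‖ ^ 2) • (∂_{v} (∂_{v} u)) x = ∫ x, regSecond κ δ v x • u x := by
  have hb1 (x : E3) : |regB κ δ (‖x‖ ^ 2) * (2 * inner ℝ x v)| ≤ 2 * (1 / δ ^ 2) := by
    rw [abs_mul, abs_mul]
    have h1 := abs_regB_mul_le hκ hδ x
    have h2 := abs_real_inner_le_norm x v
    rw [hv, mul_one] at h2
    calc |regB κ δ (‖x‖ ^ 2)| * (|2| * |inner ℝ x v|)
        ≤ |regB κ δ (‖x‖ ^ 2)| * (|2| * ‖x‖) := by gcongr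
      _ = 2 * (|regB κ δ (‖x‖ ^ 2)| * ‖x‖) := by rw [abs_two]; ring
      _ ≤ _ := by gcongr
  have hc1 : Continuous fun x : E3 => regB κ δ (‖x‖ ^ 2) * (2 * inner ℝ x v) :=
    (continuous_regB hδ).mul (by fun_prop)
  rw [integral_smul_lineDeriv_schwartz (C := max (1 / δ) (2 * (1 / δ ^ 2))) (continuous_regA hδ)
    (fun x => (abs_regA_le hκ hδ x).trans (le_max_left _ _)) hc1
    (fun x => (hb1 x).trans (le_max_right _ _)) (fun x => hasLineDerivAt_regA hδ x v),
    integral_smul_lineDeriv_schwartz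
      (C := max (2 * (1 / δ ^ 2)) (4 * (1 / δ ^ 3) + 2 * (1 / δ ^ 3))) hc1
    (fun x => (hb1 x).trans (le_max_left _ _)) (continuous_regSecond (κ := κ) hδ v)
    (fun x => (abs_regSecond_le hκ hδ hv x).trans (le_max_right _ _)) (fun x => ?_), neg_neg]
  have := hasLineDerivAt_regB (κ := κ) hδ x v
  rwa [hv, one_pow, mul_one] at this

theorem sum_inner_basis_sq (x : E3) :
    ∑ i, inner ℝ x (EuclideanSpace.basisFun (Fin 3) ℝ i) ^ 2 = ‖x‖ ^ 2 := by
  have := (EuclideanSpace.basisFun (Fin 3) ℝ).sum_sq_norm_inner_left x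
  simpa using this

/-- Green's identity for the regularised Yukawa kernel. -/
theorem integral_regA_mul (hκ : 0 ≤ κ) (hδ : 0 < δ) (u : 𝓢(E3, ℂ)) :
    ∫ x, regA κ δ (‖x‖ ^ 2) • ((κ ^ 2 : ℝ) • u x - (Δ u) x) =
      ∫ x, (4 * δ ^ 2 * regC κ δ (‖x‖ ^ 2)) • u x := by
  set b := EuclideanSpace.basisFun (Fin 3) ℝ
  have hA (w : 𝓢(E3, ℂ)) : Integrable fun x => regA κ δ (‖x‖ ^ 2) • w x :=
    integrable_bdd_smul_schwartz (continuous_regA hδ) (abs_regA_le hκ hδ) w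
  have hInt (i : Fin 3) : Integrable fun x => regSecond κ δ (b i) x • u x :=
    integrable_bdd_smul_schwartz (continuous_regSecond hδ _)
      (abs_regSecond_le hκ hδ (b.norm_eq_one i)) u
  have hL : ∫ x, regA κ δ (‖x‖ ^ 2) • (Δ u) x = ∫ x, ∑ i, regSecond κ δ (b i) x • u x := by
    rw [integral_finsetSum _ fun i _ => hInt i]
    simp_rw [← integral_regA_lineDeriv hκ hδ u (b.norm_eq_one _)]
    rw [← integral_finsetSum _ fun i _ => hA _]
    refine integral_congr_ae (Eventually.of_forall fun x => ?_)
    simp only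
    rw [SchwartzMap.laplacian_eq_sum b, sum_apply, Finset.smul_sum]
  have hAk : Integrable fun x => (regA κ δ (‖x‖ ^ 2) * κ ^ 2) • u x := by
    refine ((hA u).smul (κ ^ 2)).congr (Eventually.of_forall fun x => ?_)
    simp only [Pi.smul_apply, smul_smul, mul_comm]
  have e0 : ∫ x, regA κ δ (‖x‖ ^ 2) • ((κ ^ 2 : ℝ) • u x - (Δ u) x) =
      (∫ x, (regA κ δ (‖x‖ ^ 2) * κ ^ 2) • u x) - ∫ x, regA κ δ (‖x‖ ^ 2) • (Δ u) x := by
    rw [← integral_sub hAk (hA (Δ u))]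
    refine integral_congr_ae (Eventually.of_forall fun x => ?_)
    simp only [smul_sub, smul_smul]
  rw [e0, hL, ← integral_sub hAk (integrable_finsetSum _ fun i _ => hInt i)]
  refine integral_congr_ae (Eventually.of_forall fun x => ?_)
  simp only
  rw [← Finset.sum_smul, ← sub_smul]
  congr 1
  have hs := sum_inner_basis_sq x
  -- The Laplacian of F(|x|²) in three dimensions is 4|x|²F'' + 6F'.
  have h3 : ∑ i, regSecond κ δ (b i) x =
      4 * regC κ δ (‖x‖ ^ 2) * ‖x‖ ^ 2 + 6 * regB κ δ (‖x‖ ^ 2) := by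
    simp only [regSecond]
    rw [Finset.sum_add_distrib, ← Finset.mul_sum, hs]
    simp
    ring
  rw [h3]
  have hp : 0 < √(‖x‖ ^ 2 + δ ^ 2) := by positivity
  have hsq : √(‖x‖ ^ 2 + δ ^ 2) ^ 2 = ‖x‖ ^ 2 + δ ^ 2 := Real.sq_sqrt (by positivity)
  -- With ρ² = |x|² + δ² the identity 4ρ²F'' + 6F' = κ²F is exact; replacing ρ² by |x|² leaves the
  -- defect 4δ²F''.
  have hx : ‖x‖ ^ 2 = √(‖x‖ ^ 2 + δ ^ 2) ^ 2 - δ ^ 2 := by rw [hsq]; ring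
  unfold regA regB regC
  set ρ := √(‖x‖ ^ 2 + δ ^ 2)
  rw [hx]
  field_simp
  ring

theorem integrable_profile : Integrable fun y : E3 => 3 / √(‖y‖ ^ 2 + 1) ^ 5 := by
  have h := (integrable_rpow_neg_one_add_norm_sq (E := E3) (μ := volume) (r := 5)
    (by rw [finrank_E3]; norm_num)).const_mul 3
  refine h.congr (Eventually.of_forall fun y => ?_)
  simp only
  have e : √(‖y‖ ^ 2 + 1) ^ 5 = (1 + ‖y‖ ^ 2) ^ (5 / 2 : ℝ) := by
    have hp : 0 ≤ 1 + ‖y‖ ^ 2 := by positivity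
    rw [add_comm, Real.sqrt_eq_rpow]
    generalize 1 + ‖y‖ ^ 2 = s at hp
    rw [← Real.rpow_natCast, ← Real.rpow_mul hp]
    norm_num
  rw [e, neg_div, Real.rpow_neg (by positivity)]; rfl

/-- The radial integrand has the primitive (r/√(r² + 1))³, which rises from 0 to 1. The mass 4π is
the normalisation of the Yukawa kernel. -/
theorem integral_profile : ∫ y : E3, 3 / √(‖y‖ ^ 2 + 1) ^ 5 = 4 * Real.pi := by
  have hi := (integrable_radial_iff fun r => 3 / √(r ^ 2 + 1) ^ 5).1 integrable_profile
  rw [integral_radial fun r => 3 / √(r ^ 2 + 1) ^ 5]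
  have hd : ∀ r ∈ Ioi (0 : ℝ), HasDerivAt (fun r : ℝ => (r / √(r ^ 2 + 1)) ^ 3)
      (r ^ 2 * (3 / √(r ^ 2 + 1) ^ 5)) r := by
    intro r _
    have hp : 0 < √(r ^ 2 + 1) := by positivity
    have hsq : √(r ^ 2 + 1) ^ 2 = r ^ 2 + 1 := Real.sq_sqrt (by positivity)
    have h1 : HasDerivAt (fun r : ℝ => √(r ^ 2 + 1)) (r / √(r ^ 2 + 1)) r := by
      have := (((hasDerivAt_id r).fun_pow 2).add_const 1).sqrt (by positivity)
      refine this.congr_deriv ?_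
      simp
      field_simp
    have h2 := ((hasDerivAt_id r).fun_div h1 hp.ne').fun_pow 3
    refine h2.congr_deriv ?_
    simp only [id_eq]
    have e : 1 * √(r ^ 2 + 1) - r * (r / √(r ^ 2 + 1)) = 1 / √(r ^ 2 + 1) := by
      field_simp
      linarith
    rw [e]
    norm_num
    field_simp
  have ht : Tendsto (fun r : ℝ => (r / √(r ^ 2 + 1)) ^ 3) atTop (𝓝 1) := by
    have h1 : Tendsto (fun r : ℝ => (1 / √(1 + r⁻¹ ^ 2)) ^ 3) atTop (𝓝 1) := by
      have hc : ContinuousAt (fun s : ℝ => (1 / √(1 + s ^ 2)) ^ 3) 0 := by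
        refine ContinuousAt.pow (ContinuousAt.div continuousAt_const (by fun_prop) ?_) 3
        simp
      have := hc.tendsto.comp tendsto_inv_atTop_zero
      simpa [Function.comp_def] using this
    refine h1.congr' ?_
    filter_upwards [eventually_gt_atTop 0] with r hr
    congr 1
    have : r ^ 2 + 1 = r ^ 2 * (1 + r⁻¹ ^ 2) := by field_simp
    rw [this, Real.sqrt_mul (by positivity), Real.sqrt_sq hr.le]
    field_simp
  rw [integral_Ioi_of_hasDerivAt_of_tendsto (by
    refine Continuous.continuousWithinAt ?_
    refine Continuous.pow (Continuous.div continuous_id (by fun_prop) fun r => ?_) 3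
    positivity) hd hi ht]
  simp

theorem tendsto_integral_regA (hκ : 0 < κ) (f : 𝓢(E3, ℂ)) :
    Tendsto (fun δ => ∫ x, regA κ δ (‖x‖ ^ 2) • f x) (𝓝[>] 0)
      (𝓝 (∫ x, (4 * Real.pi * yukawa κ x) • f x)) := by
  have hne : ∀ᵐ x : E3, x ≠ 0 := by
    rw [ae_iff]; simp
  have heq (x : E3) : 4 * Real.pi * yukawa κ x = Real.exp (-(κ * ‖x‖)) / ‖x‖ := by
    unfold yukawa
    have := Real.pi_pos
    by_cases hx : ‖x‖ = 0
    · simp [hx]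
    · field_simp
  have hY : Integrable fun x : E3 => 4 * Real.pi * yukawa κ x * ‖f x‖ := by
    have h1 : MemLp (fun x => yukawa κ x) 2 volume := by
      have := (memLp_yukawa hκ).norm
      refine this.congr_norm (measurable_yukawa κ).aestronglyMeasurable
        (Eventually.of_forall fun x => ?_)
      simp
    have := (integrable_mul_of_memLp_two h1 (f.memLp 2 volume).norm).const_mul (4 * Real.pi)
    simpa only [mul_assoc] using this
  refine tendsto_integral_filter_of_dominated_convergence
    (fun x => 4 * Real.pi * yukawa κ x * ‖f x‖) ?_ ?_ hY ?_
  · filter_upwards [self_mem_nhdsWithin] with δ hδ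
    exact ((continuous_regA hδ).smul f.continuous).aestronglyMeasurable
  · filter_upwards [self_mem_nhdsWithin] with δ hδ
    filter_upwards [hne] with x hx
    have hx' : 0 < ‖x‖ := norm_pos_iff.2 hx
    have hp : 0 < √(‖x‖ ^ 2 + δ ^ 2) := by positivity
    have hle := le_sqrt_norm_sq_add (δ := δ) x
    rw [norm_smul, heq, regA, Real.norm_of_nonneg (by positivity)]
    gcongr
  · filter_upwards [hne] with x hx
    have hx' : 0 < ‖x‖ := norm_pos_iff.2 hx
    rw [heq]
    have hc : ContinuousAt (fun δ : ℝ => regA κ δ (‖x‖ ^ 2)) 0 := by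
      unfold regA
      refine ContinuousAt.div (by fun_prop) (by fun_prop) ?_
      positivity
    have := hc.tendsto
    simp only [regA, ne_eq, OfNat.ofNat_ne_zero, not_false_eq_true, zero_pow, add_zero,
      Real.sqrt_sq hx'.le] at this
    exact (this.mono_left nhdsWithin_le_nhds).smul_const (f x)

/-- The substitution x = δy exhibits the defect as an approximate identity: its profile tends to
3/(|y|² + 1)^{5/2} as δ → 0. -/
theorem integral_regC_scale (hδ : 0 < δ) (u : 𝓢(E3, ℂ)) :
    ∫ x, (4 * δ ^ 2 * regC κ δ (‖x‖ ^ 2)) • u x =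
      ∫ y : E3, (((κ * (δ * √(‖y‖ ^ 2 + 1))) ^ 2 + 3 * (κ * (δ * √(‖y‖ ^ 2 + 1))) + 3) *
        Real.exp (-(κ * (δ * √(‖y‖ ^ 2 + 1)))) / √(‖y‖ ^ 2 + 1) ^ 5) • u (δ • y) := by
  have h := Measure.integral_comp_smul (volume : Measure E3)
    (fun x => (4 * δ ^ 2 * regC κ δ (‖x‖ ^ 2)) • u x) δ
  rw [finrank_E3, abs_of_nonneg (by positivity)] at h
  have h' := (inv_smul_eq_iff₀ (pow_ne_zero 3 hδ.ne')).1 h.symm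
  rw [h', ← integral_smul]
  refine integral_congr_ae (Eventually.of_forall fun y => ?_)
  simp only [smul_smul]
  congr 1
  have e : √(‖δ • y‖ ^ 2 + δ ^ 2) = δ * √(‖y‖ ^ 2 + 1) := by
    rw [norm_smul, Real.norm_of_nonneg hδ.le,
      show (δ * ‖y‖) ^ 2 + δ ^ 2 = δ ^ 2 * (‖y‖ ^ 2 + 1) by ring,
      Real.sqrt_mul (by positivity), Real.sqrt_sq hδ.le]
  have hp : 0 < √(‖y‖ ^ 2 + 1) := by positivity
  unfold regC
  rw [e]
  field_simp

/-- The Yukawa kernel is the fundamental solution of `-Δ + κ²`. -/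
theorem integral_yukawa_smul_schwartz (hκ : 0 < κ) (u : 𝓢(E3, ℂ)) :
    ∫ x, yukawa κ x • ((κ ^ 2 : ℝ) • u x - (Δ u) x) = u 0 := by
  have h1 := tendsto_integral_regA hκ ((κ ^ 2 : ℝ) • u - Δ u)
  have h2 : Tendsto (fun δ => ∫ y : E3,
      (((κ * (δ * √(‖y‖ ^ 2 + 1))) ^ 2 + 3 * (κ * (δ * √(‖y‖ ^ 2 + 1))) + 3) *
        Real.exp (-(κ * (δ * √(‖y‖ ^ 2 + 1)))) / √(‖y‖ ^ 2 + 1) ^ 5) • u (δ • y)) (𝓝[>] 0)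
      (𝓝 (∫ y : E3, (3 / √(‖y‖ ^ 2 + 1) ^ 5) • u 0)) := by
    obtain ⟨C, hC⟩ : ∃ C, ∀ x, ‖u x‖ ≤ C := by
      obtain ⟨C, hC⟩ := u.decay 0 0
      exact ⟨C, fun x => by simpa using hC.2 x⟩
    refine tendsto_integral_filter_of_dominated_convergence
      (fun y => 3 / √(‖y‖ ^ 2 + 1) ^ 5 * C) ?_ ?_ (integrable_profile.mul_const C) ?_
    · refine Eventually.of_forall fun δ => Continuous.aestronglyMeasurable ?_
      have hc : Continuous fun y : E3 =>
          ((κ * (δ * √(‖y‖ ^ 2 + 1))) ^ 2 + 3 * (κ * (δ * √(‖y‖ ^ 2 + 1))) + 3) *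
          Real.exp (-(κ * (δ * √(‖y‖ ^ 2 + 1)))) / √(‖y‖ ^ 2 + 1) ^ 5 := by
        refine Continuous.div (by fun_prop) (by fun_prop) fun y => ?_
        positivity
      exact hc.smul (u.continuous.comp (by fun_prop))
    · filter_upwards [self_mem_nhdsWithin] with δ hδ
      refine Eventually.of_forall fun y => ?_
      have hδ' : 0 < δ := hδ
      have hq := quadratic_mul_exp_neg_le (t := κ * (δ * √(‖y‖ ^ 2 + 1))) (by positivity)
      rw [norm_smul, Real.norm_of_nonneg (by positivity)]
      have := hC (δ • y)
      gcongr
    · refine Eventually.of_forall fun y => ?_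
      have hc : Continuous fun δ : ℝ =>
        (((κ * (δ * √(‖y‖ ^ 2 + 1))) ^ 2 + 3 * (κ * (δ * √(‖y‖ ^ 2 + 1))) + 3) *
        Real.exp (-(κ * (δ * √(‖y‖ ^ 2 + 1)))) / √(‖y‖ ^ 2 + 1) ^ 5) • u (δ • y) := by
        have hc' : Continuous fun δ : ℝ =>
          ((κ * (δ * √(‖y‖ ^ 2 + 1))) ^ 2 + 3 * (κ * (δ * √(‖y‖ ^ 2 + 1))) + 3) *
          Real.exp (-(κ * (δ * √(‖y‖ ^ 2 + 1)))) / √(‖y‖ ^ 2 + 1) ^ 5 := by fun_prop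
        exact hc'.smul (u.continuous.comp (by fun_prop))
      have := hc.tendsto 0
      simp only [zero_mul, mul_zero, ne_eq, OfNat.ofNat_ne_zero, not_false_eq_true, zero_pow,
        zero_add, neg_zero, Real.exp_zero, mul_one, zero_smul] at this
      exact this.mono_left nhdsWithin_le_nhds
  rw [integral_smul_const, integral_profile] at h2
  have h3 : (fun δ => ∫ x, regA κ δ (‖x‖ ^ 2) • ((κ ^ 2 : ℝ) • u - Δ u) x) =ᶠ[𝓝[>] 0]
      fun δ => ∫ y : E3,
      (((κ * (δ * √(‖y‖ ^ 2 + 1))) ^ 2 + 3 * (κ * (δ * √(‖y‖ ^ 2 + 1))) + 3) *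
        Real.exp (-(κ * (δ * √(‖y‖ ^ 2 + 1)))) / √(‖y‖ ^ 2 + 1) ^ 5) • u (δ • y) := by
    filter_upwards [self_mem_nhdsWithin] with δ hδ
    rw [← integral_regC_scale hδ, ← integral_regA_mul hκ.le hδ]
    rfl
  have h4 := tendsto_nhds_unique (h1.congr' h3) h2
  simp_rw [mul_smul (4 * Real.pi)] at h4
  rw [integral_smul] at h4
  exact smul_right_injective ℂ (show (4 * Real.pi) ≠ 0 by positivity) h4

end Regularised


/-! ### The form domain and the free resolvent -/

open scoped SchwartzMap InnerProduct

/-- Pointwise complex conjugation of Schwartz functions. -/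
def conjSchwartz (u : 𝓢(E3, ℂ)) : 𝓢(E3, ℂ) :=
  SchwartzMap.postcompCLM (𝕜 := ℝ) (Complex.conjCLE : ℂ →L[ℝ] ℂ) u

theorem conjSchwartz_apply (u : 𝓢(E3, ℂ)) (x : E3) : conjSchwartz u x = conj (u x) := rfl

theorem conjSchwartz_conjSchwartz (u : 𝓢(E3, ℂ)) : conjSchwartz (conjSchwartz u) = u := by
  ext x; simp [conjSchwartz_apply]

theorem lineDerivOp_conjSchwartz (m : E3) (u : 𝓢(E3, ℂ)) :
    ∂_{m} (conjSchwartz u) = conjSchwartz (∂_{m} u) := by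
  ext x
  rw [conjSchwartz_apply, SchwartzMap.lineDerivOp_apply_eq_fderiv,
    SchwartzMap.lineDerivOp_apply_eq_fderiv]
  have h := (Complex.conjCLE : ℂ →L[ℝ] ℂ).hasFDerivAt.comp x (u.hasFDerivAt x)
  have h' : HasFDerivAt (conjSchwartz u) _ x := h
  rw [h'.fderiv]
  rfl

theorem laplacian_conjSchwartz (u : 𝓢(E3, ℂ)) : Δ (conjSchwartz u) = conjSchwartz (Δ u) := by
  rw [SchwartzMap.laplacian_eq_sum (EuclideanSpace.basisFun (Fin 3) ℝ),
    SchwartzMap.laplacian_eq_sum (EuclideanSpace.basisFun (Fin 3) ℝ)]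
  simp only [lineDerivOp_conjSchwartz]
  exact (map_sum (SchwartzMap.postcompCLM (𝕜 := ℝ) (Complex.conjCLE : ℂ →L[ℝ] ℂ)) _ _).symm

/-- The class in `L²(ℝ³)` of a Schwartz function. -/
def schwartzL2 : 𝓢(E3, ℂ) →L[ℂ] L2 := SchwartzMap.toLpCLM ℂ ℂ 2 volume

theorem coeFn_schwartzL2 (u : 𝓢(E3, ℂ)) : schwartzL2 u =ᵐ[volume] u :=
  u.coeFn_toLp 2 volume

theorem denseRange_schwartzL2 : DenseRange schwartzL2 :=
  SchwartzMap.denseRange_toLpCLM (by simp)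

theorem eq_zero_of_inner_schwartzL2 {f : L2} (h : ∀ u, inner ℂ (schwartzL2 u) f = 0) : f = 0 := by
  have hc : IsClosed {g : L2 | inner ℂ g f = 0} :=
    isClosed_eq (continuous_id.inner continuous_const) continuous_const
  exact inner_self_eq_zero.1 (denseRange_schwartzL2.induction_on (p := fun g => inner ℂ g f = 0) f
    hc h)

/-- Distributions pair bilinearly and the inner product is conjugate linear on the left; conjugation
of the test function reconciles them. -/
theorem toTemperedDistribution_conjSchwartz (f : L2) (u : 𝓢(E3, ℂ)) :
    Lp.toTemperedDistribution f (conjSchwartz u) = inner ℂ (schwartzL2 u) f := by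
  rw [Lp.toTemperedDistribution_apply, L2_inner_eq]
  refine integral_congr_ae ?_
  filter_upwards [coeFn_schwartzL2 u] with x hx
  rw [hx]
  rfl

theorem temperedDistribution_ext {S T : 𝓢(E3, ℂ) →Lₚₜ[ℂ] ℂ}
    (h : ∀ u, S (conjSchwartz u) = T (conjSchwartz u)) : S = T := by
  ext u
  simpa only [conjSchwartz_conjSchwartz] using h (conjSchwartz u)

theorem isWeakGradient_iff {g : L2} {D : Fin 3 → L2} :
    IsWeakGradient g D ↔ ∀ i u, inner ℂ (schwartzL2 (∂_{(EuclideanSpace.single i 1 : E3)} u)) g =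
      -inner ℂ (schwartzL2 u) (D i) := by
  have key (i : Fin 3) (u : 𝓢(E3, ℂ)) :
      (∂_{(EuclideanSpace.single i 1 : E3)} (Lp.toTemperedDistribution g)) (conjSchwartz u) =
        -inner ℂ (schwartzL2 (∂_{(EuclideanSpace.single i 1 : E3)} u)) g := by
    rw [TemperedDistribution.lineDerivOp_apply_apply, map_neg, lineDerivOp_conjSchwartz,
      toTemperedDistribution_conjSchwartz]
  constructor
  · intro h i u
    have := congrArg (fun T : 𝓢(E3, ℂ) →Lₚₜ[ℂ] ℂ => T (conjSchwartz u)) (h i)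
    simp only [key, toTemperedDistribution_conjSchwartz] at this
    rw [← this, neg_neg]
  · intro h i
    refine temperedDistribution_ext fun u => ?_
    rw [key, h, neg_neg, toTemperedDistribution_conjSchwartz]

theorem neg_laplacian_eq_iff {f k : L2} :
    -Δ (Lp.toTemperedDistribution f) = Lp.toTemperedDistribution k ↔
      ∀ u, -inner ℂ (schwartzL2 (Δ u)) f = inner ℂ (schwartzL2 u) k := by
  have key (u : 𝓢(E3, ℂ)) : (-Δ (Lp.toTemperedDistribution f)) (conjSchwartz u) =
      -inner ℂ (schwartzL2 (Δ u)) f := by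
    rw [neg_apply, TemperedDistribution.laplacian_apply_apply, laplacian_conjSchwartz,
      toTemperedDistribution_conjSchwartz]
  constructor
  · intro h u
    rw [← key, h, toTemperedDistribution_conjSchwartz]
  · intro h
    refine temperedDistribution_ext fun u => ?_
    rw [key, h, toTemperedDistribution_conjSchwartz]

theorem isWeakGradient_schwartzL2 (u : 𝓢(E3, ℂ)) :
    IsWeakGradient (schwartzL2 u)
      fun i => schwartzL2 (∂_{(EuclideanSpace.single i 1 : E3)} u) := by
  intro i
  have h (u : 𝓢(E3, ℂ)) : Lp.toTemperedDistribution (schwartzL2 u) =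
      SchwartzMap.toTemperedDistributionCLM E3 ℂ volume u :=
    Lp.toTemperedDistribution_toLp_eq u
  rw [h, h, TemperedDistribution.lineDerivOp_toTemperedDistributionCLM_eq]

/-- The operator `-Δ + κ²` on Schwartz functions. -/
def helmholtz (κ : ℝ) (u : 𝓢(E3, ℂ)) : 𝓢(E3, ℂ) := (κ ^ 2 : ℝ) • u - Δ u

theorem schwartzL2_helmholtz (κ : ℝ) (u : 𝓢(E3, ℂ)) :
    schwartzL2 (helmholtz κ u) = ((κ ^ 2 : ℝ) : ℂ) • schwartzL2 u - schwartzL2 (Δ u) := by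
  rw [helmholtz, map_sub, ← map_smul]
  rfl

theorem inner_schwartzL2_helmholtz (κ : ℝ) (u : 𝓢(E3, ℂ)) (f : L2) :
    inner ℂ (schwartzL2 (helmholtz κ u)) f =
      ((κ ^ 2 : ℝ) : ℂ) * inner ℂ (schwartzL2 u) f - inner ℂ (schwartzL2 (Δ u)) f := by
  rw [schwartzL2_helmholtz, inner_sub_left, inner_smul_left, Complex.conj_ofReal]

/-- On the Fourier side the operator multiplies by κ² + 4π²|ξ|², whose reciprocal has temperate
growth since κ > 0. Hence (-Δ + κ²)u ranges over all test functions. -/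
theorem surjective_helmholtz {κ : ℝ} (hκ : 0 < κ) : Function.Surjective (helmholtz κ) := by
  have hg : (fun x : E3 => κ ^ 2 + (2 * Real.pi) ^ 2 * ‖x‖ ^ 2).HasTemperateGrowth := by
    fun_prop
  have hi : (fun x : E3 => (κ ^ 2 + (2 * Real.pi) ^ 2 * ‖x‖ ^ 2)⁻¹).HasTemperateGrowth := by
    have h1 := Function.hasTemperateGrowth_one_add_norm_sq_rpow E3 (-1)
    have h2 : (fun x : E3 => (2 * Real.pi / κ) • x).HasTemperateGrowth :=
      ((2 * Real.pi / κ) • ContinuousLinearMap.id ℝ E3).hasTemperateGrowth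
    have h3 := h1.comp h2
    have h4 : (fun _ : E3 => (κ ^ 2)⁻¹).HasTemperateGrowth := .const _
    have h5 := h4.mul h3
    refine (congrArg Function.HasTemperateGrowth (funext fun x => ?_)).mp h5
    symm
    simp only [Pi.mul_apply, Function.comp_apply, norm_smul, Real.rpow_neg_one]
    rw [Real.norm_of_nonneg (by positivity), ← mul_inv]
    congr 1
    field_simp
  have hL (u : 𝓢(E3, ℂ)) : helmholtz κ u = SchwartzMap.fourierMultiplierCLM ℂ
      (fun x : E3 => κ ^ 2 + (2 * Real.pi) ^ 2 * ‖x‖ ^ 2) u := by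
    rw [helmholtz, SchwartzMap.laplacian_eq_fourierMultiplierCLM]
    have e : (fun x : E3 => κ ^ 2 + (2 * Real.pi) ^ 2 * ‖x‖ ^ 2) =
      ∑ i : Fin 2, ![fun _ : E3 => κ ^ 2, fun x => (2 * Real.pi) ^ 2 * ‖x‖ ^ 2] i := by
      ext x; simp [Fin.sum_univ_two]
    have e2 : (fun x : E3 => (2 * Real.pi) ^ 2 * ‖x‖ ^ 2) =
      (2 * Real.pi) ^ 2 • fun x : E3 => ‖x‖ ^ 2 := by ext; simp
    have := SchwartzMap.fourierMultiplierCLM_sum ℂ (s := Finset.univ)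
      (g := ![fun _ : E3 => κ ^ 2, fun x => (2 * Real.pi) ^ 2 * ‖x‖ ^ 2]) (by
        intro i _
        fin_cases i
        · exact .const _
        · simp only [Fin.mk_one, Matrix.cons_val_one, Matrix.cons_val_fin_one]; fun_prop)
    have h2 := SchwartzMap.fourierMultiplierCLM_smul (F := ℂ) (g := fun x : E3 => ‖x‖ ^ 2)
      (by fun_prop) ((2 * Real.pi) ^ 2)
    rw [← e2] at h2
    have e3 : (∑ i : Fin 2, ![fun _ : E3 => κ ^ 2, fun x => (2 * Real.pi) ^ 2 * ‖x‖ ^ 2] i) =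
      fun x : E3 => ∑ i : Fin 2, ![fun _ : E3 => κ ^ 2, fun x => (2 * Real.pi) ^ 2 * ‖x‖ ^ 2] i x := by
      ext; simp
    rw [e, e3, this]
    simp only [Fin.sum_univ_two, Matrix.cons_val_zero, Matrix.cons_val_one,
      Matrix.cons_val_fin_one, add_apply]
    rw [SchwartzMap.fourierMultiplierCLM_const, h2]
    simp only [smul_apply, ContinuousLinearMap.id_apply, neg_smul, sub_neg_eq_add]
  intro w
  refine ⟨SchwartzMap.fourierMultiplierCLM ℂ
    (fun x : E3 => (κ ^ 2 + (2 * Real.pi) ^ 2 * ‖x‖ ^ 2)⁻¹) w, ?_⟩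
  rw [hL, SchwartzMap.fourierMultiplierCLM_fourierMultiplierCLM_apply hg hi]
  have : ((fun x : E3 => κ ^ 2 + (2 * Real.pi) ^ 2 * ‖x‖ ^ 2) *
      fun x : E3 => (κ ^ 2 + (2 * Real.pi) ^ 2 * ‖x‖ ^ 2)⁻¹) = fun _ => 1 := by
    ext x
    exact mul_inv_cancel₀ (by positivity)
  rw [this, SchwartzMap.fourierMultiplierCLM_const]
  simp

theorem eq_of_inner_helmholtz {κ : ℝ} (hκ : 0 < κ) {f g : L2}
    (h : ∀ u, inner ℂ (schwartzL2 (helmholtz κ u)) f = inner ℂ (schwartzL2 (helmholtz κ u)) g) :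
    f = g := by
  refine sub_eq_zero.1 (eq_zero_of_inner_schwartzL2 fun u => ?_)
  obtain ⟨u, rfl⟩ := surjective_helmholtz hκ u
  rw [inner_sub_right, h, sub_self]

/-- The ambient Hilbert space of the form domain: a function and its three derivatives. -/
abbrev Jet : Type := PiLp 2 fun _ : Fin 4 => L2

/-- The Sobolev space `H¹(ℝ³)` with the norm `(‖∇g‖² + κ²‖g‖²)^{1/2}`, realised as the space of all
`(κ g, ∂₁g, ∂₂g, ∂₃g)`. -/
def formSpace (κ : ℝ) : Submodule ℂ Jet where
  carrier := {z | ∀ (i : Fin 3) (u : 𝓢(E3, ℂ)),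
    inner ℂ (schwartzL2 (∂_{(EuclideanSpace.single i 1 : E3)} u)) (z 0) =
      -((κ : ℂ) * inner ℂ (schwartzL2 u) (z i.succ))}
  zero_mem' := by intro i u; simp
  add_mem' := by
    intro z z' h h' i u
    simp only [PiLp.add_apply, inner_add_right, h i u, h' i u]
    ring
  smul_mem' := by
    intro c z h i u
    simp only [PiLp.smul_apply, inner_smul_right, h i u]
    ring

theorem isClosed_formSpace (κ : ℝ) : IsClosed (formSpace κ : Set Jet) := by
  have : (formSpace κ : Set Jet) = ⋂ (i : Fin 3) (u : 𝓢(E3, ℂ)),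
      {z | inner ℂ (schwartzL2 (∂_{(EuclideanSpace.single i 1 : E3)} u)) (z 0) =
      -((κ : ℂ) * inner ℂ (schwartzL2 u) (z i.succ))} := by
    ext z
    simp only [SetLike.mem_coe, mem_iInter]
    rfl
  rw [this]
  refine isClosed_iInter fun i => isClosed_iInter fun u => isClosed_eq ?_ ?_ <;> fun_prop

instance (κ : ℝ) : CompleteSpace (formSpace κ) := (isClosed_formSpace κ).completeSpace_coe

/-- The embedding of `H¹(ℝ³)` into `L²(ℝ³)`. -/
def formEmb (κ : ℝ) : formSpace κ →L[ℂ] L2 :=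
  ((κ⁻¹ : ℝ) : ℂ) • (PiLp.proj 2 (fun _ : Fin 4 => L2) 0 ∘L (formSpace κ).subtypeL)

variable {κ : ℝ}

theorem formEmb_apply (z : formSpace κ) : formEmb κ z = ((κ⁻¹ : ℝ) : ℂ) • z.1 0 := rfl

theorem coe_zero_eq (hκ : 0 < κ) (z : formSpace κ) : z.1 0 = (κ : ℂ) • formEmb κ z := by
  have : (κ : ℂ) ≠ 0 := by exact_mod_cast hκ.ne'
  rw [formEmb_apply, smul_smul]
  push_cast
  rw [mul_inv_cancel₀ this, one_smul]

theorem isWeakGradient_formEmb (hκ : 0 < κ) (z : formSpace κ) :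
    IsWeakGradient (formEmb κ z) fun i => z.1 i.succ := by
  have : (κ : ℂ) ≠ 0 := by exact_mod_cast hκ.ne'
  refine isWeakGradient_iff.2 fun i u => ?_
  have := z.2 i u
  rw [formEmb_apply, inner_smul_right, this]
  push_cast
  field_simp

theorem exists_formEmb_eq (hκ : 0 < κ) {g : L2} {D : Fin 3 → L2} (h : IsWeakGradient g D) :
    ∃ z : formSpace κ, formEmb κ z = g ∧ ∀ i : Fin 3, z.1 i.succ = D i := by
  have hκ' : (κ : ℂ) ≠ 0 := by exact_mod_cast hκ.ne'
  refine ⟨⟨WithLp.toLp 2 (Fin.cons ((κ : ℂ) • g) D), fun i u => ?_⟩, ?_, fun i => ?_⟩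
  · simp only [Fin.cons_zero, Fin.cons_succ, inner_smul_right, isWeakGradient_iff.1 h]
    ring
  · rw [formEmb_apply]
    simp only [Fin.cons_zero, smul_smul]
    push_cast
    rw [inv_mul_cancel₀ hκ', one_smul]
  · simp

theorem inner_formSpace (hκ : 0 < κ) (z z' : formSpace κ) :
    inner ℂ z z' = ((κ ^ 2 : ℝ) : ℂ) * inner ℂ (formEmb κ z) (formEmb κ z') +
      ∑ i : Fin 3, inner ℂ (z.1 i.succ) (z'.1 i.succ) := by
  rw [Submodule.coe_inner, PiLp.inner_apply, Fin.sum_univ_succ, coe_zero_eq hκ, coe_zero_eq hκ,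
    inner_smul_left, inner_smul_right, Complex.conj_ofReal]
  push_cast
  ring

theorem formEmb_injective (hκ : 0 < κ) : Function.Injective (formEmb κ) := by
  refine (injective_iff_map_eq_zero _).2 fun z hz => ?_
  have h := isWeakGradient_iff.1 (isWeakGradient_formEmb hκ z)
  have h0 := coe_zero_eq hκ z
  rw [hz, smul_zero] at h0
  have hs (i : Fin 3) : z.1 i.succ = 0 := by
    refine eq_zero_of_inner_schwartzL2 fun u => ?_
    have := h i u
    rw [hz, inner_zero_right] at this
    exact neg_eq_zero.1 this.symm
  ext1
  ext1 i
  refine Fin.cases ?_ (fun i => ?_) i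
  · simpa using h0
  · simpa using hs i

/-- Integration by parts: against a Schwartz function the H¹ inner product becomes an L² pairing
with (-Δ + κ²)u. This identifies J J*, for the embedding J of H¹ into L², as the free resolvent. -/
theorem exists_formEmb_eq_schwartzL2 (hκ : 0 < κ) (u : 𝓢(E3, ℂ)) :
    ∃ z : formSpace κ, formEmb κ z = schwartzL2 u ∧
      ∀ y, inner ℂ z y = inner ℂ (schwartzL2 (helmholtz κ u)) (formEmb κ y) := by
  obtain ⟨z, hz, hD⟩ := exists_formEmb_eq hκ (isWeakGradient_schwartzL2 u)
  refine ⟨z, hz, fun y => ?_⟩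
  rw [inner_formSpace hκ, hz, inner_schwartzL2_helmholtz, sub_eq_add_neg]
  congr 1
  have h := isWeakGradient_iff.1 (isWeakGradient_formEmb hκ y)
  rw [SchwartzMap.laplacian_eq_sum (EuclideanSpace.basisFun (Fin 3) ℝ), map_sum, sum_inner,
    ← Finset.sum_neg_distrib]
  refine Finset.sum_congr rfl fun i _ => ?_
  rw [hD, EuclideanSpace.basisFun_apply, h, neg_neg]

/-- The free resolvent `(-Δ + κ²)⁻¹`. -/
def freeRes (κ : ℝ) : L2 →L[ℂ] L2 := formEmb κ ∘L (formEmb κ)†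

theorem freeRes_apply (κ : ℝ) (h : L2) : freeRes κ h = formEmb κ (((formEmb κ)†) h) := rfl

theorem isSelfAdjoint_freeRes (κ : ℝ) : IsSelfAdjoint (freeRes κ) := by
  rw [ContinuousLinearMap.isSelfAdjoint_iff', freeRes, ContinuousLinearMap.adjoint_comp,
    ContinuousLinearMap.adjoint_adjoint]

/-- The range of the embedding contains the Schwartz functions and is therefore dense. -/
theorem injective_adjoint_formEmb (hκ : 0 < κ) : Function.Injective ((formEmb κ)†) := by
  refine (injective_iff_map_eq_zero _).2 fun h hh => ?_
  refine eq_zero_of_inner_schwartzL2 fun u => ?_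
  obtain ⟨z, hz, -⟩ := exists_formEmb_eq_schwartzL2 hκ u
  rw [← hz, ← ContinuousLinearMap.adjoint_inner_right, hh, inner_zero_right]

theorem injective_freeRes (hκ : 0 < κ) : Function.Injective (freeRes κ) :=
  (formEmb_injective hκ).comp (injective_adjoint_formEmb hκ)

theorem inner_helmholtz_freeRes (hκ : 0 < κ) (u : 𝓢(E3, ℂ)) (h : L2) :
    inner ℂ (schwartzL2 (helmholtz κ u)) (freeRes κ h) = inner ℂ (schwartzL2 u) h := by
  obtain ⟨z, hz, hz'⟩ := exists_formEmb_eq_schwartzL2 hκ u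
  rw [freeRes_apply, ← hz', ContinuousLinearMap.adjoint_inner_right, hz]

/-- The distributional equation (-Δ + κ²)f = h has at most one solution in L², so identities between
resolvents may be checked on test functions. -/
theorem eq_freeRes_iff (hκ : 0 < κ) {f h : L2} : f = freeRes κ h ↔
    ∀ u, inner ℂ (schwartzL2 (helmholtz κ u)) f = inner ℂ (schwartzL2 u) h := by
  constructor
  · rintro rfl u
    exact inner_helmholtz_freeRes hκ u h
  · intro H
    exact eq_of_inner_helmholtz hκ fun u => by rw [H, inner_helmholtz_freeRes hκ]

theorem memSobolev_two_of_neg_laplacian_eq {f k : L2}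
    (h : -Δ (Lp.toTemperedDistribution f) = Lp.toTemperedDistribution k) :
    TemperedDistribution.MemSobolev 2 2 (Lp.toTemperedDistribution f) := by
  have e : (fun x : E3 => (((1 + ‖x‖ ^ 2) ^ ((2 : ℝ) / 2) : ℝ) : ℂ)) =
      fun x => ∑ i : Fin 2, ![fun _ : E3 => (1 : ℂ), fun x => ((‖x‖ ^ 2 : ℝ) : ℂ)] i x := by
    ext x; simp [Fin.sum_univ_two]
  have h1 := TemperedDistribution.fourierMultiplierCLM_sum ℂ (s := Finset.univ)
    (g := ![fun _ : E3 => (1 : ℂ), fun x => ((‖x‖ ^ 2 : ℝ) : ℂ)]) (by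
      intro i _
      fin_cases i
      · exact .const _
      · simp only [Fin.mk_one, Matrix.cons_val_one, Matrix.cons_val_fin_one]; fun_prop)
  have h2 := TemperedDistribution.laplacian_eq_fourierMultiplierCLM (Lp.toTemperedDistribution f)
  -- The Bessel multiplier of order 2 is 1 + |ξ|², whereas -Δ is (2π)²|ξ|² in this normalisation of
  -- the Fourier transform; hence the factor (2π)⁻².
  refine ⟨f + (((2 * Real.pi) ^ 2)⁻¹ : ℝ) • k, ?_⟩
  rw [TemperedDistribution.besselPotential, e, h1]
  simp only [Fin.sum_univ_two, Matrix.cons_val_zero, Matrix.cons_val_one,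
      Matrix.cons_val_fin_one, add_apply]
  have h3 : Lp.toTemperedDistribution (f + (((2 * Real.pi) ^ 2)⁻¹ : ℝ) • k) =
      Lp.toTemperedDistribution f +
        ((((2 * Real.pi) ^ 2)⁻¹ : ℝ) : ℂ) • Lp.toTemperedDistribution k := by
    simp only [← Lp.toTemperedDistributionCLM_apply, map_add]
    congr 1
    rw [← map_smul]
    rfl
  rw [h3, ← h, h2, TemperedDistribution.fourierMultiplierCLM_const]
  simp only [one_smul, ContinuousLinearMap.id_apply, neg_smul, neg_neg]
  congr 1
  ext u
  simp only [smul_apply, Complex.real_smul, smul_eq_mul]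
  rw [← mul_assoc, ← Complex.ofReal_mul, inv_mul_cancel₀ (by positivity), Complex.ofReal_one,
    one_mul]

theorem freeGraph_eq_resolventGraph (hκ : 0 < κ) : freeGraph = resolventGraph κ (freeRes κ) := by
  ext ⟨f, k⟩
  constructor
  · rintro ⟨-, h⟩
    have hf : f = freeRes κ (k + ((κ ^ 2 : ℝ) : ℂ) • f) := by
      refine (eq_freeRes_iff hκ).2 fun u => ?_
      have := neg_laplacian_eq_iff.1 h u
      simp only at this
      rw [inner_schwartzL2_helmholtz, inner_add_right, inner_smul_right, ← this]
      ring
    refine ⟨_, Prod.ext hf ?_⟩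
    simp only [← hf, add_sub_cancel_right]
  · rintro ⟨h, hh⟩
    obtain ⟨rfl, rfl⟩ := Prod.ext_iff.1 hh
    have : -Δ (Lp.toTemperedDistribution (freeRes κ h)) =
        Lp.toTemperedDistribution (h - ((κ ^ 2 : ℝ) : ℂ) • freeRes κ h) := by
      refine neg_laplacian_eq_iff.2 fun u => ?_
      have := inner_helmholtz_freeRes hκ u h
      rw [inner_schwartzL2_helmholtz] at this
      rw [inner_sub_right, inner_smul_right, ← this]
      ring
    exact ⟨memSobolev_two_of_neg_laplacian_eq this, this⟩


/-! ### The free resolvent as a convolution, and the point interaction -/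

open scoped SchwartzMap InnerProduct

variable {κ : ℝ}

/-- The translate `y ↦ G(x - y)` of the Yukawa kernel. -/
def yukawaShift (κ : ℝ) (x : E3) : L2 := DomAddAct.mk (-x) +ᵥ yukawaLp κ

theorem coeFn_yukawaShift (hκ : 0 < κ) (x : E3) :
    yukawaShift κ x =ᵐ[volume] fun y => (yukawa κ (x - y) : ℂ) := by
  rw [yukawaShift, yukawaLp, dif_pos hκ, DomAddAct.mk_vadd_toLp]
  refine (MemLp.coeFn_toLp _).trans (Eventually.of_forall fun y => ?_)
  simp only [yukawa_sub_comm κ x y, vadd_eq_add, neg_add_eq_sub]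

theorem yukawaShift_zero (κ : ℝ) : yukawaShift κ 0 = yukawaLp κ := by
  rw [yukawaShift, neg_zero]
  exact zero_vadd _ _

theorem norm_yukawaShift (κ : ℝ) (x : E3) : ‖yukawaShift κ x‖ = ‖yukawaLp κ‖ :=
  DomAddAct.norm_vadd_Lp _ _

theorem continuous_yukawaShift (κ : ℝ) : Continuous (yukawaShift κ) := by
  have hc : Continuous fun x : E3 => DomAddAct.mk (-x) :=
    DomAddAct.continuous_mk.comp continuous_neg
  have : Fact ((2 : ℝ≥0∞) ≠ ⊤) := ⟨by simp⟩
  exact hc.vadd continuous_const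

/-- The convolution of the Yukawa kernel with a function in `L²(ℝ³)`. -/
def yukawaConv (κ : ℝ) (h : L2) (x : E3) : ℂ := ∫ y, (yukawa κ (x - y) : ℂ) * h y

theorem yukawaConv_eq_inner (hκ : 0 < κ) (h : L2) (x : E3) :
    yukawaConv κ h x = inner ℂ (yukawaShift κ x) h := by
  rw [L2_inner_eq, yukawaConv]
  refine integral_congr_ae ?_
  filter_upwards [coeFn_yukawaShift hκ x] with y hy
  rw [hy, Complex.conj_ofReal]

theorem continuous_yukawaConv (hκ : 0 < κ) (h : L2) : Continuous (yukawaConv κ h) := by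
  simp only [funext (yukawaConv_eq_inner hκ h)]
  exact (continuous_yukawaShift κ).inner continuous_const

theorem yukawaConv_zero (hκ : 0 < κ) (h : L2) : yukawaConv κ h 0 = inner ℂ (yukawaLp κ) h := by
  rw [yukawaConv_eq_inner hκ, yukawaShift_zero]

theorem integrable_yukawa_mul_L2 (hκ : 0 < κ) (h : L2) (x : E3) :
    Integrable (fun y => (yukawa κ (x - y) : ℂ) * h y) := by
  have h1 := L2.integrable_inner (𝕜 := ℂ) (yukawaShift κ x) h
  refine h1.congr ?_
  filter_upwards [coeFn_yukawaShift hκ x] with y hy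
  rw [hy, RCLike.inner_apply, Complex.conj_ofReal, mul_comm]

theorem integral_norm_yukawa_mul_le (hκ : 0 < κ) (h : L2) (x : E3) :
    ∫ y, ‖(yukawa κ (x - y) : ℂ) * h y‖ ≤ ‖yukawaLp κ‖ * ‖h‖ := by
  rw [← norm_yukawaShift κ x]
  refine le_trans (le_of_eq (integral_congr_ae ?_)) (integral_norm_mul_norm_le_norm _ h)
  filter_upwards [coeFn_yukawaShift hκ x] with y hy
  rw [hy, norm_mul]

theorem lineDerivOp_compSubConst (m a : E3) (u : 𝓢(E3, ℂ)) :
    ∂_{m} (SchwartzMap.compSubConstCLM ℂ a u) = SchwartzMap.compSubConstCLM ℂ a (∂_{m} u) := by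
  ext x
  rw [SchwartzMap.compSubConstCLM_apply, SchwartzMap.lineDerivOp_apply_eq_fderiv,
    SchwartzMap.lineDerivOp_apply_eq_fderiv]
  have : (SchwartzMap.compSubConstCLM ℂ a u : E3 → ℂ) = fun x => u (x - a) := by
    ext x; rw [SchwartzMap.compSubConstCLM_apply]
  rw [this, fderiv_comp_sub]

theorem laplacian_compSubConst (a : E3) (u : 𝓢(E3, ℂ)) :
    Δ (SchwartzMap.compSubConstCLM ℂ a u) = SchwartzMap.compSubConstCLM ℂ a (Δ u) := by
  rw [SchwartzMap.laplacian_eq_sum (EuclideanSpace.basisFun (Fin 3) ℝ),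
    SchwartzMap.laplacian_eq_sum (EuclideanSpace.basisFun (Fin 3) ℝ)]
  simp only [lineDerivOp_compSubConst, map_sum]

theorem integral_yukawa_sub_mul_helmholtz (hκ : 0 < κ) (u : 𝓢(E3, ℂ)) (y : E3) :
    ∫ x, (yukawa κ (x - y) : ℂ) * helmholtz κ u x = u y := by
  have h := integral_yukawa_smul_schwartz hκ (SchwartzMap.compSubConstCLM ℂ (-y) u)
  rw [SchwartzMap.compSubConstCLM_apply, zero_sub, neg_neg] at h
  rw [← h, ← integral_add_right_eq_self _ y]
  refine integral_congr_ae (Eventually.of_forall fun x => ?_)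
  simp only [add_sub_cancel_right, laplacian_compSubConst, SchwartzMap.compSubConstCLM_apply,
    sub_neg_eq_add, helmholtz]
  rw [Complex.real_smul]
  rfl

/-- Fubini's theorem and the fundamental solution property. Integrability on the product holds
because the inner integrals are at most ‖G_κ‖‖h‖, uniformly in x. -/
theorem integral_conj_helmholtz_mul_yukawaConv (hκ : 0 < κ) (u : 𝓢(E3, ℂ)) (h : L2) :
    ∫ x, conj (helmholtz κ u x) * yukawaConv κ h x = inner ℂ (schwartzL2 u) h := by
  have hmeas : AEStronglyMeasurable (fun p : E3 × E3 =>
      conj (helmholtz κ u p.1) * ((yukawa κ (p.1 - p.2) : ℂ) * h p.2))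
      (volume.prod volume) := by
    have h1 : AEStronglyMeasurable (fun p : E3 × E3 => conj (helmholtz κ u p.1))
        (volume.prod volume) :=
      (Complex.continuous_conj.comp ((helmholtz κ u).continuous.comp
        continuous_fst)).aestronglyMeasurable
    have h2 : AEStronglyMeasurable (fun p : E3 × E3 => (yukawa κ (p.1 - p.2) : ℂ))
        (volume.prod volume) :=
      (Complex.measurable_ofReal.comp ((measurable_yukawa κ).comp
        (measurable_fst.sub measurable_snd))).aestronglyMeasurable
    exact h1.mul (h2.mul (Lp.aestronglyMeasurable h).comp_snd)
  have hInt : Integrable (fun p : E3 × E3 =>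
      conj (helmholtz κ u p.1) * ((yukawa κ (p.1 - p.2) : ℂ) * h p.2)) (volume.prod volume) := by
    refine (integrable_prod_iff hmeas).2 ⟨Eventually.of_forall fun x =>
      (integrable_yukawa_mul_L2 hκ h x).const_mul (conj (helmholtz κ u x)), ?_⟩
    refine Integrable.mono' ((helmholtz κ u).integrable (μ := volume).norm.mul_const
      (‖yukawaLp κ‖ * ‖h‖)) hmeas.norm.integral_prod_right' (Eventually.of_forall fun x => ?_)
    rw [Real.norm_of_nonneg (integral_nonneg fun _ => norm_nonneg _)]
    simp only [norm_mul (conj _), integral_const_mul, RCLike.norm_conj]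
    exact mul_le_mul_of_nonneg_left (integral_norm_yukawa_mul_le hκ h x) (norm_nonneg _)
  have e1 : ∫ x, conj (helmholtz κ u x) * yukawaConv κ h x =
      ∫ x, ∫ y, conj (helmholtz κ u x) * ((yukawa κ (x - y) : ℂ) * h y) := by
    simp only [integral_const_mul, yukawaConv]
  rw [e1, integral_integral_swap hInt, L2_inner_eq]
  refine integral_congr_ae ?_
  filter_upwards [coeFn_schwartzL2 u] with y hy
  rw [hy, ← integral_yukawa_sub_mul_helmholtz hκ u y, ← integral_conj, ← integral_mul_const]
  refine integral_congr_ae (Eventually.of_forall fun x => ?_)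
  simp only [map_mul, Complex.conj_ofReal]
  ring

/-- The free resolvent is the convolution with the Yukawa kernel. -/
theorem coeFn_freeRes (hκ : 0 < κ) (h : L2) : freeRes κ h =ᵐ[volume] yukawaConv κ h := by
  refine ae_eq_of_integral_contDiff_smul_eq ?_ (continuous_yukawaConv hκ h).locallyIntegrable ?_
  · exact (Lp.memLp (freeRes κ h)).locallyIntegrable (by norm_num)
  · intro g hg hgc
    have hg' : ContDiff ℝ ∞ fun x => (g x : ℂ) := Complex.ofRealCLM.contDiff.comp hg
    have hgc' : HasCompactSupport fun x => (g x : ℂ) := hgc.comp_left (g := Complex.ofReal) rfl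
    -- The test function g is written as (-Δ + κ²)u with u Schwartz; compact support of u is not
    -- required.
    obtain ⟨u, hu⟩ := surjective_helmholtz hκ (hgc'.toSchwartzMap hg')
    have hgu (x : E3) : helmholtz κ u x = (g x : ℂ) := by rw [hu]; rfl
    have e1 := integral_conj_helmholtz_mul_yukawaConv hκ u h
    rw [← inner_helmholtz_freeRes hκ, L2_inner_eq] at e1
    have e2 : ∫ x, conj (schwartzL2 (helmholtz κ u) x) * freeRes κ h x =
        ∫ x, g x • freeRes κ h x := by
      refine integral_congr_ae ?_
      filter_upwards [coeFn_schwartzL2 (helmholtz κ u)] with x hx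
      rw [hx, hgu, Complex.conj_ofReal, Complex.real_smul]
    rw [← e2, ← e1]
    refine integral_congr_ae (Eventually.of_forall fun x => ?_)
    simp only [hgu, Complex.conj_ofReal, Complex.real_smul]

theorem inner_helmholtz_yukawaLp (hκ : 0 < κ) (u : 𝓢(E3, ℂ)) :
    inner ℂ (schwartzL2 (helmholtz κ u)) (yukawaLp κ) = conj (u 0) := by
  rw [← integral_yukawa_sub_mul_helmholtz hκ u 0, ← integral_conj, L2_inner_eq]
  refine integral_congr_ae ?_
  filter_upwards [coeFn_schwartzL2 (helmholtz κ u), coeFn_yukawaLp hκ] with x hx hy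
  rw [hx, hy, sub_zero, map_mul, Complex.conj_ofReal, mul_comm]

/-- The point source cancels in the difference: (-Δ + κ²)(G_m - G_κ) = (κ² - m²)G_m. -/
theorem smul_freeRes_yukawaLp {m : ℝ} (hκ : 0 < κ) (hm : 0 < m) :
    ((κ ^ 2 - m ^ 2 : ℝ) : ℂ) • freeRes κ (yukawaLp m) = yukawaLp m - yukawaLp κ := by
  rw [← map_smul]
  symm
  refine (eq_freeRes_iff hκ).2 fun u => ?_
  have h1 := inner_helmholtz_yukawaLp hm u
  rw [inner_schwartzL2_helmholtz] at h1
  rw [inner_sub_right, inner_helmholtz_yukawaLp hκ, inner_schwartzL2_helmholtz, inner_smul_right,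
    ← h1]
  push_cast
  ring

theorem freeRes_sub_freeRes {m : ℝ} (hκ : 0 < κ) (hm : 0 < m) (h : L2) :
    ((κ ^ 2 - m ^ 2 : ℝ) : ℂ) • freeRes κ (freeRes m h) = freeRes m h - freeRes κ h := by
  rw [← map_smul]
  symm
  rw [sub_eq_iff_eq_add, ← map_add]
  refine (eq_freeRes_iff hκ).2 fun u => ?_
  have h1 := inner_helmholtz_freeRes hm u h
  rw [inner_schwartzL2_helmholtz] at h1
  rw [inner_add_right, inner_schwartzL2_helmholtz, inner_smul_right, ← h1]
  push_cast
  ring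

theorem inner_yukawaLp_freeRes_yukawaLp {m : ℝ} (hκ : 0 < κ) (hm : κ < m) :
    inner ℂ (yukawaLp m) (freeRes κ (yukawaLp m)) =
      ((1 / (8 * Real.pi * m * (κ + m) ^ 2) : ℝ) : ℂ) := by
  have hm0 : 0 < m := hκ.trans hm
  have hne : ((κ ^ 2 - m ^ 2 : ℝ) : ℂ) ≠ 0 := by
    have : κ ^ 2 - m ^ 2 ≠ 0 := by nlinarith
    exact_mod_cast this
  have h := congrArg (inner ℂ (yukawaLp m)) (smul_freeRes_yukawaLp hκ hm0)
  rw [inner_smul_right, inner_sub_right, inner_yukawaLp hm0 hm0, inner_yukawaLp hm0 hκ] at h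
  refine mul_left_cancel₀ hne (h.trans ?_)
  rw [← Complex.ofReal_sub, ← Complex.ofReal_mul]
  congr 1
  have := Real.pi_pos
  field_simp
  ring

/-- The Yukawa kernel does not belong to `H¹(ℝ³)`. -/
theorem yukawaLp_ne_formEmb (hκ : 0 < κ) (y : formSpace κ) : yukawaLp κ ≠ formEmb κ y := by
  intro hy
  -- If G_κ = J y, Cauchy-Schwarz in H¹ against J*G_m bounds 1/(4π(κ + m)) by ‖y‖/(√(8πm)(κ + m)),
  -- that is m ≤ 2π‖y‖². Any larger m gives a contradiction.
  obtain ⟨m, hm, hm'⟩ : ∃ m : ℝ, κ < m ∧ 2 * Real.pi * ‖y‖ ^ 2 < m := by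
    refine ⟨max κ (2 * Real.pi * ‖y‖ ^ 2) + 1, ?_, ?_⟩
    · linarith [le_max_left κ (2 * Real.pi * ‖y‖ ^ 2)]
    · linarith [le_max_right κ (2 * Real.pi * ‖y‖ ^ 2)]
  have hm0 : 0 < m := hκ.trans hm
  have h1 : ‖inner ℂ (yukawaLp κ) (yukawaLp m)‖ ≤ ‖y‖ * ‖((formEmb κ)†) (yukawaLp m)‖ := by
    rw [hy, ← ContinuousLinearMap.adjoint_inner_right]
    exact norm_inner_le_norm _ _
  have h2 : ‖((formEmb κ)†) (yukawaLp m)‖ ^ 2 = 1 / (8 * Real.pi * m * (κ + m) ^ 2) := by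
    have := inner_yukawaLp_freeRes_yukawaLp hκ hm
    rw [freeRes_apply, ← ContinuousLinearMap.adjoint_inner_left,
      inner_self_eq_norm_sq_to_K] at this
    exact Complex.ofReal_injective ((Complex.ofReal_pow _ _).trans this)
  rw [inner_yukawaLp hκ hm0, Complex.norm_real, Real.norm_of_nonneg (by positivity)] at h1
  have h3 := pow_le_pow_left₀ (by positivity) h1 2
  rw [mul_pow, h2] at h3
  have hpi := Real.pi_pos
  have hk : 0 < κ + m := by positivity
  rw [← mul_div_assoc, mul_one, div_pow, div_le_div_iff₀ (by positivity) (by positivity)] at h3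
  have h4 : 8 * Real.pi * (κ + m) ^ 2 * (2 * Real.pi * ‖y‖ ^ 2 - m) ≥ 0 := by nlinarith
  have h5 : 8 * Real.pi * (κ + m) ^ 2 * (2 * Real.pi * ‖y‖ ^ 2 - m) < 0 :=
    mul_neg_of_pos_of_neg (by positivity) (by linarith)
  linarith

/-- The resolvent of the point interaction, `h ↦ G h + ⟨G_κ, h⟩ / (α + κ / 4π) G_κ`. -/
def pointRes (α κ : ℝ) : L2 →L[ℂ] L2 :=
  freeRes κ + ((α + κ / (4 * Real.pi))⁻¹ : ℝ) •
    (innerSL ℂ (yukawaLp κ)).smulRight (yukawaLp κ)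

theorem pointRes_apply (α κ : ℝ) (h : L2) : pointRes α κ h =
    freeRes κ h + (((α + κ / (4 * Real.pi))⁻¹ : ℝ) * inner ℂ (yukawaLp κ) h : ℂ) • yukawaLp κ := by
  rw [mul_smul]
  rfl

theorem isSelfAdjoint_pointRes (α κ : ℝ) : IsSelfAdjoint (pointRes α κ) := by
  rw [ContinuousLinearMap.isSelfAdjoint_iff_isSymmetric]
  intro f g
  have h := (isSelfAdjoint_freeRes κ).isSymmetric f g
  simp only [ContinuousLinearMap.coe_coe] at h ⊢
  rw [pointRes_apply, pointRes_apply, inner_add_left, inner_add_right, h, inner_smul_left,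
    inner_smul_right, map_mul, Complex.conj_ofReal, inner_conj_symm]
  ring

/-- A nonzero singular coefficient would express G_κ as an element of H¹; with a zero coefficient
the injectivity of the free resolvent applies. -/
theorem injective_pointRes {α : ℝ} (hκ : 0 < κ) : Function.Injective (pointRes α κ) := by
  refine (injective_iff_map_eq_zero _).2 fun h hh => ?_
  rw [pointRes_apply] at hh
  by_cases hc : (((α + κ / (4 * Real.pi))⁻¹ : ℝ) * inner ℂ (yukawaLp κ) h : ℂ) = 0
  · rw [hc, zero_smul, add_zero] at hh
    exact (injective_iff_map_eq_zero _).1 (injective_freeRes hκ) h hh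
  · exfalso
    have h1 : yukawaLp κ = formEmb κ
        ((-(((α + κ / (4 * Real.pi))⁻¹ : ℝ) * inner ℂ (yukawaLp κ) h : ℂ)⁻¹) •
          ((formEmb κ)†) h) := by
      rw [map_smul, ← freeRes_apply, eq_neg_of_add_eq_zero_left hh, smul_neg, neg_smul, neg_neg,
        smul_smul, inv_mul_cancel₀ hc, one_smul]
    exact yukawaLp_ne_formEmb hκ _ h1

/-- The first resolvent identity for the point interaction. -/
theorem smul_pointRes_pointRes {α m : ℝ} (hκ : 0 < κ) (hm : 0 < m)
    (hακ : α + κ / (4 * Real.pi) ≠ 0) (hαm : α + m / (4 * Real.pi) ≠ 0) (q : L2) :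
    ((κ ^ 2 - m ^ 2 : ℝ) : ℂ) • pointRes α κ (pointRes α m q) =
      pointRes α m q - pointRes α κ q := by
  have e1 := freeRes_sub_freeRes hκ hm q
  have e2 := smul_freeRes_yukawaLp hκ hm
  have e3 : ((κ ^ 2 - m ^ 2 : ℝ) : ℂ) * inner ℂ (yukawaLp κ) (freeRes m q) =
      inner ℂ (yukawaLp m) q - inner ℂ (yukawaLp κ) q := by
    have h := smul_freeRes_yukawaLp hm hκ
    have h' := congrArg (fun z => inner ℂ z q) h
    simp only [inner_smul_left, inner_sub_left, Complex.conj_ofReal] at h'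
    have hs := (isSelfAdjoint_freeRes m).isSymmetric (yukawaLp κ) q
    simp only [ContinuousLinearMap.coe_coe] at hs
    rw [hs] at h'
    push_cast at h' ⊢
    linear_combination -h'
  have hpi := Real.pi_pos
  rw [pointRes_apply α κ, pointRes_apply α m, pointRes_apply α κ q, map_add, map_smul,
    inner_add_right, inner_smul_right, inner_yukawaLp hκ hm]
  set a := α + κ / (4 * Real.pi) with ha
  set b := α + m / (4 * Real.pi) with hb
  -- The left side is (κ - m)/(4π): the inner product of the two kernels matches the variation of α
  -- + κ/(4π).
  have hab : ((κ ^ 2 - m ^ 2 : ℝ) : ℂ) * ((1 / (4 * Real.pi * (κ + m)) : ℝ) : ℂ) = a - b := by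
    rw [← Complex.ofReal_mul, ← Complex.ofReal_sub]
    congr 1
    rw [ha, hb]
    field_simp
    ring
  have ha' : (a : ℂ) ≠ 0 := by exact_mod_cast hακ
  have hb' : (b : ℂ) ≠ 0 := by exact_mod_cast hαm
  rw [smul_add, smul_add, smul_comm _ _ (freeRes κ (yukawaLp m)), e1, e2, smul_smul]
  set I := inner ℂ (yukawaLp m) q
  set L := inner ℂ (yukawaLp κ) q
  have e4 : ((κ ^ 2 - m ^ 2 : ℝ) : ℂ) * (((a⁻¹ : ℝ) : ℂ) *
      (inner ℂ (yukawaLp κ) (freeRes m q) +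
        ((b⁻¹ : ℝ) : ℂ) * I * ((1 / (4 * Real.pi * (κ + m)) : ℝ) : ℂ))) =
      ((b⁻¹ : ℝ) : ℂ) * I - ((a⁻¹ : ℝ) : ℂ) * L := by
    have : ((κ ^ 2 - m ^ 2 : ℝ) : ℂ) * (((a⁻¹ : ℝ) : ℂ) *
      (inner ℂ (yukawaLp κ) (freeRes m q) +
        ((b⁻¹ : ℝ) : ℂ) * I * ((1 / (4 * Real.pi * (κ + m)) : ℝ) : ℂ))) =
        ((a⁻¹ : ℝ) : ℂ) * (I - L + ((b⁻¹ : ℝ) : ℂ) * I * (a - b)) := by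
      rw [← e3, ← hab]
      ring
    rw [this]
    push_cast
    field_simp
    ring
  rw [e4]
  module

/-- The graph admits any μ = m² with nonvanishing denominator; the first resolvent identity carries
each of them to the fixed κ. -/
theorem pointInteractionGraph_eq_resolventGraph {α : ℝ} (hκ : 0 < κ)
    (hακ : α + κ / (4 * Real.pi) ≠ 0) :
    pointInteractionGraph α = resolventGraph κ (pointRes α κ) := by
  have key (μ : ℝ) (hμ : 0 < μ) (q : L2) (c : ℂ) : (c = ((α + μ / (4 * Real.pi) : ℝ) : ℂ)) →
      pointRes α μ q =ᵐ[volume] fun x =>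
        yukawaConv μ q x + yukawaConv μ q 0 / c * (yukawa μ x : ℂ) := by
    rintro rfl
    rw [pointRes_apply]
    filter_upwards [Lp.coeFn_add (freeRes μ q)
      ((((α + μ / (4 * Real.pi))⁻¹ : ℝ) * inner ℂ (yukawaLp μ) q : ℂ) • yukawaLp μ),
      Lp.coeFn_smul (((α + μ / (4 * Real.pi))⁻¹ : ℝ) * inner ℂ (yukawaLp μ) q : ℂ) (yukawaLp μ),
      coeFn_freeRes hμ q, coeFn_yukawaLp hμ] with x h1 h2 h3 h4
    rw [h1, Pi.add_apply, h2, Pi.smul_apply, h3, h4, yukawaConv_zero hμ, smul_eq_mul]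
    push_cast
    ring
  ext ⟨g, k'⟩
  constructor
  · rintro ⟨μ, hμ, hαμ, f, k, f₀, hfk, hf₀, hff₀, hg, hk⟩
    set m := √μ with hmdef
    have hm : 0 < m := Real.sqrt_pos.2 hμ
    have hμm : μ = m ^ 2 := (Real.sq_sqrt hμ.le).symm
    rw [freeGraph_eq_resolventGraph hm] at hfk
    obtain ⟨q, hq⟩ := hfk
    obtain ⟨rfl, rfl⟩ := Prod.ext_iff.1 hq
    simp only at hff₀ hg hk
    have hf₀' : f₀ = yukawaConv m q :=
      (Continuous.ae_eq_iff_eq volume hf₀ (continuous_yukawaConv hm q)).1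
        (hff₀.symm.trans (coeFn_freeRes hm q))
    have hgm : g = pointRes α m q := by
      refine Lp.ext (hg.trans ?_)
      rw [hf₀', greenFunction_eq_yukawa, ← hmdef]
      exact (key m hm q _ rfl).symm
    have hk2 : k' = q - ((m ^ 2 : ℝ) : ℂ) • pointRes α m q := by
      rw [hμm, hgm, sub_add_cancel] at hk
      exact eq_sub_of_add_eq hk
    refine ⟨k' + ((κ ^ 2 : ℝ) : ℂ) • g, ?_⟩
    have hR : pointRes α κ (k' + ((κ ^ 2 : ℝ) : ℂ) • g) = g := by
      have h1 := smul_pointRes_pointRes hκ hm hακ hαμ q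
      have h2 : k' + ((κ ^ 2 : ℝ) : ℂ) • g =
          q + ((κ ^ 2 - m ^ 2 : ℝ) : ℂ) • pointRes α m q := by
        rw [hk2, hgm]
        push_cast
        module
      rw [h2, map_add, map_smul, h1, hgm]
      abel
    rw [hR, add_sub_cancel_right]
  · rintro ⟨h, hh⟩
    obtain ⟨rfl, rfl⟩ := Prod.ext_iff.1 hh
    have hs : √(κ ^ 2) = κ := Real.sqrt_sq hκ.le
    refine ⟨κ ^ 2, by positivity, by rwa [hs], freeRes κ h,
      h - ((κ ^ 2 : ℝ) : ℂ) • freeRes κ h, yukawaConv κ h, ?_, continuous_yukawaConv hκ h,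
      coeFn_freeRes hκ h, ?_, ?_⟩
    · rw [freeGraph_eq_resolventGraph hκ]
      exact ⟨h, rfl⟩
    · rw [greenFunction_eq_yukawa, hs]
      exact key κ hκ h _ rfl
    · simp


/-! ### Form perturbations and their resolvents -/

open scoped InnerProduct

section Abstract

section NoComplete

variable {H : Type*} [NormedAddCommGroup H] [InnerProductSpace ℂ H]

theorem inverse_apply_self {f : H →L[ℂ] H} (hf : IsUnit f) (x : H) : Ring.inverse f (f x) = x :=
  DFunLike.congr_fun (Ring.inverse_mul_cancel f hf) x

theorem self_apply_inverse {f : H →L[ℂ] H} (hf : IsUnit f) (x : H) : f (Ring.inverse f x) = x :=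
  DFunLike.congr_fun (Ring.mul_inverse_cancel f hf) x

theorem isUnit_of_apply_eq {f g : H →L[ℂ] H} (h1 : ∀ x, f (g x) = x) (h2 : ∀ x, g (f x) = x) :
    IsUnit f ∧ Ring.inverse f = g := by
  have e1 : f * g = 1 := by ext x; exact h1 x
  have e2 : g * f = 1 := by ext x; exact h2 x
  exact ⟨⟨⟨f, g, e1, e2⟩, rfl⟩, Ring.inverse_unit ⟨f, g, e1, e2⟩⟩

/-- Rank-one operator `z ↦ ⟨y, z⟩ x`. -/
def rankOne (x y : H) : H →L[ℂ] H := (innerSL ℂ y).smulRight x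

theorem rankOne_apply (x y z : H) : rankOne x y z = inner ℂ y z • x := rfl

theorem isCompactOperator_rankOne (x y : H) : IsCompactOperator (rankOne x y) := by
  have h : IsCompactOperator (innerSL ℂ y : H →L[ℂ] ℂ) := by
    refine ⟨Metric.closedBall 0 1, isCompact_closedBall _ _, ?_⟩
    exact (innerSL ℂ y).continuous.continuousAt.preimage_mem_nhds (by
      simpa using Metric.closedBall_mem_nhds (0 : ℂ) one_pos)
  exact h.clm_comp ((1 : ℂ →L[ℂ] ℂ).smulRight x)

/-- The Sherman-Morrison formula. -/
theorem isUnit_add_rankOne {S : H →L[ℂ] H} (hS : IsUnit S) {x y : H}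
    (hd : 1 + inner ℂ y (Ring.inverse S x) ≠ 0) :
    IsUnit (S + rankOne x y) ∧ Ring.inverse (S + rankOne x y) =
      Ring.inverse S - (1 + inner ℂ y (Ring.inverse S x))⁻¹ •
        (rankOne (Ring.inverse S x) y ∘L Ring.inverse S) := by
  generalize hdd : 1 + inner ℂ y (Ring.inverse S x) = d at hd ⊢
  have hd' : inner ℂ y (Ring.inverse S x) = d - 1 := by rw [← hdd]; ring
  refine isUnit_of_apply_eq (fun z => ?_) fun z => ?_
  · simp only [add_apply, sub_apply, smul_apply, ContinuousLinearMap.comp_apply, rankOne_apply,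
      map_sub, map_smul, self_apply_inverse hS, hd']
    rw [show x + (d - 1) • x = d • x by module, smul_smul, smul_smul,
      show d⁻¹ * inner ℂ y (Ring.inverse S z) * d = inner ℂ y (Ring.inverse S z) by field_simp]
    abel
  · simp only [add_apply, sub_apply, smul_apply, ContinuousLinearMap.comp_apply, rankOne_apply,
      map_add, map_smul, inverse_apply_self hS, hd']
    have h : d⁻¹ • (d - 1) • Ring.inverse S x = Ring.inverse S x - d⁻¹ • Ring.inverse S x := by
      rw [sub_smul, one_smul, smul_sub, smul_smul, inv_mul_cancel₀ hd, one_smul]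
    rw [h]
    module

end NoComplete

variable {H K M : Type*} [NormedAddCommGroup H] [InnerProductSpace ℂ H] [CompleteSpace H]
  [NormedAddCommGroup K] [InnerProductSpace ℂ K] [CompleteSpace K]
  [NormedAddCommGroup M] [InnerProductSpace ℂ M] [CompleteSpace M]

/-- The operator `1 + B* s B` of a form perturbation. -/
def formOp (B : H →L[ℂ] M) (s : M →L[ℂ] M) : H →L[ℂ] H := 1 + B† ∘L s ∘L B

theorem formOp_apply (B : H →L[ℂ] M) (s : M →L[ℂ] M) (x : H) :
    formOp B s x = x + (B†) (s (B x)) := rfl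

/-- The Birman-Schwinger operator `1 + s B B*`. -/
def birmanOp (B : H →L[ℂ] M) (s : M →L[ℂ] M) : M →L[ℂ] M := 1 + s ∘L B ∘L B†

theorem birmanOp_apply (B : H →L[ℂ] M) (s : M →L[ℂ] M) (x : M) :
    birmanOp B s x = x + s (B ((B†) x)) := rfl

/-- The resolvent `J (1 + B* s B)⁻¹ J*` of a form perturbation. -/
def perturbRes (J : H →L[ℂ] K) (B : H →L[ℂ] M) (s : M →L[ℂ] M) : K →L[ℂ] K :=
  J ∘L Ring.inverse (formOp B s) ∘L J†

theorem perturbRes_apply (J : H →L[ℂ] K) (B : H →L[ℂ] M) (s : M →L[ℂ] M) (h : K) :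
    perturbRes J B s h = J (Ring.inverse (formOp B s) ((J†) h)) := rfl

/-- If 1 + YX is invertible then so is 1 + XY, with inverse 1 - X(1 + YX)⁻¹Y; here X = B* and Y =
sB. The inversion moves from the form domain to the space of the Birman-Schwinger operator. -/
theorem isUnit_formOp_of_isUnit_birmanOp {B : H →L[ℂ] M} {s : M →L[ℂ] M}
    (hu : IsUnit (birmanOp B s)) : IsUnit (formOp B s) ∧ Ring.inverse (formOp B s) =
      1 - B† ∘L Ring.inverse (birmanOp B s) ∘L s ∘L B := by
  refine isUnit_of_apply_eq (fun x => ?_) fun x => ?_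
  · have h := self_apply_inverse hu (s (B x))
    rw [birmanOp_apply] at h
    simp only [formOp_apply, sub_apply, one_apply_eq_self, ContinuousLinearMap.comp_apply, map_sub]
    rw [← sub_eq_zero]
    have h' := congrArg (B†) h
    rw [map_add] at h'
    rw [← h']
    abel
  · have h := inverse_apply_self hu (s (B x))
    rw [birmanOp_apply] at h
    rw [map_add] at h
    have h' := congrArg (B†) h
    rw [map_add] at h'
    simp only [formOp_apply, sub_apply, one_apply_eq_self, ContinuousLinearMap.comp_apply, map_add]
    refine Eq.trans ?_ (sub_zero x)
    rw [← sub_eq_zero.2 h']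
    abel

theorem isSelfAdjoint_formOp {B : H →L[ℂ] M} {s : M →L[ℂ] M} (hs : IsSelfAdjoint s) :
    IsSelfAdjoint (formOp B s) :=
  (IsSelfAdjoint.one _).add (hs.adjoint_conj B)

theorem isSelfAdjoint_perturbRes {J : H →L[ℂ] K} {B : H →L[ℂ] M} {s : M →L[ℂ] M}
    (hs : IsSelfAdjoint s) : IsSelfAdjoint (perturbRes J B s) :=
  (isSelfAdjoint_formOp hs).ringInverse.conj_adjoint J

theorem injective_perturbRes {J : H →L[ℂ] K} {B : H →L[ℂ] M} {s : M →L[ℂ] M}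
    (hJ : Function.Injective J) (hJ' : Function.Injective (J†)) (hu : IsUnit (formOp B s)) :
    Function.Injective (perturbRes J B s) := by
  have : Function.Injective (Ring.inverse (formOp B s) : H →L[ℂ] H) :=
    fun a b hab => by
      rw [← self_apply_inverse hu a, hab, self_apply_inverse hu]
  exact hJ.comp (this.comp hJ')

theorem perturbRes_eq_sub {J : H →L[ℂ] K} {B : H →L[ℂ] M} {s : M →L[ℂ] M}
    (hu : IsUnit (birmanOp B s)) : perturbRes J B s =
      J ∘L J† - (B ∘L J†)† ∘L Ring.inverse (birmanOp B s) ∘L s ∘L (B ∘L J†) := by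
  ext h
  rw [perturbRes_apply, (isUnit_formOp_of_isUnit_birmanOp hu).2, ContinuousLinearMap.adjoint_comp,
    ContinuousLinearMap.adjoint_adjoint]
  simp only [sub_apply, one_apply_eq_self, ContinuousLinearMap.comp_apply, map_sub]

/-- Coercivity: ⟨(1 + B*B)x, x⟩ = ‖x‖² + ‖Bx‖². -/
theorem isUnit_formOp_one (B : H →L[ℂ] M) : IsUnit (formOp B 1) := by
  refine ContinuousLinearMap.isUnit_of_forall_le_norm_inner_map _ (c := 1) one_pos fun x => ?_
  rw [formOp_apply, one_apply_eq_self, inner_add_left, ContinuousLinearMap.adjoint_inner_left,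
    inner_self_eq_norm_sq_to_K, inner_self_eq_norm_sq_to_K]
  have e : ((‖x‖ : ℂ) ^ 2 + (‖B x‖ : ℂ) ^ 2) = ((‖x‖ ^ 2 + ‖B x‖ ^ 2 : ℝ) : ℂ) := by push_cast; rfl
  have : ‖((‖x‖ ^ 2 + ‖B x‖ ^ 2 : ℝ) : ℂ)‖ = ‖x‖ ^ 2 + ‖B x‖ ^ 2 := by
    rw [Complex.norm_real, Real.norm_of_nonneg (by positivity)]
  refine le_trans ?_ (le_of_eq (this.symm.trans (congrArg _ e.symm)))
  simp only [NNReal.coe_one, mul_one]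
  linarith [sq_nonneg ‖B x‖]

/-- The difference d satisfies d + B*Bd = B*Bx; pairing with d gives ‖d‖² + ‖Bd‖² ≤ ‖Bd‖‖Bx‖.
Smallness of Bx at the given x suffices, whatever the norm of B. -/
theorem norm_sub_inverse_formOp_one_le (B : H →L[ℂ] M) (x : H) :
    ‖x - Ring.inverse (formOp B 1) x‖ ≤ ‖B x‖ := by
  set d := x - Ring.inverse (formOp B 1) x with hd
  have h1 : d + (B†) (B d) = (B†) (B x) := by
    have h := self_apply_inverse (isUnit_formOp_one B) x
    rw [formOp_apply, one_apply_eq_self] at h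
    rw [hd, map_sub, map_sub]
    nth_rewrite 1 [← h]
    abel
  have h2 := congrArg (fun z => RCLike.re (inner ℂ d z)) h1
  simp only [inner_add_right, map_add, ContinuousLinearMap.adjoint_inner_right,
    inner_self_eq_norm_sq] at h2
  have h3 : RCLike.re (inner ℂ (B d) (B x)) ≤ ‖B d‖ * ‖B x‖ :=
    (RCLike.re_le_norm _).trans (norm_inner_le_norm _ _)
  have h4 : ‖d‖ ^ 2 ≤ ‖B x‖ ^ 2 := by nlinarith [sq_nonneg (‖B d‖ - ‖B x‖ / 2)]
  exact le_of_sq_le_sq h4 (norm_nonneg _)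

theorem norm_inverse_formOp_one_le (B : H →L[ℂ] M) (x : H) :
    ‖Ring.inverse (formOp B 1) x‖ ≤ ‖x‖ := by
  set y := Ring.inverse (formOp B 1) x with hy
  have h := self_apply_inverse (isUnit_formOp_one B) x
  rw [formOp_apply, one_apply_eq_self, ← hy] at h
  have h2 := congrArg (fun z => RCLike.re (inner ℂ y z)) h
  simp only [inner_add_right, map_add, ContinuousLinearMap.adjoint_inner_right,
    inner_self_eq_norm_sq] at h2
  have h3 : RCLike.re (inner ℂ y x) ≤ ‖y‖ * ‖x‖ :=
    (RCLike.re_le_norm _).trans (norm_inner_le_norm _ _)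
  by_contra! hlt
  have : ‖y‖ * ‖x‖ < ‖y‖ * ‖y‖ := mul_lt_mul_of_pos_left hlt ((norm_nonneg _).trans_lt hlt)
  nlinarith [sq_nonneg ‖B y‖]

/-- The Fredholm alternative for `1 + C` with `C` compact. -/
theorem isUnit_one_add_of_isCompactOperator {C : H →L[ℂ] H} (hC : IsCompactOperator C)
    (hi : ∀ x, x + C x = 0 → x = 0) : IsUnit (1 + C) := by
  rcases hC.hasEigenvalue_or_mem_resolventSet (μ := (-1 : ℂ)) (by simp) with h | h
  · exfalso
    obtain ⟨x, hx⟩ := h.exists_hasEigenvector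
    refine hx.2 (hi x ?_)
    have := hx.apply_eq_smul
    simp only [ContinuousLinearMap.coe_coe, neg_smul, one_smul] at this
    rw [this, add_neg_cancel]
  · have : algebraMap ℂ (H →L[ℂ] H) (-1) - C = -(1 + C) := by
      rw [map_neg, map_one]; abel
    rw [spectrum.mem_resolventSet_iff, this] at h
    exact (IsUnit.neg_iff _).1 h

/-- Inversion of a perturbed non-invertible Fredholm operator `T + ε T₁ + o(ε)` with a simple
kernel. -/
theorem tendsto_smul_inverse_of_simple_kernel {C T₁ : H →L[ℂ] H} (hC : IsCompactOperator C)
    {T : ℝ → H →L[ℂ] H} {φ χ : H} (hφ : φ + C φ = 0) (hχ : ∀ x, inner ℂ χ (x + C x) = 0)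
    (hsimple : ∀ x, x + C x = 0 → ∃ c : ℂ, x = c • φ) (hnorm : inner ℂ χ φ = -1)
    (hT : Tendsto (fun ε : ℝ => ((ε⁻¹ : ℝ) : ℂ) • (T ε - (1 + C))) (𝓝[>] 0) (𝓝 T₁))
    (hm : inner ℂ χ (T₁ φ) ≠ 0) :
    (∀ᶠ ε in 𝓝[>] 0, IsUnit (T ε)) ∧
      Tendsto (fun ε : ℝ => (ε : ℂ) • Ring.inverse (T ε)) (𝓝[>] 0)
        (𝓝 ((inner ℂ χ (T₁ φ))⁻¹ • rankOne φ χ)) := by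
  have hε0 : Tendsto (fun ε : ℝ => (ε : ℂ)) (𝓝[>] 0) (𝓝 0) := by
    have := (Complex.continuous_ofReal.tendsto 0).mono_left (nhdsWithin_le_nhds (s := Ioi (0 : ℝ)))
    simpa using this
  have hTlim : Tendsto T (𝓝[>] 0) (𝓝 (1 + C)) := by
    have h := (hε0.smul hT).add_const (1 + C)
    rw [zero_smul, zero_add] at h
    refine h.congr' ?_
    filter_upwards [self_mem_nhdsWithin] with ε hε
    have : (ε : ℂ) ≠ 0 := by exact_mod_cast (ne_of_gt hε)
    rw [smul_smul]
    push_cast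
    rw [mul_inv_cancel₀ this, one_smul, sub_add_cancel]
  -- Subtraction of z ↦ ⟨χ, z⟩φ removes the kernel: χ annihilates the range of 1 + C, and ⟨χ, φ⟩ =
  -- -1 makes S fix φ.
  set S : H →L[ℂ] H := 1 + (C - rankOne φ χ) with hSdef
  have hSapp (x : H) : S x = x + C x - inner ℂ χ x • φ := by
    rw [hSdef]
    simp only [add_apply, sub_apply, one_apply_eq_self, rankOne_apply]
    abel
  have hS : IsUnit S := by
    refine isUnit_one_add_of_isCompactOperator (hC.sub (isCompactOperator_rankOne φ χ))
      fun x hx => ?_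
    have hx' : x + C x - inner ℂ χ x • φ = 0 := by rw [← hSapp]; exact hx
    have h1 := congrArg (inner ℂ χ) hx'
    rw [inner_sub_right, hχ, inner_smul_right, hnorm, inner_zero_right] at h1
    have h2 : inner ℂ χ x = 0 := by linear_combination h1
    rw [h2, zero_smul, sub_zero] at hx'
    obtain ⟨c, rfl⟩ := hsimple x hx'
    rw [inner_smul_right, hnorm] at h2
    have : c = 0 := by linear_combination -h2
    rw [this, zero_smul]
  have hSφ : S φ = φ := by rw [hSapp, hφ, hnorm]; simp
  have hSiφ : Ring.inverse S φ = φ := by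
    nth_rewrite 1 [← hSφ]; exact inverse_apply_self hS φ
  have hχS (x : H) : inner ℂ χ (Ring.inverse S x) = inner ℂ χ x := by
    have h := congrArg (inner ℂ χ) (self_apply_inverse hS x)
    rw [hSapp, inner_sub_right, hχ, inner_smul_right, hnorm] at h
    rw [← h]; ring
  set Sε : ℝ → H →L[ℂ] H := fun ε => T ε - rankOne φ χ with hSε
  have hSεlim : Tendsto Sε (𝓝[>] 0) (𝓝 S) := by
    have := hTlim.sub_const (rankOne φ χ)
    rwa [show 1 + C - rankOne φ χ = S by rw [hSdef]; abel] at this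
  have hinv : Tendsto (fun ε => Ring.inverse (Sε ε)) (𝓝[>] 0) (𝓝 (Ring.inverse S)) := by
    obtain ⟨U, hU⟩ := hS
    rw [← hU] at hSεlim ⊢
    exact (NormedRing.inverse_continuousAt U).tendsto.comp hSεlim
  have hSεu : ∀ᶠ ε in 𝓝[>] 0, IsUnit (Sε ε) :=
    hSεlim.eventually (hS.choose_spec ▸ Units.isOpen.mem_nhds hS.choose.isUnit)
  set d : ℝ → ℂ := fun ε => 1 + inner ℂ χ (Ring.inverse (Sε ε) φ) with hd
  have happ {F : ℝ → H →L[ℂ] H} {F₀ : H →L[ℂ] H} (hF : Tendsto F (𝓝[>] 0) (𝓝 F₀))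
      {z : ℝ → H} {z₀ : H} (hz : Tendsto z (𝓝[>] 0) (𝓝 z₀)) :
      Tendsto (fun ε => F ε (z ε)) (𝓝[>] 0) (𝓝 (F₀ z₀)) :=
    (isBoundedBilinearMap_apply.continuous.tendsto (F₀, z₀)).comp (hF.prodMk_nhds hz)
  -- The Sherman-Morrison denominator vanishes to first order: S_ε φ - φ = (T_ε - (1 + C))φ is εT₁φ
  -- + o(ε), and S⁻¹ preserves the pairing with χ.
  have hdlim : Tendsto (fun ε : ℝ => ((ε⁻¹ : ℝ) : ℂ) * d ε) (𝓝[>] 0)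
      (𝓝 (-inner ℂ χ (T₁ φ))) := by
    have h1 := happ hinv (happ hT tendsto_const_nhds (z₀ := φ))
    have h2 := ((continuous_const.inner continuous_id).tendsto _).comp h1 |>.neg
      (f := fun ε => inner ℂ χ (Ring.inverse (Sε ε) ((((ε⁻¹ : ℝ) : ℂ) • (T ε - (1 + C))) φ)))
    simp only [id_eq, hχS] at h2
    refine h2.congr' ?_
    filter_upwards [hSεu] with ε hu
    have e1 : (T ε - (1 + C)) φ = Sε ε φ - φ := by
      simp only [hSε, sub_apply, add_apply, one_apply_eq_self, rankOne_apply, hφ, hnorm]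
      module
    rw [smul_apply, map_smul, inner_smul_right, e1, map_sub, inverse_apply_self hu, inner_sub_right,
      hnorm, hd]
    ring
  have hdne : ∀ᶠ ε in 𝓝[>] 0, d ε ≠ 0 := by
    filter_upwards [hdlim.eventually_ne (neg_ne_zero.2 hm)] with ε h hd0
    exact h (by rw [hd0, mul_zero])
  have hSM : ∀ᶠ ε in 𝓝[>] 0, IsUnit (T ε) ∧ Ring.inverse (T ε) = Ring.inverse (Sε ε) -
      (d ε)⁻¹ • (rankOne (Ring.inverse (Sε ε) φ) χ ∘L Ring.inverse (Sε ε)) := by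
    filter_upwards [hSεu, hdne] with ε hu hd0
    have := isUnit_add_rankOne hu hd0
    rwa [show Sε ε + rankOne φ χ = T ε from sub_add_cancel _ _] at this
  refine ⟨hSM.mono fun _ h => h.1, ?_⟩
  have hr : Tendsto (fun ε => rankOne (Ring.inverse (Sε ε) φ) χ ∘L Ring.inverse (Sε ε)) (𝓝[>] 0)
      (𝓝 (rankOne φ χ)) := by
    have h1 : Tendsto (fun ε => rankOne (Ring.inverse (Sε ε) φ) χ) (𝓝[>] 0) (𝓝 (rankOne φ χ)) := by
      have hz := happ hinv (tendsto_const_nhds (x := φ))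
      rw [hSiφ] at hz
      have hc : Continuous fun x : H => rankOne x χ :=
        (ContinuousLinearMap.smulRightL ℂ H H (innerSL ℂ χ)).continuous
      exact (hc.tendsto _).comp hz
    have h2 := ((ContinuousLinearMap.compL ℂ H H H).isBoundedBilinearMap.continuous.tendsto
      (rankOne φ χ, Ring.inverse S)).comp (h1.prodMk_nhds hinv)
    simp only [ContinuousLinearMap.compL_apply, Function.comp_def] at h2
    have h3 : rankOne φ χ ∘L Ring.inverse S = rankOne φ χ := by
      ext x; simp only [ContinuousLinearMap.comp_apply, rankOne_apply, hχS]
    rwa [h3] at h2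
  have h1 := hε0.smul hinv
  have h2 := (hdlim.inv₀ (neg_ne_zero.2 hm)).smul hr
  have h3 := h1.sub h2
  rw [zero_smul, zero_sub, inv_neg, neg_smul, neg_neg] at h3
  refine h3.congr' ?_
  filter_upwards [hSM] with ε h
  rw [h.2, smul_sub, smul_smul]
  congr 2
  push_cast
  rw [mul_inv, inv_inv]

end Abstract

/-- The graph of a form sum in terms of its resolvent. -/
theorem formSumGraph_eq_resolventGraph {κ : ℝ} (hκ : 0 < κ) {W : E3 → ℝ}
    {B : formSpace κ →L[ℂ] L2} {s : L2 →L[ℂ] L2}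
    (hB : ∀ f g, inner ℂ (B f) (s (B g)) =
      ∫ x, (W x : ℂ) * (conj (formEmb κ f x) * formEmb κ g x))
    (hu : IsUnit (formOp B s)) :
    formSumGraph W = resolventGraph κ (perturbRes (formEmb κ) B s) := by
  -- The inner product of the form domain contains κ²⟨g, g'⟩, which is subtracted here and reappears
  -- as the shift of the resolvent.
  have hform (y z : formSpace κ) : (∑ i : Fin 3, inner ℂ (y.1 i.succ) (z.1 i.succ)) +
      (∫ x, (W x : ℂ) * (conj (formEmb κ y x) * formEmb κ z x)) =
      inner ℂ y (formOp B s z) -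
        ((κ ^ 2 : ℝ) : ℂ) * inner ℂ (formEmb κ y) (formEmb κ z) := by
    rw [formOp_apply, inner_add_right, ContinuousLinearMap.adjoint_inner_right, hB,
      inner_formSpace hκ]
    ring
  ext ⟨g, h⟩
  constructor
  · rintro ⟨D, hD, hφ⟩
    obtain ⟨z, rfl, hzD⟩ := exists_formEmb_eq hκ hD
    simp only at hφ
    have key : formOp B s z =
        ((formEmb κ)†) (h + ((κ ^ 2 : ℝ) : ℂ) • formEmb κ z) := by
      refine ext_inner_left ℂ fun y => ?_
      have h1 := hφ _ _ (isWeakGradient_formEmb hκ y)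
      simp only [← hzD] at h1
      rw [hform] at h1
      rw [ContinuousLinearMap.adjoint_inner_right, inner_add_right, inner_smul_right, ← h1]
      ring
    refine ⟨h + ((κ ^ 2 : ℝ) : ℂ) • formEmb κ z, ?_⟩
    rw [perturbRes_apply, ← key, inverse_apply_self hu, add_sub_cancel_right]
  · rintro ⟨q, hq⟩
    obtain ⟨rfl, rfl⟩ := Prod.ext_iff.1 hq
    set z := Ring.inverse (formOp B s) (((formEmb κ)†) q) with hz
    have hzq : formOp B s z = ((formEmb κ)†) q := self_apply_inverse hu _
    refine ⟨fun i => z.1 i.succ, isWeakGradient_formEmb hκ z, fun φ Dφ hφ => ?_⟩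
    obtain ⟨y, rfl, hyD⟩ := exists_formEmb_eq hκ hφ
    simp only [← hyD, perturbRes_apply, ← hz]
    rw [hform, hzq, ContinuousLinearMap.adjoint_inner_right, inner_sub_right, inner_smul_right]


/-! ### Multiplication and dilation operators -/

open scoped InnerProduct

/-- Dominated convergence in `L²`, along representatives. -/
theorem tendsto_L2_of_dominated {X ι : Type*} [MeasurableSpace X] {μ : Measure X} {l : Filter ι}
    [l.IsCountablyGenerated] {F : ι → Lp ℂ 2 μ} {f : Lp ℂ 2 μ} {φ : ι → X → ℂ} {φ₀ : X → ℂ}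
    {g : X → ℝ} (hF : ∀ᶠ i in l, F i =ᵐ[μ] φ i) (hf : f =ᵐ[μ] φ₀)
    (hg : Integrable (fun x => g x ^ 2) μ) (hle : ∀ᶠ i in l, ∀ᵐ x ∂μ, ‖φ i x‖ ≤ g x)
    (hle₀ : ∀ᵐ x ∂μ, ‖φ₀ x‖ ≤ g x)
    (hlim : ∀ᵐ x ∂μ, Tendsto (fun i => φ i x) l (𝓝 (φ₀ x))) : Tendsto F l (𝓝 f) := by
  have h1 : Tendsto (fun i => ∫ x, ‖φ i x - φ₀ x‖ ^ 2 ∂μ) l (𝓝 0) := by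
    have h := tendsto_integral_filter_of_dominated_convergence (μ := μ) (l := l)
      (F := fun i x => ‖φ i x - φ₀ x‖ ^ 2) (f := fun _ => (0 : ℝ)) (fun x => 4 * g x ^ 2)
      (by
        filter_upwards [hF] with i hi
        exact (((Lp.aestronglyMeasurable (F i)).congr hi).sub
          ((Lp.aestronglyMeasurable f).congr hf)).norm.pow 2)
      (by
        filter_upwards [hle] with i hi
        filter_upwards [hi, hle₀] with x h1 h2
        rw [Real.norm_of_nonneg (by positivity)]
        have := norm_sub_le (φ i x) (φ₀ x)
        have h3 : ‖φ i x - φ₀ x‖ ≤ 2 * g x := by linarith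
        calc ‖φ i x - φ₀ x‖ ^ 2 ≤ (2 * g x) ^ 2 := by gcongr
          _ = 4 * g x ^ 2 := by ring) (hg.const_mul 4)
      (by
        filter_upwards [hlim] with x hx
        have := ((hx.sub_const (φ₀ x)).norm).pow 2
        simpa using this)
    simpa using h
  rw [tendsto_iff_norm_sub_tendsto_zero]
  have h2 : Tendsto (fun i => ‖F i - f‖ ^ 2) l (𝓝 0) := by
    refine h1.congr' ?_
    filter_upwards [hF] with i hi
    rw [L2_norm_sq]
    refine integral_congr_ae ?_
    filter_upwards [hi, hf, Lp.coeFn_sub (F i) f] with x a b c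
    rw [c, Pi.sub_apply, a, b]
  have h3 := (Real.continuous_sqrt.tendsto 0).comp h2
  simpa [Function.comp_def, Real.sqrt_sq] using h3

/-- A linear assignment of square integrable functions, bounded in norm, defines an operator. -/
theorem exists_clm_coeFn_eq {H : Type*} [NormedAddCommGroup H] [InnerProductSpace ℂ H]
    {Φ : H → E3 → ℂ} {C : ℝ} (hm : ∀ z, MemLp (Φ z) 2 volume)
    (hadd : ∀ z z', Φ (z + z') =ᵐ[volume] Φ z + Φ z')
    (hsmul : ∀ (c : ℂ) z, Φ (c • z) =ᵐ[volume] c • Φ z)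
    (hC : ∀ z, ‖(hm z).toLp (Φ z)‖ ≤ C * ‖z‖) :
    ∃ L : H →L[ℂ] L2, ∀ z, L z =ᵐ[volume] Φ z :=
  ⟨LinearMap.mkContinuous
    { toFun := fun z => (hm z).toLp (Φ z)
      map_add' := fun z z' => by
        rw [← MemLp.toLp_add]
        exact MemLp.toLp_congr _ _ (hadd z z')
      map_smul' := fun c z => by
        rw [RingHom.id_apply, ← MemLp.toLp_const_smul]
        exact MemLp.toLp_congr _ _ (hsmul c z) } C hC, fun z => (hm z).coeFn_toLp⟩

theorem exists_mulOp {p : E3 → ℝ} (hp : AEStronglyMeasurable p volume) {C : ℝ}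
    (hC : ∀ x, |p x| ≤ C) :
    ∃ L : L2 →L[ℂ] L2, ∀ f, L f =ᵐ[volume] fun x => (p x : ℂ) * f x := by
  have hC' : ∀ᵐ x : E3, ‖(p x : ℂ)‖ ≤ C := Eventually.of_forall fun x => by simpa using hC x
  have hm (f : L2) : MemLp (fun x => (p x : ℂ) * f x) 2 volume :=
    memLp_two_bdd_mul (Complex.continuous_ofReal.comp_aestronglyMeasurable hp) hC' (Lp.memLp f)
  refine exists_clm_coeFn_eq (C := C) hm (fun f g => ?_) (fun c f => ?_) fun f => ?_
  · filter_upwards [Lp.coeFn_add f g] with x hx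
    rw [hx, Pi.add_apply, Pi.add_apply, mul_add]
  · filter_upwards [Lp.coeFn_smul c f] with x hx
    rw [hx, Pi.smul_apply, Pi.smul_apply, mul_smul_comm]
  · refine L2_norm_le_of_ae_le ?_
    filter_upwards [(hm f).coeFn_toLp, hC'] with x hx hx'
    rw [hx, norm_mul]
    gcongr

/-- Multiplication by a bounded measurable real function. -/
def mulOp {p : E3 → ℝ} (hp : AEStronglyMeasurable p volume) {C : ℝ} (hC : ∀ x, |p x| ≤ C) :
    L2 →L[ℂ] L2 := (exists_mulOp hp hC).choose

theorem coeFn_mulOp {p : E3 → ℝ} (hp : AEStronglyMeasurable p volume) {C : ℝ}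
    (hC : ∀ x, |p x| ≤ C) (f : L2) : mulOp hp hC f =ᵐ[volume] fun x => (p x : ℂ) * f x :=
  (exists_mulOp hp hC).choose_spec f

theorem isSelfAdjoint_mulOp {p : E3 → ℝ} (hp : AEStronglyMeasurable p volume) {C : ℝ}
    (hC : ∀ x, |p x| ≤ C) : IsSelfAdjoint (mulOp hp hC) := by
  rw [ContinuousLinearMap.isSelfAdjoint_iff_isSymmetric]
  intro f g
  simp only [ContinuousLinearMap.coe_coe]
  rw [L2_inner_eq, L2_inner_eq]
  refine integral_congr_ae ?_
  filter_upwards [coeFn_mulOp hp hC f, coeFn_mulOp hp hC g] with x hf hg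
  rw [hf, hg, map_mul, Complex.conj_ofReal]
  ring

variable {ε : ℝ}

theorem ae_comp_smul (hε : 0 < ε) {P : E3 → Prop} (h : ∀ᵐ x, P x) : ∀ᵐ x, P (ε • x) :=
  (Measure.quasiMeasurePreserving_smul volume hε.ne').ae h

theorem integral_comp_smul_E3 {F : Type*} [NormedAddCommGroup F] [NormedSpace ℝ F] (hε : 0 < ε)
    (f : E3 → F) : ∫ x, f (ε • x) = (ε ^ 3)⁻¹ • ∫ x, f x := by
  rw [Measure.integral_comp_smul, finrank_E3, abs_of_pos (by positivity)]

theorem memLp_comp_smul (hε : 0 < ε) (f : L2) : MemLp (fun x => f (ε • x)) 2 volume :=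
  memLp_two_of_integral ((Lp.aestronglyMeasurable f).comp_quasiMeasurePreserving
    (Measure.quasiMeasurePreserving_smul volume hε.ne'))
    ((integrable_norm_sq f).comp_smul hε.ne')

theorem exists_dilation (hε : 0 < ε) :
    ∃ L : L2 →L[ℂ] L2, ∀ f, L f =ᵐ[volume] fun x => f (ε • x) := by
  refine exists_clm_coeFn_eq (C := √(ε ^ 3)⁻¹) (memLp_comp_smul hε) (fun f g => ?_)
    (fun c f => ?_) fun f => ?_
  · filter_upwards [ae_comp_smul hε (Lp.coeFn_add f g)] with x hx
    rw [hx]; rfl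
  · filter_upwards [ae_comp_smul hε (Lp.coeFn_smul c f)] with x hx
    rw [hx]; rfl
  · refine le_of_sq_le_sq ?_ (by positivity)
    rw [L2_norm_toLp_sq, integral_comp_smul_E3 hε fun x => ‖f x‖ ^ 2, ← L2_norm_sq, mul_pow,
      Real.sq_sqrt (by positivity), smul_eq_mul]

/-- The dilation `f ↦ f(ε ·)`. -/
def dilation (hε : 0 < ε) : L2 →L[ℂ] L2 := (exists_dilation hε).choose

theorem coeFn_dilation (hε : 0 < ε) (f : L2) : dilation hε f =ᵐ[volume] fun x => f (ε • x) :=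
  (exists_dilation hε).choose_spec f

theorem adjoint_dilation (hε : 0 < ε) :
    (dilation hε)† = (((ε ^ 3)⁻¹ : ℝ) : ℂ) • dilation (inv_pos.2 hε) := by
  symm
  rw [ContinuousLinearMap.eq_adjoint_iff]
  intro f g
  rw [smul_apply, inner_smul_left, L2_inner_eq, L2_inner_eq, Complex.conj_ofReal]
  have h := integral_comp_smul_E3 hε fun x => conj (f (ε⁻¹ • x)) * g x
  have e1 : ∫ x, conj (dilation (inv_pos.2 hε) f x) * g x = ∫ x, conj (f (ε⁻¹ • x)) * g x := by
    refine integral_congr_ae ?_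
    filter_upwards [coeFn_dilation (inv_pos.2 hε) f] with x hx
    rw [hx]
  rw [e1, ← Complex.real_smul, ← h]
  refine integral_congr_ae ?_
  filter_upwards [coeFn_dilation hε g] with x hx
  rw [hx, inv_smul_smul₀ hε.ne']

/-- The dilated free resolvent is a multiple of the free resolvent at a rescaled energy. -/
theorem coeFn_dilation_freeRes_adjoint {κ : ℝ} (hκ : 0 < κ) (hε : 0 < ε) (f : L2) :
    dilation hε (freeRes κ (((dilation hε)†) f)) =ᵐ[volume] fun x =>
      ∫ y, ((ε⁻¹ * yukawa (ε * κ) (x - y) : ℝ) : ℂ) * f y := by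
  have h1 : ∀ x, yukawaConv κ (((dilation hε)†) f) (ε • x) =
      ∫ y, ((ε⁻¹ * yukawa (ε * κ) (x - y) : ℝ) : ℂ) * f y := by
    intro x
    have h := integral_comp_smul_E3 hε fun y => (yukawa κ (ε • x - y) : ℂ) * f (ε⁻¹ • y)
    have e1 : yukawaConv κ (((dilation hε)†) f) (ε • x) =
        (ε ^ 3)⁻¹ • ∫ y, (yukawa κ (ε • x - y) : ℂ) * f (ε⁻¹ • y) := by
      rw [yukawaConv, ← integral_smul, adjoint_dilation]
      refine integral_congr_ae ?_
      filter_upwards [Lp.coeFn_smul (((ε ^ 3)⁻¹ : ℝ) : ℂ) (dilation (inv_pos.2 hε) f),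
        coeFn_dilation (inv_pos.2 hε) f] with y h1 h2
      rw [smul_apply, h1, Pi.smul_apply, h2, smul_eq_mul, Complex.real_smul]
      ring
    rw [e1, ← h]
    refine integral_congr_ae (Eventually.of_forall fun y => ?_)
    simp only [← smul_sub, yukawa_smul hε, inv_smul_smul₀ hε.ne']
  filter_upwards [coeFn_dilation hε (freeRes κ (((dilation hε)†) f)),
    ae_comp_smul hε (coeFn_freeRes hκ (((dilation hε)†) f))] with x h2 h3
  rw [h2, h3, h1]

/-! ### Weighted embeddings -/

theorem norm_le_of_norm_self_comp_adjoint_le {H : Type*} [NormedAddCommGroup H]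
    [InnerProductSpace ℂ H] [CompleteSpace H] {B : H →L[ℂ] L2} {C : ℝ} (h : ‖B ∘L B†‖ ≤ C) (z : H) :
    ‖B z‖ ≤ √C * ‖z‖ := by
  have h1 : ‖B†‖ * ‖B†‖ ≤ C := by
    rw [← ContinuousLinearMap.norm_adjoint_comp_self, ContinuousLinearMap.adjoint_adjoint]
    exact h
  rw [LinearIsometryEquiv.norm_map] at h1
  refine (B.le_opNorm z).trans ?_
  gcongr
  refine Real.le_sqrt_of_sq_le ?_
  rwa [sq]

/-- Multiplication by an unbounded weight `b`, relative to an operator `J` such that `b J J* b` has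
a square integrable kernel. -/
theorem exists_weighted {H : Type*} [NormedAddCommGroup H] [InnerProductSpace ℂ H]
    [CompleteSpace H] (J : H →L[ℂ] L2) {b : E3 → ℝ} (hb : AEStronglyMeasurable b volume)
    (hb0 : ∀ x, 0 ≤ b x) {N : E3 × E3 → ℝ}
    (hJ : ∀ f, J ((J†) f) =ᵐ[volume] fun x => ∫ y, (N (x, y) : ℂ) * f y)
    (hk : MemLp (fun p : E3 × E3 => ((b p.1 * N p * b p.2 : ℝ) : ℂ)) 2 (volume.prod volume)) :
    ∃ B : H →L[ℂ] L2, (∀ z, B z =ᵐ[volume] fun x => (b x : ℂ) * J z x) ∧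
      B ∘L B† = intOp (hk.toLp _) := by
  -- The soft cut-offs p_n = (n + 1)/(n + 1 + b) lie in [0, 1], tend to 1 pointwise and keep c_n =
  -- p_n b below n + 1.
  set p : ℕ → E3 → ℝ := fun n x => (n + 1) / ((n + 1) + b x) with hp
  have hp0 (n : ℕ) (x : E3) : 0 ≤ p n x := by
    have := hb0 x; simp only [hp]; positivity
  have hp1 (n : ℕ) (x : E3) : p n x ≤ 1 := by
    have := hb0 x
    simp only [hp]
    rw [div_le_one (by positivity)]
    linarith
  have hpabs (n : ℕ) (x : E3) : |p n x| ≤ 1 := by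
    rw [abs_of_nonneg (hp0 n x)]; exact hp1 n x
  have hpm (n : ℕ) : AEStronglyMeasurable (p n) volume :=
    (aemeasurable_const.div (aemeasurable_const.add hb.aemeasurable)).aestronglyMeasurable
  have hplim (x : E3) : Tendsto (fun n => p n x) atTop (𝓝 1) := by
    have h1 : Tendsto (fun n : ℕ => 1 - b x * (1 / ((n : ℝ) + 1 + b x))) atTop
        (𝓝 (1 - b x * 0)) := by
      refine tendsto_const_nhds.sub (tendsto_const_nhds.mul ?_)
      refine tendsto_const_nhds.div_atTop ?_
      refine tendsto_atTop_add_const_right _ _ (tendsto_atTop_add_const_right _ _ ?_)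
      exact tendsto_natCast_atTop_atTop
    rw [mul_zero, sub_zero] at h1
    refine h1.congr fun n => ?_
    have : (n : ℝ) + 1 + b x ≠ 0 := by have := hb0 x; positivity
    simp only [hp]
    field_simp
    ring
  set c : ℕ → E3 → ℝ := fun n x => p n x * b x with hc
  have hcabs (n : ℕ) (x : E3) : |c n x| ≤ n + 1 := by
    have := hb0 x
    rw [abs_of_nonneg (mul_nonneg (hp0 n x) this)]
    simp only [hp]
    rw [div_mul_eq_mul_div, div_le_iff₀ (by positivity)]
    nlinarith [(Nat.cast_nonneg n : (0 : ℝ) ≤ n)]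
  have hcm (n : ℕ) : AEStronglyMeasurable (c n) volume := (hpm n).mul hb
  set Bn : ℕ → H →L[ℂ] L2 := fun n => mulOp (hcm n) (hcabs n) ∘L J with hBn
  have hkn (n : ℕ) : MemLp (fun q : E3 × E3 => ((c n q.1 * N q * c n q.2 : ℝ) : ℂ)) 2
      (volume.prod volume) := by
    refine hk.mono ?_ (Eventually.of_forall fun q => ?_)
    · have : (fun q : E3 × E3 => ((c n q.1 * N q * c n q.2 : ℝ) : ℂ)) =
          fun q => ((p n q.1 * p n q.2 : ℝ) : ℂ) * ((b q.1 * N q * b q.2 : ℝ) : ℂ) := by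
        ext q; simp only [hc]; push_cast; ring
      rw [this]
      exact (Complex.continuous_ofReal.comp_aestronglyMeasurable
        ((hpm n).comp_fst.mul (hpm n).comp_snd)).mul hk.1
    · rw [Complex.norm_real, Complex.norm_real, Real.norm_eq_abs, Real.norm_eq_abs]
      have : c n q.1 * N q * c n q.2 = p n q.1 * p n q.2 * (b q.1 * N q * b q.2) := by
        simp only [hc]; ring
      rw [this, abs_mul, abs_mul]
      exact mul_le_of_le_one_left (abs_nonneg _)
        (mul_le_one₀ (hpabs n _) (abs_nonneg _) (hpabs n _))
  have hBnad (n : ℕ) : (Bn n)† = J† ∘L mulOp (hcm n) (hcabs n) := by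
    rw [hBn, ContinuousLinearMap.adjoint_comp, (isSelfAdjoint_mulOp (hcm n) (hcabs n)).adjoint_eq]
  have hBnBn (n : ℕ) : Bn n ∘L (Bn n)† = intOp ((hkn n).toLp _) := by
    rw [hBnad]
    ext1 f
    refine Lp.ext ?_
    filter_upwards [coeFn_intOp_toLp (hkn n) f,
      coeFn_mulOp (hcm n) (hcabs n) (J ((J†) (mulOp (hcm n) (hcabs n) f))),
      hJ (mulOp (hcm n) (hcabs n) f)] with x h1 h2 h3
    rw [h1]
    simp only [hBn, ContinuousLinearMap.comp_apply]
    rw [h2, h3, ← integral_const_mul]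
    refine integral_congr_ae ?_
    filter_upwards [coeFn_mulOp (hcm n) (hcabs n) f] with y hy
    rw [hy]
    push_cast
    ring
  have hkle (n : ℕ) : ‖(hkn n).toLp _‖ ≤ ‖hk.toLp _‖ := by
    refine Lp.norm_le_norm_of_ae_le ?_
    filter_upwards [(hkn n).coeFn_toLp, hk.coeFn_toLp] with q h1 h2
    rw [h1, h2, Complex.norm_real, Complex.norm_real, Real.norm_eq_abs, Real.norm_eq_abs]
    have : c n q.1 * N q * c n q.2 = p n q.1 * p n q.2 * (b q.1 * N q * b q.2) := by
      simp only [hc]; ring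
    rw [this, abs_mul, abs_mul]
    exact mul_le_of_le_one_left (abs_nonneg _)
      (mul_le_one₀ (hpabs n _) (abs_nonneg _) (hpabs n _))
  -- The cut-offs only decrease the kernel, so the B_n are uniformly bounded; Fatou's lemma then
  -- puts b J z in L².
  have hBnle (n : ℕ) (z : H) : ‖Bn n z‖ ≤ √‖hk.toLp _‖ * ‖z‖ := by
    refine norm_le_of_norm_self_comp_adjoint_le ?_ z
    rw [hBnBn]
    exact (norm_intOp_le _).trans (hkle n)
  have hBnfn (n : ℕ) (z : H) : Bn n z =ᵐ[volume] fun x => (c n x : ℂ) * J z x :=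
    coeFn_mulOp (hcm n) (hcabs n) (J z)
  have hlim (z : H) : eLpNorm (fun x => (b x : ℂ) * J z x) 2 volume ≤
      ENNReal.ofReal (√‖hk.toLp _‖ * ‖z‖) := by
    refine (Lp.eLpNorm_lim_le_liminf_eLpNorm (f := fun n x => (c n x : ℂ) * J z x)
      (fun n => (Complex.continuous_ofReal.comp_aestronglyMeasurable (hcm n)).mul
        (Lp.aestronglyMeasurable (J z))) _ (Eventually.of_forall fun x => ?_)).trans ?_
    · have h1 : Tendsto (fun n => c n x) atTop (𝓝 (b x)) := by
        simpa using (hplim x).mul_const (b x)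
      exact ((Complex.continuous_ofReal.tendsto _).comp h1).mul_const _
    · refine liminf_le_of_le (by isBoundedDefault) fun a ha => ?_
      obtain ⟨n, hn⟩ := ha.exists
      refine hn.trans ?_
      rw [← eLpNorm_congr_ae (hBnfn n z), ← ENNReal.ofReal_toReal (Lp.eLpNorm_ne_top (Bn n z)),
        ← Lp.norm_def]
      exact ENNReal.ofReal_le_ofReal (hBnle n z)
  have hm (z : H) : MemLp (fun x => (b x : ℂ) * J z x) 2 volume :=
    ⟨(Complex.continuous_ofReal.comp_aestronglyMeasurable hb).mul (Lp.aestronglyMeasurable (J z)),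
      (hlim z).trans_lt ENNReal.ofReal_lt_top⟩
  obtain ⟨B, hB⟩ := exists_clm_coeFn_eq (C := √‖hk.toLp _‖) hm (fun z z' => by
      filter_upwards [Lp.coeFn_add (J z) (J z')] with x hx
      rw [map_add, hx, Pi.add_apply, Pi.add_apply, mul_add]) (fun a z => by
      filter_upwards [Lp.coeFn_smul a (J z)] with x hx
      rw [map_smul, hx, Pi.smul_apply, Pi.smul_apply, mul_smul_comm]) (fun z => by
      rw [Lp.norm_toLp]
      exact ENNReal.toReal_le_of_le_ofReal (by positivity) (hlim z))
  refine ⟨B, hB, ?_⟩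
  have hP (n : ℕ) : mulOp (hpm n) (hpabs n) ∘L B = Bn n := by
    ext1 z
    refine Lp.ext ?_
    filter_upwards [coeFn_mulOp (hpm n) (hpabs n) (B z), hB z, hBnfn n z] with x h1 h2 h3
    rw [ContinuousLinearMap.comp_apply, h1, h2, h3]
    simp only [hc]
    push_cast
    ring
  -- B B* and the integral operator agree when enclosed between two cut-offs, and the cut-offs tend
  -- strongly to the identity.
  have hPI (n : ℕ) : mulOp (hpm n) (hpabs n) ∘L (B ∘L B†) ∘L mulOp (hpm n) (hpabs n) =
      mulOp (hpm n) (hpabs n) ∘L intOp (hk.toLp _) ∘L mulOp (hpm n) (hpabs n) := by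
    have h1 : (Bn n)† = B† ∘L mulOp (hpm n) (hpabs n) := by
      rw [← hP, ContinuousLinearMap.adjoint_comp,
        (isSelfAdjoint_mulOp (hpm n) (hpabs n)).adjoint_eq]
    have h2 := hBnBn n
    rw [h1, ← hP] at h2
    refine Eq.trans h2 ?_
    ext1 f
    refine Lp.ext ?_
    filter_upwards [coeFn_intOp_toLp (hkn n) f,
      coeFn_mulOp (hpm n) (hpabs n) (intOp (hk.toLp _) (mulOp (hpm n) (hpabs n) f)),
      coeFn_intOp_toLp hk (mulOp (hpm n) (hpabs n) f)] with x h1 h2 h3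
    rw [h1]
    simp only [ContinuousLinearMap.comp_apply]
    rw [h2, h3, ← integral_const_mul]
    refine integral_congr_ae ?_
    filter_upwards [coeFn_mulOp (hpm n) (hpabs n) f] with y hy
    rw [hy]
    simp only [hc]
    push_cast
    ring
  have hPlim (f : L2) : Tendsto (fun n => mulOp (hpm n) (hpabs n) f) atTop (𝓝 f) := by
    refine tendsto_L2_of_dominated (φ := fun n x => (p n x : ℂ) * f x) (φ₀ := f)
      (g := fun x => ‖f x‖) (Eventually.of_forall fun n => coeFn_mulOp (hpm n) (hpabs n) f)
      (EventuallyEq.refl _ _) (integrable_norm_sq f)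
      (Eventually.of_forall fun n => Eventually.of_forall fun x => ?_)
      (Eventually.of_forall fun x => le_rfl) (Eventually.of_forall fun x => ?_)
    · rw [norm_mul, Complex.norm_real]
      exact mul_le_of_le_one_left (norm_nonneg _) (hpabs n x)
    · have := ((Complex.continuous_ofReal.tendsto _).comp (hplim x)).mul_const (f x)
      simpa [Function.comp_def] using this
  have hX (X : L2 →L[ℂ] L2) (f g : L2) : Tendsto (fun n => inner ℂ g
      ((mulOp (hpm n) (hpabs n) ∘L X ∘L mulOp (hpm n) (hpabs n)) f)) atTop
      (𝓝 (inner ℂ g (X f))) := by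
    have h1 := ((X.continuous.tendsto _).comp (hPlim f))
    have h2 := (hPlim g).inner (𝕜 := ℂ) h1
    refine h2.congr fun n => ?_
    have := (isSelfAdjoint_mulOp (hpm n) (hpabs n)).isSymmetric g
      (X (mulOp (hpm n) (hpabs n) f))
    exact this
  ext1 f
  refine ext_inner_left ℂ fun g => ?_
  have h1 := hX (B ∘L B†) f g
  simp only [hPI] at h1
  exact tendsto_nhds_unique h1 (hX _ f g)


/-! ### Birman-Schwinger operators -/

open scoped InnerProduct

variable {V : E3 → ℝ}

theorem absRoot_nonneg (V : E3 → ℝ) (x : E3) : 0 ≤ absRoot V x := Real.sqrt_nonneg _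

theorem absRoot_sq (V : E3 → ℝ) (x : E3) : absRoot V x ^ 2 = |V x| := Real.sq_sqrt (abs_nonneg _)

theorem aestronglyMeasurable_absRoot (hV : AEStronglyMeasurable V volume) :
    AEStronglyMeasurable (absRoot V) volume :=
  (Real.continuous_sqrt.comp continuous_abs).comp_aestronglyMeasurable hV

theorem memLp_absRoot (hV : Integrable V volume) :
    MemLp (fun x => (absRoot V x : ℂ)) 2 volume := by
  refine memLp_two_of_integral (Complex.continuous_ofReal.comp_aestronglyMeasurable
    (aestronglyMeasurable_absRoot hV.1)) ?_
  refine hV.norm.congr (Eventually.of_forall fun x => ?_)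
  simp only [Complex.norm_real, Real.norm_eq_abs, sq_abs, absRoot_sq]

/-- `√|V|` as an element of `L²(ℝ³)`. -/
def absRootLp (hV : Integrable V volume) : L2 := (memLp_absRoot hV).toLp _

theorem coeFn_absRootLp (hV : Integrable V volume) :
    absRootLp hV =ᵐ[volume] fun x => (absRoot V x : ℂ) := (memLp_absRoot hV).coeFn_toLp

theorem sign_mul_abs (a : ℝ) : Real.sign a * |a| = a := by
  rcases lt_trichotomy a 0 with h | h | h
  · rw [Real.sign_of_neg h, abs_of_neg h]; ring
  · simp [h]
  · rw [Real.sign_of_pos h, abs_of_pos h]; ring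

theorem abs_sign_le (a : ℝ) : |Real.sign a| ≤ 1 := by
  rcases Real.sign_apply_eq a with h | h | h <;> simp [h]

/-- As sign 0 = 0, the square of the sign is the indicator of {V ≠ 0}, outside which √|V| vanishes
anyway. The operator s is an involution only on such weighted functions. -/
theorem sign_mul_sign_mul_absRoot (V : E3 → ℝ) (x : E3) :
    Real.sign (V x) * (Real.sign (V x) * absRoot V x) = absRoot V x := by
  rcases lt_trichotomy (V x) 0 with h | h | h
  · rw [Real.sign_of_neg h]; ring
  · simp [absRoot, h]
  · rw [Real.sign_of_pos h]; ring

theorem measurable_sign : Measurable Real.sign := by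
  unfold Real.sign
  exact Measurable.ite measurableSet_Iio measurable_const
    (Measurable.ite measurableSet_Ioi measurable_const measurable_const)

theorem aestronglyMeasurable_sign (hV : AEStronglyMeasurable V volume) :
    AEStronglyMeasurable (fun x => Real.sign (V x)) volume :=
  (measurable_sign.comp_aemeasurable hV.aemeasurable).aestronglyMeasurable

/-- Multiplication by the sign of `V`. -/
def signOp (hV : AEStronglyMeasurable V volume) : L2 →L[ℂ] L2 :=
  mulOp (aestronglyMeasurable_sign hV) fun x => abs_sign_le (V x)

theorem coeFn_signOp (hV : AEStronglyMeasurable V volume) (f : L2) :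
    signOp hV f =ᵐ[volume] fun x => (Real.sign (V x) : ℂ) * f x := coeFn_mulOp _ _ f

theorem isSelfAdjoint_signOp (hV : AEStronglyMeasurable V volume) : IsSelfAdjoint (signOp hV) :=
  isSelfAdjoint_mulOp _ _

/-- The kernel `√|V(x)| G(x - y) √|V(y)|`. -/
def rollnikKernel (V : E3 → ℝ) (m : ℝ) (p : E3 × E3) : ℝ :=
  absRoot V p.1 * yukawa m (p.1 - p.2) * absRoot V p.2

theorem aestronglyMeasurable_rollnikKernel (hV : AEStronglyMeasurable V volume) (m : ℝ) :
    AEStronglyMeasurable (rollnikKernel V m) (volume.prod volume) := by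
  have h1 := aestronglyMeasurable_absRoot hV
  exact (h1.comp_fst.mul ((measurable_yukawa m).comp
    (measurable_fst.sub measurable_snd)).aestronglyMeasurable).mul h1.comp_snd

theorem rollnikKernel_nonneg (V : E3 → ℝ) (m : ℝ) (p : E3 × E3) : 0 ≤ rollnikKernel V m p :=
  mul_nonneg (mul_nonneg (absRoot_nonneg V _) (yukawa_nonneg _ _)) (absRoot_nonneg V _)

theorem rollnikKernel_le {m : ℝ} (hm : 0 ≤ m) (p : E3 × E3) :
    rollnikKernel V m p ≤ rollnikKernel V 0 p := by
  unfold rollnikKernel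
  have := absRoot_nonneg V p.1
  have := absRoot_nonneg V p.2
  have := yukawa_le_yukawa_zero hm (p.1 - p.2)
  gcongr

/-- At m = 0 the squared kernel is |V(x)||V(y)|/(16π²|x - y|²), the Rollnik integrand up to a
constant; larger m only decreases it. On the diagonal the kernel is 0 by the convention for division
by zero. -/
theorem memLp_rollnikKernel (hV : IsRollnik V) {m : ℝ} (hm : 0 ≤ m) :
    MemLp (fun p => (rollnikKernel V m p : ℂ)) 2 (volume.prod volume) := by
  have hmeas (m : ℝ) : AEStronglyMeasurable (fun p => (rollnikKernel V m p : ℂ))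
      (volume.prod volume) :=
    Complex.continuous_ofReal.comp_aestronglyMeasurable
      (aestronglyMeasurable_rollnikKernel hV.1 m)
  have h0 : MemLp (fun p => (rollnikKernel V 0 p : ℂ)) 2 (volume.prod volume) := by
    refine ⟨hmeas 0, ?_⟩
    rw [eLpNorm_lt_top_iff_lintegral_rpow_enorm_lt_top (by simp) (by simp)]
    have hm2 : AEMeasurable (fun p : E3 × E3 => ‖(rollnikKernel V 0 p : ℂ)‖ₑ ^ (2 : ℝ≥0∞).toReal)
        (volume.prod volume) := (hmeas 0).enorm.pow_const _
    rw [lintegral_prod _ hm2]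
    refine lt_of_le_of_lt (lintegral_mono fun x => lintegral_mono fun y => ?_) hV.2
    simp only [ENNReal.toReal_ofNat, ENNReal.rpow_ofNat]
    by_cases hxy : x = y
    · subst hxy
      simp [rollnikKernel, yukawa]
    · have hpos : 0 < ‖x - y‖ := norm_pos_iff.2 (sub_ne_zero.2 hxy)
      have hpi : 1 ≤ 4 * Real.pi := by linarith [Real.pi_gt_three]
      rw [← ofReal_norm, ← ofReal_norm, ← ofReal_norm, ← ofReal_norm,
        ← ENNReal.ofReal_pow (norm_nonneg _), ← ENNReal.ofReal_pow (norm_nonneg _),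
        ← ENNReal.ofReal_mul (norm_nonneg _), ← ENNReal.ofReal_div_of_pos (by positivity)]
      refine ENNReal.ofReal_le_ofReal ?_
      rw [Complex.norm_real, Real.norm_eq_abs, sq_abs, rollnikKernel, mul_pow, mul_pow, absRoot_sq,
        absRoot_sq, yukawa_zero_eq, Real.norm_eq_abs, Real.norm_eq_abs, mul_right_comm,
        div_eq_mul_inv, ← inv_pow]
      gcongr
      nlinarith
  refine h0.mono (hmeas m) (Eventually.of_forall fun p => ?_)
  rw [Complex.norm_real, Complex.norm_real, Real.norm_of_nonneg (rollnikKernel_nonneg _ _ _),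
    Real.norm_of_nonneg (rollnikKernel_nonneg _ _ _)]
  exact rollnikKernel_le hm p

/-- The operator `√|V| (-Δ + m²)⁻¹ √|V|`, for `m ≥ 0`. -/
def bsOp (hV : IsRollnik V) (m : ℝ) : L2 →L[ℂ] L2 :=
  -- The maximum with 0 makes the family total in m.
  intOp ((memLp_rollnikKernel hV (le_max_right m 0)).toLp _)

theorem bsOp_eq (hV : IsRollnik V) {m : ℝ} (hm : 0 ≤ m) :
    bsOp hV m = intOp ((memLp_rollnikKernel hV hm).toLp _) := by
  unfold bsOp
  congr 2
  simp only [max_eq_left hm]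

theorem coeFn_bsOp (hV : IsRollnik V) {m : ℝ} (hm : 0 ≤ m) (f : L2) :
    bsOp hV m f =ᵐ[volume] fun x =>
      (absRoot V x : ℂ) * ∫ y, (yukawa m (x - y) : ℂ) * ((absRoot V y : ℂ) * f y) := by
  rw [bsOp_eq hV hm]
  filter_upwards [coeFn_intOp_toLp (memLp_rollnikKernel hV hm) f] with x hx
  rw [hx, ← integral_const_mul]
  refine integral_congr_ae (Eventually.of_forall fun y => ?_)
  simp only [rollnikKernel]
  push_cast
  ring

theorem isCompactOperator_bsOp (hV : IsRollnik V) (m : ℝ) : IsCompactOperator (bsOp hV m) :=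
  isCompactOperator_intOp _

theorem isSelfAdjoint_bsOp (hV : IsRollnik V) (m : ℝ) : IsSelfAdjoint (bsOp hV m) := by
  rw [ContinuousLinearMap.isSelfAdjoint_iff', bsOp, adjoint_intOp]
  congr 2
  ext p
  simp only [rollnikKernel, Complex.conj_ofReal, Prod.fst_swap, Prod.snd_swap,
    yukawa_sub_comm _ p.2 p.1]
  congr 1
  ring

theorem ae_prod_fst_ne_snd : ∀ᵐ p : E3 × E3 ∂(volume.prod volume), p.1 ≠ p.2 := by
  have hm : MeasurableSet {p : E3 × E3 | ¬ p.1 ≠ p.2} := by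
    simp only [not_not]
    exact measurableSet_eq_fun measurable_fst measurable_snd
  rw [ae_iff, Measure.measure_prod_null hm]
  refine Eventually.of_forall fun x => ?_
  have : Prod.mk x ⁻¹' {p : E3 × E3 | ¬ p.1 ≠ p.2} = {x} := by
    ext y; simp [eq_comm]
  simp only [this]
  simp

theorem integrable_sq_rollnikKernel (hV : IsRollnik V) {m : ℝ} (hm : 0 ≤ m) :
    Integrable (fun p => rollnikKernel V m p ^ 2) (volume.prod volume) := by
  have h := (memLp_two_iff_integrable_sq_norm (memLp_rollnikKernel hV hm).1).1
    (memLp_rollnikKernel hV hm)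
  refine h.congr (Eventually.of_forall fun p => ?_)
  simp [Complex.norm_real]

theorem norm_rollnikKernel_le {m : ℝ} (hm : 0 ≤ m) (p : E3 × E3) :
    ‖(rollnikKernel V m p : ℂ)‖ ≤ rollnikKernel V 0 p := by
  rw [Complex.norm_real, Real.norm_of_nonneg (rollnikKernel_nonneg _ _ _)]
  exact rollnikKernel_le hm p

theorem tendsto_bsOp_atTop (hV : IsRollnik V) : Tendsto (bsOp hV) atTop (𝓝 0) := by
  have hz : MemLp (fun _ : E3 × E3 => (0 : ℂ)) 2 (volume.prod volume) := MemLp.zero'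
  have h := tendsto_intOp_of_dominated (l := atTop) (F := rollnikKernel V 0)
    (fun m => memLp_rollnikKernel hV (le_max_right m 0)) hz
    (integrable_sq_rollnikKernel hV le_rfl)
    (Eventually.of_forall fun m => Eventually.of_forall fun p =>
      norm_rollnikKernel_le (le_max_right m 0) p)
    (Eventually.of_forall fun p => by simpa using rollnikKernel_nonneg V 0 p)
    (Eventually.of_forall fun p => by
      by_cases hp : ‖p.1 - p.2‖ = 0
      · simp [rollnikKernel, yukawa, hp]
      · have hpos : 0 < ‖p.1 - p.2‖ := lt_of_le_of_ne (norm_nonneg _) (Ne.symm hp)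
        have h1 : Tendsto (fun m : ℝ => Real.exp (-(max m 0 * ‖p.1 - p.2‖))) atTop (𝓝 0) := by
          refine Real.tendsto_exp_neg_atTop_nhds_zero.comp ?_
          refine Tendsto.atTop_mul_const hpos ?_
          exact tendsto_atTop_mono (fun m => le_max_left m 0) tendsto_id
        have h2 := ((h1.div_const (4 * Real.pi * ‖p.1 - p.2‖)).const_mul
          (absRoot V p.1)).mul_const (absRoot V p.2)
        have h3 := (Complex.continuous_ofReal.tendsto _).comp h2
        simpa [rollnikKernel, yukawa, Function.comp_def] using h3)
  have h0 : hz.toLp _ = 0 := MemLp.toLp_zero hz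
  rw [h0, map_zero] at h
  exact h

theorem tendsto_bsOp_zero (hV : IsRollnik V) : Tendsto (bsOp hV) (𝓝[>] 0) (𝓝 (bsOp hV 0)) := by
  rw [bsOp_eq hV le_rfl]
  refine tendsto_intOp_of_dominated (F := rollnikKernel V 0)
    (fun m => memLp_rollnikKernel hV (le_max_right m 0)) (memLp_rollnikKernel hV le_rfl)
    (integrable_sq_rollnikKernel hV le_rfl)
    (Eventually.of_forall fun m => Eventually.of_forall fun p =>
      norm_rollnikKernel_le (le_max_right m 0) p)
    (Eventually.of_forall fun p => norm_rollnikKernel_le le_rfl p)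
    (Eventually.of_forall fun p => ?_)
  have hc : Continuous fun m : ℝ => (rollnikKernel V (max m 0) p : ℂ) := by
    unfold rollnikKernel yukawa
    fun_prop
  have := hc.tendsto 0
  rw [max_self] at this
  exact this.mono_left nhdsWithin_le_nhds

/-- The inequality 1 - exp(-t) ≤ t cancels the singularity. The bound is constant in x, so
√|V(x)|√|V(y)|, square integrable for V in L¹, dominates the difference quotients. -/
theorem abs_yukawa_sub_le {m : ℝ} (hm : 0 ≤ m) (x : E3) :
    |yukawa m x - yukawa 0 x| ≤ m * (4 * Real.pi)⁻¹ := by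
  have hpi := Real.pi_pos
  rw [abs_sub_comm, abs_of_nonneg (sub_nonneg.2 (yukawa_le_yukawa_zero hm x))]
  unfold yukawa
  by_cases hx : ‖x‖ = 0
  · simp [hx]; positivity
  · have hpos : 0 < ‖x‖ := lt_of_le_of_ne (norm_nonneg _) (Ne.symm hx)
    rw [← sub_div, div_le_iff₀ (by positivity)]
    have := Real.add_one_le_exp (-(m * ‖x‖))
    have e : m * (4 * Real.pi)⁻¹ * (4 * Real.pi * ‖x‖) = m * ‖x‖ := by field_simp
    rw [e]
    simp only [zero_mul, neg_zero, Real.exp_zero]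
    linarith

/-- The derivative at m = 0 is independent of x, which is why the first-order term of the
Birman-Schwinger operator has rank one. -/
theorem tendsto_yukawa_quotient {x : E3} (hx : x ≠ 0) :
    Tendsto (fun m => m⁻¹ * (yukawa m x - yukawa 0 x)) (𝓝[>] 0) (𝓝 (-(4 * Real.pi)⁻¹)) := by
  have hpos : 0 < ‖x‖ := norm_pos_iff.2 hx
  have hpi := Real.pi_pos
  have hd : HasDerivAt (fun m => yukawa m x) (-(4 * Real.pi)⁻¹) 0 := by
    unfold yukawa
    have := ((((hasDerivAt_id (0 : ℝ)).mul_const ‖x‖).fun_neg).exp).div_const (4 * Real.pi * ‖x‖)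
    refine this.congr_deriv ?_
    simp only [id_eq, zero_mul, neg_zero, Real.exp_zero]
    field_simp
  have h := hd.tendsto_slope_zero_right
  simpa [smul_eq_mul] using h

/-- First order expansion of the Birman-Schwinger operator at zero energy. -/
theorem tendsto_bsOp_quotient (hV : IsRollnik V) (hV1 : Integrable V volume) :
    Tendsto (fun m : ℝ => ((m⁻¹ : ℝ) : ℂ) • (bsOp hV m - bsOp hV 0)) (𝓝[>] 0)
      (𝓝 (((-(4 * Real.pi)⁻¹ : ℝ) : ℂ) • rankOne (absRootLp hV1) (absRootLp hV1))) := by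
  have hpi := Real.pi_pos
  have hT := memLp_tensor (memLp_absRoot hV1) (memLp_absRoot hV1)
  have hk₀ := hT.const_smul (((-(4 * Real.pi)⁻¹ : ℝ) : ℂ))
  have hk (m : ℝ) := ((memLp_rollnikKernel hV (le_max_right m 0)).sub
    (memLp_rollnikKernel hV le_rfl)).const_smul ((m⁻¹ : ℝ) : ℂ)
  have hle (m : ℝ) (p : E3 × E3) : ‖(((m⁻¹ : ℝ) : ℂ) • ((fun p => (rollnikKernel V (max m 0) p : ℂ))
      - fun p => (rollnikKernel V 0 p : ℂ))) p‖ ≤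
      (4 * Real.pi)⁻¹ * (absRoot V p.1 * absRoot V p.2) := by
    have h1 := absRoot_nonneg V p.1
    have h2 := absRoot_nonneg V p.2
    simp only [Pi.smul_apply, Pi.sub_apply, smul_eq_mul]
    rw [← Complex.ofReal_sub, ← Complex.ofReal_mul, Complex.norm_real, Real.norm_eq_abs]
    rcases le_or_gt m 0 with hm | hm
    · rw [max_eq_right hm]; simp; positivity
    · rw [max_eq_left hm.le]
      have e : m⁻¹ * (rollnikKernel V m p - rollnikKernel V 0 p) =
          m⁻¹ * (yukawa m (p.1 - p.2) - yukawa 0 (p.1 - p.2)) * (absRoot V p.1 * absRoot V p.2) := by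
        unfold rollnikKernel; ring
      rw [e, abs_mul, abs_of_nonneg (mul_nonneg h1 h2), abs_mul, abs_of_pos (inv_pos.2 hm)]
      gcongr
      rw [inv_mul_le_iff₀ hm]
      exact abs_yukawa_sub_le hm.le _
  have h := tendsto_intOp_of_dominated (l := 𝓝[>] 0)
    (F := fun p => (4 * Real.pi)⁻¹ * (absRoot V p.1 * absRoot V p.2)) hk hk₀
    (by
      have h1 := ((memLp_two_iff_integrable_sq_norm hT.1).1 hT).const_mul (((4 * Real.pi)⁻¹) ^ 2)
      refine h1.congr (Eventually.of_forall fun p => ?_)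
      simp only [← Complex.ofReal_mul, Complex.norm_real, Real.norm_eq_abs, sq_abs]
      ring)
    (Eventually.of_forall fun m => Eventually.of_forall fun p => hle m p)
    (Eventually.of_forall fun p => by
      have h1 := absRoot_nonneg V p.1
      have h2 := absRoot_nonneg V p.2
      simp only [Pi.smul_apply, smul_eq_mul]
      rw [← Complex.ofReal_mul, ← Complex.ofReal_mul, Complex.norm_real, Real.norm_eq_abs, abs_mul,
        abs_neg, abs_of_pos (by positivity : (0 : ℝ) < (4 * Real.pi)⁻¹),
        abs_of_nonneg (mul_nonneg h1 h2)])
    (by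
      filter_upwards [ae_prod_fst_ne_snd] with p hp
      have h1 := ((tendsto_yukawa_quotient (sub_ne_zero.2 hp)).mul_const
        (absRoot V p.1 * absRoot V p.2))
      have h2 := (Complex.continuous_ofReal.tendsto _).comp h1
      have e : ((((-(4 * Real.pi)⁻¹ : ℝ) : ℂ)) • fun p : E3 × E3 =>
          (absRoot V p.1 : ℂ) * (absRoot V p.2 : ℂ)) p =
          ((-(4 * Real.pi)⁻¹ * (absRoot V p.1 * absRoot V p.2) : ℝ) : ℂ) := by
        simp
      rw [e]
      refine h2.congr' ?_
      filter_upwards [self_mem_nhdsWithin] with m hm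
      have hm' : 0 < m := hm
      simp only [Function.comp_apply, Pi.smul_apply, Pi.sub_apply, smul_eq_mul,
        max_eq_left hm'.le, rollnikKernel]
      push_cast
      ring)
  have e1 : intOp (hk₀.toLp _) =
      ((-(4 * Real.pi)⁻¹ : ℝ) : ℂ) • rankOne (absRootLp hV1) (absRootLp hV1) := by
    have : hk₀.toLp _ = (((-(4 * Real.pi)⁻¹ : ℝ) : ℂ)) • hT.toLp _ := rfl
    rw [this, map_smul]
    congr 1
    ext1 f
    refine Lp.ext ?_
    filter_upwards [coeFn_intOp_toLp hT f, coeFn_absRootLp hV1,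
      Lp.coeFn_smul (inner ℂ (absRootLp hV1) f) (absRootLp hV1)] with x h1 h2 h3
    rw [h1, rankOne_apply, h3, Pi.smul_apply, h2, smul_eq_mul, L2_inner_eq, ← integral_mul_const]
    refine integral_congr_ae ?_
    filter_upwards [coeFn_absRootLp hV1] with y hy
    rw [hy, Complex.conj_ofReal]
    ring
  have e2 (m : ℝ) : intOp ((hk m).toLp _) = ((m⁻¹ : ℝ) : ℂ) • (bsOp hV m - bsOp hV 0) := by
    have : (hk m).toLp _ = ((m⁻¹ : ℝ) : ℂ) •
        ((memLp_rollnikKernel hV (le_max_right m 0)).toLp _ -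
          (memLp_rollnikKernel hV le_rfl).toLp _) := rfl
    rw [this, map_smul, map_sub, bsOp_eq hV le_rfl]
    rfl
  rw [e1] at h
  exact h.congr e2


/-! ### Form sums with scaled potentials -/

open scoped InnerProduct

variable {V : E3 → ℝ} {κ ε : ℝ}

/-- Dilation by ε turns √|V(·/ε)| into √|V| and the kernel G_κ into ε⁻¹G_{εκ}: the limit ε → 0
becomes a zero-energy limit for a fixed potential. -/
theorem exists_scaledEmb (hV : IsRollnik V) (hκ : 0 < κ) (hε : 0 < ε) :
    ∃ B : formSpace κ →L[ℂ] L2,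
      (∀ z, B z =ᵐ[volume] fun x => (absRoot V x : ℂ) * formEmb κ z (ε • x)) ∧
      B ∘L B† = ((ε⁻¹ : ℝ) : ℂ) • bsOp hV (ε * κ) := by
  have hεκ : 0 ≤ ε * κ := by positivity
  have hk : MemLp (fun p : E3 × E3 => ((absRoot V p.1 * (ε⁻¹ * yukawa (ε * κ) (p.1 - p.2)) *
      absRoot V p.2 : ℝ) : ℂ)) 2 (volume.prod volume) := by
    refine ((memLp_rollnikKernel hV hεκ).const_smul ((ε⁻¹ : ℝ) : ℂ)).ae_eq
      (Eventually.of_forall fun p => ?_)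
    simp only [Pi.smul_apply, smul_eq_mul, rollnikKernel]
    push_cast
    ring
  obtain ⟨B, hB, hBB⟩ := exists_weighted (dilation hε ∘L formEmb κ)
    (aestronglyMeasurable_absRoot hV.1) (absRoot_nonneg V)
    (N := fun p => ε⁻¹ * yukawa (ε * κ) (p.1 - p.2)) (fun f => by
      rw [ContinuousLinearMap.adjoint_comp]
      exact coeFn_dilation_freeRes_adjoint hκ hε f) hk
  refine ⟨B, fun z => ?_, ?_⟩
  · filter_upwards [hB z, coeFn_dilation hε (formEmb κ z)] with x h1 h2
    rw [h1, ContinuousLinearMap.comp_apply, h2]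
  · rw [hBB, bsOp_eq hV hεκ, ← map_smul, ← MemLp.toLp_const_smul]
    congr 1
    refine MemLp.toLp_congr _ _ (Eventually.of_forall fun p => ?_)
    simp only [Pi.smul_apply, smul_eq_mul, rollnikKernel]
    push_cast
    ring

/-- The weighted embedding `z ↦ √|V| z(ε ·)` of `H¹(ℝ³)` into `L²(ℝ³)`. -/
def scaledEmb (hV : IsRollnik V) (hκ : 0 < κ) (hε : 0 < ε) : formSpace κ →L[ℂ] L2 :=
  (exists_scaledEmb hV hκ hε).choose

theorem coeFn_scaledEmb (hV : IsRollnik V) (hκ : 0 < κ) (hε : 0 < ε) (z : formSpace κ) :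
    scaledEmb hV hκ hε z =ᵐ[volume] fun x => (absRoot V x : ℂ) * formEmb κ z (ε • x) :=
  (exists_scaledEmb hV hκ hε).choose_spec.1 z

theorem scaledEmb_comp_adjoint (hV : IsRollnik V) (hκ : 0 < κ) (hε : 0 < ε) :
    scaledEmb hV hκ hε ∘L (scaledEmb hV hκ hε)† = ((ε⁻¹ : ℝ) : ℂ) • bsOp hV (ε * κ) :=
  (exists_scaledEmb hV hκ hε).choose_spec.2

theorem coeFn_scaledEmb_adjoint (hV : IsRollnik V) (hκ : 0 < κ) (hε : 0 < ε) (h : L2) :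
    scaledEmb hV hκ hε (((formEmb κ)†) h) =ᵐ[volume] fun x =>
      (absRoot V x : ℂ) * yukawaConv κ h (ε • x) := by
  filter_upwards [coeFn_scaledEmb hV hκ hε (((formEmb κ)†) h),
    ae_comp_smul hε (coeFn_freeRes hκ h)] with x h1 h2
  rw [h1, ← freeRes_apply, h2]

theorem inner_scaledEmb_sign (hV : IsRollnik V) (hκ : 0 < κ) (hε : 0 < ε) (f g : formSpace κ) :
    inner ℂ (scaledEmb hV hκ hε f) (signOp hV.1 (scaledEmb hV hκ hε g)) =
      ∫ x, (((ε ^ 3)⁻¹ * V (ε⁻¹ • x) : ℝ) : ℂ) * (conj (formEmb κ f x) * formEmb κ g x) := by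
  have h := integral_comp_smul_E3 hε
    fun x => (V (ε⁻¹ • x) : ℂ) * (conj (formEmb κ f x) * formEmb κ g x)
  have e : ∫ x, (((ε ^ 3)⁻¹ * V (ε⁻¹ • x) : ℝ) : ℂ) * (conj (formEmb κ f x) * formEmb κ g x) =
      (ε ^ 3)⁻¹ • ∫ x, (V (ε⁻¹ • x) : ℂ) * (conj (formEmb κ f x) * formEmb κ g x) := by
    rw [← integral_smul]
    refine integral_congr_ae (Eventually.of_forall fun x => ?_)
    simp only [Complex.real_smul]
    push_cast
    ring
  rw [e, ← h, L2_inner_eq]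
  refine integral_congr_ae ?_
  filter_upwards [coeFn_scaledEmb hV hκ hε f, coeFn_scaledEmb hV hκ hε g,
    coeFn_signOp hV.1 (scaledEmb hV hκ hε g)] with x h1 h2 h3
  rw [h3, h1, h2, inv_smul_smul₀ hε.ne', map_mul, Complex.conj_ofReal]
  have : (V x : ℂ) = (Real.sign (V x) : ℂ) * ((absRoot V x : ℂ) * (absRoot V x : ℂ)) := by
    rw [← Complex.ofReal_mul, ← Complex.ofReal_mul, ← sq, absRoot_sq, sign_mul_abs]
  rw [this]
  ring

/-- The weighted embedding of the form `∫ a V(x/ε) |g|²`. -/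
def potEmb (hV : IsRollnik V) (hκ : 0 < κ) (hε : 0 < ε) (a : ℝ) : formSpace κ →L[ℂ] L2 :=
  ((√(a * ε ^ 3) : ℝ) : ℂ) • scaledEmb hV hκ hε

/-- The kernel takes one power of ε from the factor a ε³ of the change of variables. The remaining
coupling a ε² makes σ = 2 critical. -/
theorem potEmb_comp_adjoint (hV : IsRollnik V) (hκ : 0 < κ) (hε : 0 < ε) {a : ℝ} (ha : 0 ≤ a) :
    potEmb hV hκ hε a ∘L (potEmb hV hκ hε a)† = ((a * ε ^ 2 : ℝ) : ℂ) • bsOp hV (ε * κ) := by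
  have h : √(a * ε ^ 3) * √(a * ε ^ 3) = a * ε ^ 3 := Real.mul_self_sqrt (by positivity)
  rw [potEmb, map_smulₛₗ, ContinuousLinearMap.smul_comp, ContinuousLinearMap.comp_smul,
    scaledEmb_comp_adjoint, smul_smul, smul_smul, Complex.conj_ofReal, ← Complex.ofReal_mul,
    ← Complex.ofReal_mul, h]
  congr 2
  field_simp

theorem birmanOp_potEmb (hV : IsRollnik V) (hκ : 0 < κ) (hε : 0 < ε) {a : ℝ} (ha : 0 ≤ a) :
    birmanOp (potEmb hV hκ hε a) (signOp hV.1) =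
      1 + ((a * ε ^ 2 : ℝ) : ℂ) • (signOp hV.1 ∘L bsOp hV (ε * κ)) := by
  rw [birmanOp, potEmb_comp_adjoint hV hκ hε ha, ContinuousLinearMap.comp_smul]

/-- The operator `√|V| (G h)(ε ·)`. -/
def gammaOp (hV : IsRollnik V) (hκ : 0 < κ) (hε : 0 < ε) : L2 →L[ℂ] L2 :=
  scaledEmb hV hκ hε ∘L (formEmb κ)†

theorem potEmb_comp_formEmb_adjoint (hV : IsRollnik V) (hκ : 0 < κ) (hε : 0 < ε) (a : ℝ) :
    potEmb hV hκ hε a ∘L (formEmb κ)† = ((√(a * ε ^ 3) : ℝ) : ℂ) • gammaOp hV hκ hε := rfl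

/-- The resolvent of the form sum `-Δ + a V(·/ε)`. -/
def potRes (hV : IsRollnik V) (hκ : 0 < κ) (hε : 0 < ε) (a : ℝ) : L2 →L[ℂ] L2 :=
  perturbRes (formEmb κ) (potEmb hV hκ hε a) (signOp hV.1)

theorem isSelfAdjoint_potRes (hV : IsRollnik V) (hκ : 0 < κ) (hε : 0 < ε) (a : ℝ) :
    IsSelfAdjoint (potRes hV hκ hε a) :=
  isSelfAdjoint_perturbRes (isSelfAdjoint_signOp hV.1)

theorem injective_potRes (hV : IsRollnik V) (hκ : 0 < κ) (hε : 0 < ε) {a : ℝ}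
    (hu : IsUnit (formOp (potEmb hV hκ hε a) (signOp hV.1))) :
    Function.Injective (potRes hV hκ hε a) :=
  injective_perturbRes (formEmb_injective hκ) (injective_adjoint_formEmb hκ) hu

theorem formSumGraph_eq_potRes (hV : IsRollnik V) (hκ : 0 < κ) (hε : 0 < ε) {a : ℝ} (ha : 0 ≤ a)
    (hu : IsUnit (formOp (potEmb hV hκ hε a) (signOp hV.1))) :
    formSumGraph (fun x => a * V (ε⁻¹ • x)) = resolventGraph κ (potRes hV hκ hε a) := by
  refine formSumGraph_eq_resolventGraph hκ (fun f g => ?_) hu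
  have h : √(a * ε ^ 3) * √(a * ε ^ 3) = a * ε ^ 3 := Real.mul_self_sqrt (by positivity)
  rw [potEmb, smul_apply, smul_apply, map_smul, inner_smul_left, inner_smul_right,
    inner_scaledEmb_sign, Complex.conj_ofReal, ← mul_assoc, ← Complex.ofReal_mul, h,
    ← integral_const_mul]
  refine integral_congr_ae (Eventually.of_forall fun x => ?_)
  simp only [← mul_assoc, ← Complex.ofReal_mul]
  congr 4
  field_simp

theorem potRes_eq_sub (hV : IsRollnik V) (hκ : 0 < κ) (hε : 0 < ε) {a : ℝ} (ha : 0 ≤ a)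
    (hu : IsUnit (birmanOp (potEmb hV hκ hε a) (signOp hV.1))) :
    potRes hV hκ hε a = freeRes κ - ((a * ε ^ 3 : ℝ) : ℂ) • ((gammaOp hV hκ hε)† ∘L
      Ring.inverse (birmanOp (potEmb hV hκ hε a) (signOp hV.1)) ∘L signOp hV.1 ∘L
        gammaOp hV hκ hε) := by
  have h : √(a * ε ^ 3) * √(a * ε ^ 3) = a * ε ^ 3 := Real.mul_self_sqrt (by positivity)
  rw [potRes, perturbRes_eq_sub hu, potEmb_comp_formEmb_adjoint, map_smulₛₗ,
    ContinuousLinearMap.smul_comp, ContinuousLinearMap.comp_smul, ContinuousLinearMap.comp_smul,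
    ContinuousLinearMap.comp_smul, smul_smul, Complex.conj_ofReal, ← Complex.ofReal_mul, h]
  rfl

/-- For every potential of Rollnik class there is an energy at which the resolvent exists. -/
theorem exists_isUnit_birmanOp (hV : IsRollnik V) (hε : 0 < ε) {a : ℝ} (ha : 0 ≤ a) :
    ∃ (κ : ℝ) (hκ : 0 < κ), IsUnit (birmanOp (potEmb hV hκ hε a) (signOp hV.1)) := by
  have h1 : Tendsto (fun κ => ((a * ε ^ 2 : ℝ) : ℂ) • (signOp hV.1 ∘L bsOp hV (ε * κ)))
      atTop (𝓝 0) := by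
    have h := (tendsto_bsOp_atTop hV).comp (tendsto_id.const_mul_atTop hε)
    have h2 := ((ContinuousLinearMap.compL ℂ L2 L2 L2 (signOp hV.1)).continuous.tendsto 0).comp h
    have h3 := h2.const_smul ((a * ε ^ 2 : ℝ) : ℂ)
    rw [map_zero, smul_zero] at h3
    exact h3
  have h2 := h1.const_add (1 : L2 →L[ℂ] L2)
  rw [add_zero] at h2
  have h3 := h2.eventually (Units.isOpen.mem_nhds (isUnit_one (M := L2 →L[ℂ] L2)))
  obtain ⟨κ, hu, hκ⟩ := (h3.and (eventually_gt_atTop 0)).exists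
  refine ⟨κ, hκ, ?_⟩
  rw [birmanOp_potEmb hV hκ hε ha]
  exact hu

/-! ### The operators `√|V| (G h)(ε ·)` as `ε` tends to zero -/

/-- The limit `h ↦ ⟨G_κ, h⟩ √|V|`. -/
def gammaLim (hV : Integrable V volume) (κ : ℝ) : L2 →L[ℂ] L2 :=
  rankOne (absRootLp hV) (yukawaLp κ)

/-- Translations act continuously on L², and a multiple of the integrable weight |V| dominates. -/
theorem tendsto_integral_yukawaShift (hV : Integrable V volume) (κ : ℝ) :
    Tendsto (fun ε : ℝ => ∫ x, |V x| * ‖yukawaShift κ (ε • x) - yukawaLp κ‖ ^ 2) (𝓝[>] 0)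
      (𝓝 0) := by
  have h := tendsto_integral_filter_of_dominated_convergence (l := 𝓝[>] (0 : ℝ))
    (F := fun (ε : ℝ) x => |V x| * ‖yukawaShift κ (ε • x) - yukawaLp κ‖ ^ 2)
    (f := fun _ => (0 : ℝ)) (fun x => |V x| * (2 * ‖yukawaLp κ‖) ^ 2)
    (Eventually.of_forall fun ε => by
      have hc : Continuous fun x : E3 => ‖yukawaShift κ (ε • x) - yukawaLp κ‖ ^ 2 := by
        have := continuous_yukawaShift κ
        fun_prop
      exact hV.1.norm.mul hc.aestronglyMeasurable)
    (Eventually.of_forall fun ε => Eventually.of_forall fun x => by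
      rw [Real.norm_of_nonneg (by positivity)]
      have h1 := norm_sub_le (yukawaShift κ (ε • x)) (yukawaLp κ)
      rw [norm_yukawaShift] at h1
      gcongr
      linarith)
    (hV.norm.mul_const _)
    (Eventually.of_forall fun x => by
      have hc : Continuous fun ε : ℝ => |V x| * ‖yukawaShift κ (ε • x) - yukawaLp κ‖ ^ 2 := by
        have := continuous_yukawaShift κ
        fun_prop
      have := (hc.tendsto 0).mono_left (nhdsWithin_le_nhds (s := Ioi 0))
      simpa [yukawaShift_zero] using this)
  simpa using h

/-- The value (G h)(εx) - (G h)(0) is the inner product of h with a difference of translates of G_κ,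
so Cauchy-Schwarz yields a bound uniform in h. -/
theorem norm_gammaOp_sub_le (hV : IsRollnik V) (hV1 : Integrable V volume) (hκ : 0 < κ)
    (hε : 0 < ε) : ‖gammaOp hV hκ hε - gammaLim hV1 κ‖ ≤
      √(∫ x, |V x| * ‖yukawaShift κ (ε • x) - yukawaLp κ‖ ^ 2) := by
  refine ContinuousLinearMap.opNorm_le_bound _ (by positivity) fun h => ?_
  refine le_of_sq_le_sq ?_ (by positivity)
  have hInt : Integrable fun x => |V x| * ‖yukawaShift κ (ε • x) - yukawaLp κ‖ ^ 2 := by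
    have hc : Continuous fun x : E3 => ‖yukawaShift κ (ε • x) - yukawaLp κ‖ ^ 2 := by
      have := continuous_yukawaShift κ
      fun_prop
    refine (hV1.norm.mul_const ((2 * ‖yukawaLp κ‖) ^ 2)).mono'
      (hV1.1.norm.mul hc.aestronglyMeasurable) (Eventually.of_forall fun x => ?_)
    rw [Real.norm_of_nonneg (by positivity), Real.norm_eq_abs]
    have h1 := norm_sub_le (yukawaShift κ (ε • x)) (yukawaLp κ)
    rw [norm_yukawaShift] at h1
    gcongr
    linarith
  rw [mul_pow, Real.sq_sqrt (integral_nonneg fun x => by positivity), L2_norm_sq,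
    ← integral_mul_const]
  refine integral_mono_ae (integrable_norm_sq _) (hInt.mul_const _) ?_
  filter_upwards [coeFn_scaledEmb_adjoint hV hκ hε h, coeFn_absRootLp hV1,
    Lp.coeFn_sub (gammaOp hV hκ hε h) (gammaLim hV1 κ h),
    Lp.coeFn_smul (inner ℂ (yukawaLp κ) h) (absRootLp hV1)] with x h1 h2 h3 h4
  rw [sub_apply, h3, Pi.sub_apply, gammaLim, rankOne_apply, h4, Pi.smul_apply, h2, gammaOp,
    ContinuousLinearMap.comp_apply, h1, yukawaConv_eq_inner hκ, smul_eq_mul, mul_comm,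
    ← sub_mul, ← inner_sub_left, norm_mul, mul_pow, Complex.norm_real, Real.norm_eq_abs, sq_abs,
    absRoot_sq]
  have := norm_inner_le_norm (𝕜 := ℂ) (yukawaShift κ (ε • x) - yukawaLp κ) h
  calc _ ≤ (‖yukawaShift κ (ε • x) - yukawaLp κ‖ * ‖h‖) ^ 2 * |V x| := by gcongr
    _ = _ := by ring


/-! ### Resolvent limits -/

open scoped InnerProduct

variable {V : E3 → ℝ} {κ : ℝ}

/-- The operators `√|V| (G h)(ε ·)`, as a family indexed by all real `ε`. -/
def gammaFam (hV : IsRollnik V) (hκ : 0 < κ) (ε : ℝ) : L2 →L[ℂ] L2 :=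
  if hε : 0 < ε then gammaOp hV hκ hε else 0

theorem tendsto_gammaFam (hV : IsRollnik V) (hV1 : Integrable V volume) (hκ : 0 < κ) :
    Tendsto (gammaFam hV hκ) (𝓝[>] 0) (𝓝 (gammaLim hV1 κ)) := by
  rw [tendsto_iff_norm_sub_tendsto_zero]
  have h := (Real.continuous_sqrt.tendsto 0).comp (tendsto_integral_yukawaShift hV1 κ)
  rw [Real.sqrt_zero] at h
  refine squeeze_zero' (Eventually.of_forall fun _ => norm_nonneg _) ?_ h
  filter_upwards [self_mem_nhdsWithin] with ε hε
  replace hε : 0 < ε := hε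
  rw [gammaFam, dif_pos hε]
  exact norm_gammaOp_sub_le hV hV1 hκ hε

/-- The resolvents of the form sums `-Δ + a(ε) V(·/ε)`, as a family indexed by all real `ε`. -/
def potResFam (hV : IsRollnik V) (hκ : 0 < κ) (a : ℝ → ℝ) (ε : ℝ) : L2 →L[ℂ] L2 :=
  if hε : 0 < ε then potRes hV hκ hε (a ε) else 0

/-- The Birman-Schwinger operators `1 + a(ε) ε² sign(V) √|V| (-Δ + ε²κ²)⁻¹ √|V|`. -/
def birmanFam (hV : IsRollnik V) (κ : ℝ) (a : ℝ → ℝ) (ε : ℝ) : L2 →L[ℂ] L2 :=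
  1 + ((a ε * ε ^ 2 : ℝ) : ℂ) • (signOp hV.1 ∘L bsOp hV (ε * κ))

theorem tendsto_clm_comp {l : Filter ℝ} {F G : ℝ → L2 →L[ℂ] L2} {F₀ G₀ : L2 →L[ℂ] L2}
    (hF : Tendsto F l (𝓝 F₀)) (hG : Tendsto G l (𝓝 G₀)) :
    Tendsto (fun ε => F ε ∘L G ε) l (𝓝 (F₀ ∘L G₀)) :=
  ((ContinuousLinearMap.compL ℂ L2 L2 L2).isBoundedBilinearMap.continuous.tendsto
    (F₀, G₀)).comp (hF.prodMk_nhds hG)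

/-- The outer factors Γ_ε converge in norm, so the middle factor a ε³ (1 + a ε² s K_{εκ})⁻¹ alone
decides the limit. -/
theorem tendsto_potResFam (hV : IsRollnik V) (hV1 : Integrable V volume) (hκ : 0 < κ)
    {a : ℝ → ℝ} (ha : ∀ᶠ ε in 𝓝[>] 0, 0 ≤ a ε) {L : L2 →L[ℂ] L2}
    (hu : ∀ᶠ ε in 𝓝[>] 0, IsUnit (birmanFam hV κ a ε))
    (hL : Tendsto (fun ε => ((a ε * ε ^ 3 : ℝ) : ℂ) • Ring.inverse (birmanFam hV κ a ε)) (𝓝[>] 0)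
      (𝓝 L)) :
    Tendsto (potResFam hV hκ a) (𝓝[>] 0)
      (𝓝 (freeRes κ - (gammaLim hV1 κ)† ∘L L ∘L signOp hV.1 ∘L gammaLim hV1 κ)) := by
  have hΓ := tendsto_gammaFam hV hV1 hκ
  have hΓ' : Tendsto (fun ε => (gammaFam hV hκ ε)†) (𝓝[>] 0) (𝓝 ((gammaLim hV1 κ)†)) :=
    (ContinuousLinearMap.adjoint.continuous.tendsto _).comp hΓ
  have h := tendsto_clm_comp hΓ' (tendsto_clm_comp hL
    (tendsto_clm_comp (tendsto_const_nhds (x := signOp hV.1)) hΓ))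
  refine (h.const_sub (freeRes κ)).congr' ?_
  filter_upwards [self_mem_nhdsWithin, ha, hu] with ε hε ha hu
  replace hε : 0 < ε := hε
  rw [birmanFam, ← birmanOp_potEmb hV hκ hε ha] at hu
  rw [potResFam, dif_pos hε, potRes_eq_sub hV hκ hε ha hu, gammaFam, dif_pos hε, birmanFam,
    ← birmanOp_potEmb hV hκ hε ha]
  rw [ContinuousLinearMap.smul_comp, ContinuousLinearMap.comp_smul]

theorem eventually_potResFam (hV : IsRollnik V) (hκ : 0 < κ)
    {a : ℝ → ℝ} (ha : ∀ᶠ ε in 𝓝[>] 0, 0 ≤ a ε)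
    (hu : ∀ᶠ ε in 𝓝[>] 0, IsUnit (birmanFam hV κ a ε)) {R : L2 →L[ℂ] L2}
    (hR : Tendsto (potResFam hV hκ a) (𝓝[>] 0) (𝓝 R)) :
    ∀ᶠ ε in 𝓝[>] 0, IsSelfAdjoint (potResFam hV hκ a ε) ∧
      Function.Injective (potResFam hV hκ a ε) ∧ ‖potResFam hV hκ a ε‖ ≤ ‖R‖ + 1 ∧
      formSumGraph (fun x => a ε * V (ε⁻¹ • x)) = resolventGraph κ (potResFam hV hκ a ε) := by
  have hn := hR.norm.eventually (eventually_le_nhds (lt_add_one ‖R‖))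
  filter_upwards [self_mem_nhdsWithin, ha, hu, hn] with ε hε ha hu hn
  replace hε : 0 < ε := hε
  rw [birmanFam, ← birmanOp_potEmb hV hκ hε ha] at hu
  have hu' := (isUnit_formOp_of_isUnit_birmanOp hu).1
  refine ⟨?_, ?_, hn, ?_⟩ <;> rw [potResFam, dif_pos hε]
  · exact isSelfAdjoint_potRes hV hκ hε _
  · exact injective_potRes hV hκ hε hu'
  · exact formSumGraph_eq_potRes hV hκ hε ha hu'

theorem tendsto_mul_const_nhdsGT (hκ : 0 < κ) :
    Tendsto (fun ε : ℝ => ε * κ) (𝓝[>] 0) (𝓝[>] 0) := by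
  refine tendsto_nhdsWithin_iff.2 ⟨?_, ?_⟩
  · have h : Continuous fun ε : ℝ => ε * κ := by fun_prop
    have := (h.tendsto 0).mono_left (nhdsWithin_le_nhds (s := Ioi 0))
    simpa using this
  · filter_upwards [self_mem_nhdsWithin] with ε hε
    exact mul_pos hε hκ

/-- Norm resolvent convergence to the free Laplacian in the absence of a zero-energy
obstruction. -/
theorem tendsto_potResFam_free (hV : IsRollnik V) (hV1 : Integrable V volume) (hκ : 0 < κ)
    {a : ℝ → ℝ} (ha : ∀ᶠ ε in 𝓝[>] 0, 0 ≤ a ε) {b : ℝ}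
    (hb : Tendsto (fun ε => a ε * ε ^ 2) (𝓝[>] 0) (𝓝 b))
    (hu₀ : IsUnit (1 + (b : ℂ) • (signOp hV.1 ∘L bsOp hV 0))) :
    (∀ᶠ ε in 𝓝[>] 0, IsUnit (birmanFam hV κ a ε)) ∧
      Tendsto (potResFam hV hκ a) (𝓝[>] 0) (𝓝 (freeRes κ)) := by
  have h1 : Tendsto (birmanFam hV κ a) (𝓝[>] 0)
      (𝓝 (1 + (b : ℂ) • (signOp hV.1 ∘L bsOp hV 0))) := by
    have h := tendsto_clm_comp (tendsto_const_nhds (x := signOp hV.1))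
      ((tendsto_bsOp_zero hV).comp (tendsto_mul_const_nhdsGT hκ))
    exact (((Complex.continuous_ofReal.tendsto _).comp hb).smul h).const_add _
  have hu : ∀ᶠ ε in 𝓝[>] 0, IsUnit (birmanFam hV κ a ε) :=
    h1.eventually (Units.isOpen.mem_nhds hu₀)
  refine ⟨hu, ?_⟩
  have hinv : Tendsto (fun ε => Ring.inverse (birmanFam hV κ a ε)) (𝓝[>] 0)
      (𝓝 (Ring.inverse (1 + (b : ℂ) • (signOp hV.1 ∘L bsOp hV 0)))) := by
    obtain ⟨U, hU⟩ := hu₀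
    rw [← hU] at h1 ⊢
    exact (NormedRing.inverse_continuousAt U).tendsto.comp h1
  have hε : Tendsto (fun ε : ℝ => ε) (𝓝[>] 0) (𝓝 0) := tendsto_id.mono_left nhdsWithin_le_nhds
  -- There is one more power of ε than in the convergent coupling a ε², so the correction to the
  -- free resolvent vanishes.
  have hcoef : Tendsto (fun ε => ((a ε * ε ^ 3 : ℝ) : ℂ)) (𝓝[>] 0) (𝓝 0) := by
    have h := hb.mul hε
    rw [mul_zero] at h
    have h' := (Complex.continuous_ofReal.tendsto _).comp h
    rw [Complex.ofReal_zero] at h'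
    refine h'.congr fun ε => ?_
    simp only [Function.comp_apply]
    congr 1
    ring
  have hL := hcoef.smul hinv
  rw [zero_smul] at hL
  have := tendsto_potResFam hV hV1 hκ ha hu hL
  rwa [ContinuousLinearMap.zero_comp, ContinuousLinearMap.comp_zero, sub_zero] at this

/-! ### Nonnegative potentials -/

/-- For V ≥ 0 the sign is 1 wherever √|V| is nonzero. The form operator is then 1 + B*B, invertible
without any spectral condition. -/
theorem signOp_comp_potEmb (hV : IsRollnik V) (hV0 : ∀ᵐ x, 0 ≤ V x) (hκ : 0 < κ) {ε : ℝ}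
    (hε : 0 < ε) (a : ℝ) :
    signOp hV.1 ∘L potEmb hV hκ hε a = potEmb hV hκ hε a := by
  rw [potEmb, ContinuousLinearMap.comp_smul]
  congr 1
  ext1 z
  refine Lp.ext ?_
  filter_upwards [hV0, coeFn_signOp hV.1 (scaledEmb hV hκ hε z), coeFn_scaledEmb hV hκ hε z]
    with x h0 h1 h2
  rw [ContinuousLinearMap.comp_apply, h1, h2, ← mul_assoc, ← Complex.ofReal_mul]
  rcases h0.eq_or_lt with h | h
  · simp [absRoot, ← h]
  · rw [Real.sign_of_pos h, one_mul]

theorem formOp_potEmb_of_nonneg (hV : IsRollnik V) (hV0 : ∀ᵐ x, 0 ≤ V x) (hκ : 0 < κ) {ε : ℝ}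
    (hε : 0 < ε) (a : ℝ) :
    formOp (potEmb hV hκ hε a) (signOp hV.1) = formOp (potEmb hV hκ hε a) 1 := by
  unfold formOp
  rw [signOp_comp_potEmb hV hV0]
  rfl

/-- Elements `G h` with `h` orthogonal to the Yukawa kernel are dense in `H¹(ℝ³)`: points have
zero capacity in a weak sense. -/
theorem dense_adjoint_formEmb_orthogonal (hκ : 0 < κ) :
    Dense (((formEmb κ)†) '' {h : L2 | inner ℂ (yukawaLp κ) h = 0}) := by
  set S : Submodule ℂ (formSpace κ) :=
    (ℂ ∙ yukawaLp κ)ᗮ.map (((formEmb κ)†) : L2 →ₗ[ℂ] formSpace κ) with hS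
  have hSeq : (((formEmb κ)†) '' {h : L2 | inner ℂ (yukawaLp κ) h = 0}) = (S : Set _) := by
    rw [hS, Submodule.map_coe]
    congr 1
    ext h
    rw [SetLike.mem_coe, Submodule.mem_orthogonal_singleton_iff_inner_right]
    rfl
  rw [hSeq, Submodule.dense_iff_topologicalClosure_eq_top,
    Submodule.topologicalClosure_eq_top_iff, Submodule.eq_bot_iff]
  intro y hy
  -- For y orthogonal to the set, J y is orthogonal to everything orthogonal to G_κ, hence a
  -- multiple of G_κ; as G_κ is not in H¹, the multiple is zero.
  have h1 : formEmb κ y ∈ (ℂ ∙ yukawaLp κ)ᗮᗮ := by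
    rw [Submodule.mem_orthogonal]
    intro h hh
    rw [Submodule.mem_orthogonal] at hy
    have := hy (((formEmb κ)†) h) ⟨h, hh, rfl⟩
    rwa [ContinuousLinearMap.adjoint_inner_left] at this
  rw [Submodule.orthogonal_orthogonal, Submodule.mem_span_singleton] at h1
  obtain ⟨c, hc⟩ := h1
  by_cases hc0 : c = 0
  · rw [hc0, zero_smul] at hc
    exact (injective_iff_map_eq_zero _).1 (formEmb_injective hκ) y hc.symm
  · exfalso
    refine yukawaLp_ne_formEmb hκ (c⁻¹ • y) ?_
    rw [map_smul, ← hc, smul_smul, inv_mul_cancel₀ hc0, one_smul]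

/-- On the dense set of G h with ⟨G_κ, h⟩ = 0 one has Γ_ε h → 0, and a ε³ is bounded above, so B_ε G
h → 0. The operators (1 + B*B)⁻¹ are contractions, which extends convergence to the identity to all
x. -/
theorem tendsto_inverse_formOp_potEmb (hV : IsRollnik V) (hV1 : Integrable V volume) (hκ : 0 < κ)
    {a : ℝ → ℝ} {C : ℝ} (ha : ∀ᶠ ε in 𝓝[>] 0, a ε * ε ^ 3 ≤ C) (x : formSpace κ)
    {δ : ℝ} (hδ : 0 < δ) :
    ∀ᶠ ε in 𝓝[>] 0, ∀ hε : 0 < ε,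
      ‖x - Ring.inverse (formOp (potEmb hV hκ hε (a ε)) 1) x‖ < δ := by
  obtain ⟨_, ⟨h, hh, rfl⟩, hx⟩ := (dense_adjoint_formEmb_orthogonal hκ).exists_dist_lt x
    (by positivity : 0 < δ / 3)
  have hz : gammaLim hV1 κ h = 0 := by
    have : inner ℂ (yukawaLp κ) h = 0 := hh
    rw [gammaLim, rankOne_apply, this, zero_smul]
  have h1 : Tendsto (fun ε => √C * ‖gammaFam hV hκ ε h‖) (𝓝[>] 0) (𝓝 0) := by
    have h2 := ((ContinuousLinearMap.apply ℂ L2 h).continuous.tendsto _).comp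
      (tendsto_gammaFam hV hV1 hκ)
    have h3 := h2.norm.const_mul √C
    simp only [ContinuousLinearMap.apply_apply, hz, norm_zero, mul_zero] at h3
    exact h3
  filter_upwards [h1.eventually (gt_mem_nhds (by positivity : 0 < δ / 3)), ha] with ε h2 ha hε
  set Q := Ring.inverse (formOp (potEmb hV hκ hε (a ε)) 1) with hQ
  set y := ((formEmb κ)†) h with hy
  have h3 : ‖y - Q y‖ < δ / 3 := by
    refine (norm_sub_inverse_formOp_one_le _ y).trans_lt (lt_of_le_of_lt ?_ h2)
    rw [gammaFam, dif_pos hε, potEmb, smul_apply, norm_smul, Complex.norm_real,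
      Real.norm_of_nonneg (Real.sqrt_nonneg _)]
    exact mul_le_mul_of_nonneg_right (Real.sqrt_le_sqrt ha) (norm_nonneg _)
  have h4 : ‖Q (x - y)‖ ≤ ‖x - y‖ := norm_inverse_formOp_one_le _ _
  rw [dist_eq_norm] at hx
  have e : x - Q x = (x - y) + (y - Q y) - Q (x - y) := by rw [map_sub]; abel
  rw [e]
  calc _ ≤ ‖x - y + (y - Q y)‖ + ‖Q (x - y)‖ := norm_sub_le _ _
    _ ≤ ‖x - y‖ + ‖y - Q y‖ + ‖Q (x - y)‖ := by gcongr; exact norm_add_le _ _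
    _ < δ := by linarith

/-- Strong resolvent convergence to the free Laplacian for nonnegative potentials. -/
theorem tendsto_potResFam_of_nonneg (hV : IsRollnik V) (hV1 : Integrable V volume)
    (hV0 : ∀ᵐ x, 0 ≤ V x) (hκ : 0 < κ) {a : ℝ → ℝ} (ha0 : ∀ᶠ ε in 𝓝[>] 0, 0 ≤ a ε) {C : ℝ}
    (ha : ∀ᶠ ε in 𝓝[>] 0, a ε * ε ^ 3 ≤ C) :
    (∃ M, ∀ᶠ ε in 𝓝[>] 0, IsSelfAdjoint (potResFam hV hκ a ε) ∧
      Function.Injective (potResFam hV hκ a ε) ∧ ‖potResFam hV hκ a ε‖ ≤ M ∧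
      formSumGraph (fun x => a ε * V (ε⁻¹ • x)) = resolventGraph κ (potResFam hV hκ a ε)) ∧
    ∀ h, Tendsto (fun ε => potResFam hV hκ a ε h) (𝓝[>] 0) (𝓝 (freeRes κ h)) := by
  refine ⟨⟨‖formEmb κ‖ * ‖(formEmb κ)†‖, ?_⟩, fun h => ?_⟩
  · filter_upwards [self_mem_nhdsWithin, ha0] with ε hε ha0
    replace hε : 0 < ε := hε
    have hu : IsUnit (formOp (potEmb hV hκ hε (a ε)) (signOp hV.1)) := by
      rw [formOp_potEmb_of_nonneg hV hV0]; exact isUnit_formOp_one _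
    refine ⟨?_, ?_, ?_, ?_⟩ <;> rw [potResFam, dif_pos hε]
    · exact isSelfAdjoint_potRes hV hκ hε _
    · exact injective_potRes hV hκ hε hu
    · refine ContinuousLinearMap.opNorm_le_bound _ (by positivity) fun h => ?_
      rw [potRes, perturbRes_apply, formOp_potEmb_of_nonneg hV hV0]
      calc _ ≤ ‖formEmb κ‖ * ‖Ring.inverse (formOp (potEmb hV hκ hε (a ε)) 1)
            (((formEmb κ)†) h)‖ := (formEmb κ).le_opNorm _
        _ ≤ ‖formEmb κ‖ * ‖((formEmb κ)†) h‖ := by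
          gcongr; exact norm_inverse_formOp_one_le _ _
        _ ≤ ‖formEmb κ‖ * (‖(formEmb κ)†‖ * ‖h‖) := by
          gcongr; exact ContinuousLinearMap.le_opNorm _ _
        _ = _ := by ring
    · exact formSumGraph_eq_potRes hV hκ hε ha0 hu
  · rw [Metric.tendsto_nhds]
    intro δ hδ
    have h1 := tendsto_inverse_formOp_potEmb hV hV1 hκ ha (((formEmb κ)†) h)
      (δ := δ / (‖formEmb κ‖ + 1)) (by positivity)
    filter_upwards [self_mem_nhdsWithin, h1] with ε hε h1
    replace hε : 0 < ε := hε
    rw [dist_comm, dist_eq_norm, potResFam, dif_pos hε, potRes, perturbRes_apply,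
      formOp_potEmb_of_nonneg hV hV0, freeRes_apply, ← map_sub]
    have h2 := h1 hε
    rw [lt_div_iff₀ (by positivity)] at h2
    refine lt_of_le_of_lt (ContinuousLinearMap.le_opNorm _ _) (lt_of_le_of_lt ?_ h2)
    rw [mul_comm]
    gcongr
    linarith


/-! ### Decay of zero-energy solutions -/

variable {V : E3 → ℝ}

/-- As f has zero mass, 1/(4π|x|) can be subtracted from the kernel. Where the defining integral is
undefined its value is 0 and the bound is trivial. -/
theorem norm_newtonPotential_le {f : E3 → ℂ} (hf : Integrable f) (h0 : ∫ y, f y = 0) {x : E3}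
    {h : E3 → ℝ} (hh : Integrable h)
    (hle : ∀ᵐ y, |yukawa 0 (x - y) - yukawa 0 x| * ‖f y‖ ≤ h y) :
    ‖newtonPotential f x‖ ≤ ∫ y, h y := by
  have hnn : 0 ≤ ∫ y, h y := integral_nonneg_of_ae (by
    filter_upwards [hle] with y hy
    exact (by positivity : (0 : ℝ) ≤ _).trans hy)
  unfold newtonPotential
  by_cases hi : Integrable fun y => (((4 * Real.pi * ‖x - y‖)⁻¹ : ℝ) : ℂ) * f y
  · have e : ∫ y, (((4 * Real.pi * ‖x - y‖)⁻¹ : ℝ) : ℂ) * f y =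
        ∫ y, ((yukawa 0 (x - y) - yukawa 0 x : ℝ) : ℂ) * f y := by
      have : ∫ y, (yukawa 0 x : ℂ) * f y = 0 := by rw [integral_const_mul, h0, mul_zero]
      rw [← sub_zero (∫ y, (((4 * Real.pi * ‖x - y‖)⁻¹ : ℝ) : ℂ) * f y), ← this,
        ← integral_sub hi (hf.const_mul _)]
      refine integral_congr_ae (Eventually.of_forall fun y => ?_)
      simp only [yukawa_zero_eq]
      push_cast
      ring
    rw [e]
    refine norm_integral_le_of_norm_le hh ?_
    filter_upwards [hle] with y hy
    rwa [norm_mul, Complex.norm_real, Real.norm_eq_abs]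
  · rw [integral_undef hi, norm_zero]
    exact hnn

theorem abs_inv_sub_inv_le {a b c : ℝ} (ha : 0 < a) (hb : 0 < b) (hc : |a - b| ≤ c) :
    |b⁻¹ - a⁻¹| ≤ c / (a * b) := by
  rw [inv_sub_inv hb.ne' ha.ne', abs_div, abs_of_pos (mul_pos hb ha), mul_comm b a]
  gcongr

/-- With a = |x|, b = |x - y| and c = |y|, the truncated weight min(·, n) passes from x to y under
the difference of Newton kernels, at the cost of an additional 1 and uniformly in n. -/
theorem min_mul_abs_inv_sub_inv_le {a b c n : ℝ} (ha : 0 < a) (hb : 0 < b) (hc : |a - b| ≤ c)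
    (hn : 1 ≤ n) : min a n * |b⁻¹ - a⁻¹| ≤ min c n * (b⁻¹ + 1) := by
  have hc0 : 0 ≤ c := (abs_nonneg _).trans hc
  have hm : 0 ≤ min a n := le_min ha.le (by linarith)
  rcases le_total c n with h | h
  · rw [min_eq_left h]
    calc min a n * |b⁻¹ - a⁻¹| ≤ a * (c / (a * b)) := by
          gcongr
          · exact min_le_left _ _
          · exact abs_inv_sub_inv_le ha hb hc
      _ = c * b⁻¹ := by field_simp
      _ ≤ c * (b⁻¹ + 1) := by gcongr; linarith
  · rw [min_eq_right h]
    have h1 : |b⁻¹ - a⁻¹| ≤ b⁻¹ + a⁻¹ := by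
      refine (abs_sub _ _).trans (le_of_eq ?_)
      rw [abs_of_pos (inv_pos.2 hb), abs_of_pos (inv_pos.2 ha)]
    have h2 : min a n * b⁻¹ ≤ n * b⁻¹ := by gcongr; exact min_le_right _ _
    have h3 : min a n * a⁻¹ ≤ 1 := by
      rw [← div_eq_mul_inv, div_le_one ha]; exact min_le_left _ _
    nlinarith [mul_le_mul_of_nonneg_left h1 hm]

/-- Solutions of a Hilbert-Schmidt integral inequality that is stable under truncated linear
weights decay linearly. -/
theorem memLp_norm_mul_of_le_integral {k : E3 × E3 → ℝ}
    (hk : MemLp (fun p => (k p : ℂ)) 2 (volume.prod volume)) (hk0 : ∀ p, 0 ≤ k p) {φ : L2}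
    (h : ∀ n : ℕ, 1 ≤ n →
      ∀ᵐ x, min ‖x‖ n * ‖φ x‖ ≤ ∫ y, k (x, y) * (min ‖y‖ n * ‖φ y‖)) :
    MemLp (fun x => ((‖x‖ * ‖φ x‖ : ℝ) : ℂ)) 2 volume := by
  -- The part of the kernel with |y| > ρ has small norm for large ρ and can be absorbed; on |y| ≤ ρ
  -- the weight is at most ρ.
  have hkr (ρ : ℝ) : MemLp ({p : E3 × E3 | ρ < ‖p.2‖}.indicator fun p => (k p : ℂ)) 2
      (volume.prod volume) :=
    hk.indicator (measurableSet_lt measurable_const measurable_snd.norm)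
  have hz : MemLp (fun _ : E3 × E3 => (0 : ℂ)) 2 (volume.prod volume) := MemLp.zero'
  have hlim := tendsto_intOp_of_dominated (l := atTop) (F := k) hkr hz
    (by simpa using (memLp_two_iff_integrable_sq_norm hk.1).1 hk)
    (Eventually.of_forall fun ρ => Eventually.of_forall fun p =>
      (norm_indicator_le_norm_self _ _).trans (by
        rw [Complex.norm_real, Real.norm_of_nonneg (hk0 p)]))
    (Eventually.of_forall fun p => by simpa using hk0 p)
    (Eventually.of_forall fun p => by
      refine tendsto_const_nhds.congr' ?_
      filter_upwards [eventually_ge_atTop ‖p.2‖] with ρ hρ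
      rw [indicator_of_notMem]
      simpa using hρ)
  have h0 : hz.toLp _ = 0 := MemLp.toLp_zero hz
  rw [h0, map_zero] at hlim
  obtain ⟨ρ, hρ, hρ0⟩ := ((hlim.norm.eventually (gt_mem_nhds
    (by rw [norm_zero]; norm_num : ‖(0 : L2 →L[ℂ] L2)‖ < 1 / 2))).and (eventually_ge_atTop 0)).exists
  set K := intOp (hk.toLp _) with hK
  set Kr := intOp ((hkr ρ).toLp _) with hKr
  have hb : MemLp (fun x => ((‖φ x‖ : ℝ) : ℂ)) 2 volume := (Lp.memLp φ).norm.ofReal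
  have ha (n : ℕ) : MemLp (fun x : E3 => ((min ‖x‖ n * ‖φ x‖ : ℝ) : ℂ)) 2 volume := by
    have := memLp_two_bdd_mul (m := fun x : E3 => ((min ‖x‖ n : ℝ) : ℂ)) (C := n)
      (by
        have : Continuous fun x : E3 => ((min ‖x‖ n : ℝ) : ℂ) := by fun_prop
        exact this.aestronglyMeasurable)
      (Eventually.of_forall fun x => by
        rw [Complex.norm_real, Real.norm_of_nonneg (by positivity)]; exact min_le_right _ _) hb
    simpa only [Complex.ofReal_mul] using this
  -- From ‖A‖ ≤ ‖A‖/2 + ρ‖K‖‖B‖, where ‖A‖ is finite because the weight is truncated. The bound is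
  -- independent of n, as Fatou's lemma requires.
  have hbound (n : ℕ) (hn : 1 ≤ n) : ‖(ha n).toLp _‖ ≤ 2 * (ρ * (‖K‖ * ‖hb.toLp _‖)) := by
    set A := (ha n).toLp _ with hA
    set B := hb.toLp _ with hB
    have h1 : ‖A‖ ≤ 1 * ‖Kr A + (ρ : ℂ) • K B‖ := by
      refine L2_norm_le_of_ae_le ?_
      filter_upwards [h n hn, (ha n).coeFn_toLp, Lp.coeFn_add (Kr A) ((ρ : ℂ) • K B),
        Lp.coeFn_smul (ρ : ℂ) (K B), coeFn_intOp_toLp (hkr ρ) A, coeFn_intOp_toLp hk B,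
        ae_memLp_section hk, ae_memLp_section (hkr ρ)] with x hx h1 h2 h3 h4 h5 h6 h7
      have i1 : Integrable fun y => (k (x, y) : ℂ) * A y := integrable_kernel_mul h6 (Lp.memLp A)
      have i2 : Integrable fun y => (k (x, y) : ℂ) * B y := integrable_kernel_mul h6 (Lp.memLp B)
      have i3 : Integrable fun y => {p : E3 × E3 | ρ < ‖p.2‖}.indicator (fun p => (k p : ℂ)) (x, y)
          * A y := integrable_kernel_mul h7 (Lp.memLp A)
      rw [h2, Pi.add_apply, h3, Pi.smul_apply, h4, h5, smul_eq_mul, ← integral_const_mul,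
        ← integral_add i3 (i2.const_mul _), one_mul]
      refine le_trans ?_ (Complex.re_le_norm _)
      rw [h1, Complex.norm_real, Real.norm_of_nonneg (by positivity)]
      refine hx.trans ?_
      have e : ∫ y, k (x, y) * (min ‖y‖ n * ‖φ y‖) = (∫ y, (k (x, y) : ℂ) * A y).re := by
        rw [← Complex.ofReal_re (∫ y, k (x, y) * (min ‖y‖ n * ‖φ y‖)), ← integral_complex_ofReal]
        congr 1
        refine integral_congr_ae ?_
        filter_upwards [(ha n).coeFn_toLp] with y hy
        rw [hA, hy]
        push_cast
        rfl
      rw [e]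
      have hre {f : E3 → ℂ} (hf : Integrable f) : (∫ y, f y).re = ∫ y, (f y).re :=
        (integral_re hf).symm
      have i4 : Integrable fun y => {p : E3 × E3 | ρ < ‖p.2‖}.indicator (fun p => (k p : ℂ)) (x, y)
          * A y + (ρ : ℂ) * ((k (x, y) : ℂ) * B y) := i3.add (i2.const_mul _)
      rw [hre i1, hre i4]
      refine integral_mono_ae i1.re i4.re ?_
      filter_upwards [(ha n).coeFn_toLp, hb.coeFn_toLp] with y hy hy'
      change ((k (x, y) : ℂ) * A y).re ≤ ({p : E3 × E3 | ρ < ‖p.2‖}.indicator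
        (fun p => (k p : ℂ)) (x, y) * A y + (ρ : ℂ) * ((k (x, y) : ℂ) * B y)).re
      rw [hA, hB, hy, hy']
      have hk0' := hk0 (x, y)
      by_cases hlt : ρ < ‖y‖
      · rw [indicator_of_mem (by simpa using hlt)]
        simp only [← Complex.ofReal_mul, ← Complex.ofReal_add, Complex.ofReal_re]
        have : 0 ≤ ρ * (k (x, y) * ‖φ y‖) := by positivity
        linarith
      · rw [indicator_of_notMem (by simpa using hlt)]
        simp only [← Complex.ofReal_mul, Complex.ofReal_re, zero_mul, zero_add]
        have : min ‖y‖ n ≤ ρ := (min_le_left _ _).trans (not_lt.1 hlt)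
        calc k (x, y) * (min ‖y‖ n * ‖φ y‖) ≤ k (x, y) * (ρ * ‖φ y‖) := by gcongr
          _ = _ := by ring
    have h2 : ‖Kr A‖ ≤ 1 / 2 * ‖A‖ := Kr.le_of_opNorm_le hρ.le A
    have h3 : ‖(ρ : ℂ) • K B‖ ≤ ρ * (‖K‖ * ‖B‖) := by
      rw [norm_smul, Complex.norm_real, Real.norm_of_nonneg hρ0]
      gcongr
      exact K.le_opNorm B
    have h4 := norm_add_le (Kr A) ((ρ : ℂ) • K B)
    linarith
  refine ⟨?_, ?_⟩
  · exact Complex.continuous_ofReal.comp_aestronglyMeasurable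
      (continuous_norm.aestronglyMeasurable.mul (Lp.aestronglyMeasurable φ).norm)
  · refine lt_of_le_of_lt (Lp.eLpNorm_lim_le_liminf_eLpNorm (fun n => (ha n).1) _
      (Eventually.of_forall fun x => ?_)) (lt_of_le_of_lt (liminf_le_of_frequently_le'
        (x := ENNReal.ofReal (2 * (ρ * (‖K‖ * ‖hb.toLp _‖)))) ?_) ENNReal.ofReal_lt_top)
    · refine tendsto_const_nhds.congr' ?_
      obtain ⟨N, hN⟩ := exists_nat_ge ‖x‖
      filter_upwards [eventually_ge_atTop N] with n hn
      rw [min_eq_left (hN.trans (by exact_mod_cast hn))]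
    · refine Eventually.frequently ?_
      filter_upwards [eventually_ge_atTop 1] with n hn
      have := hbound n hn
      rw [Lp.norm_toLp] at this
      exact (ENNReal.le_ofReal_iff_toReal_le (ha n).2.ne (by positivity)).2 this

theorem integrable_inv_quartic : Integrable fun x : E3 => 2 / (‖x‖ ^ 2 * (1 + ‖x‖ ^ 2)) := by
  refine (integrable_radial_iff fun r => 2 / (r ^ 2 * (1 + r ^ 2))).2 ?_
  refine ((integrable_inv_one_add_sq.const_mul 2).integrableOn (s := Ioi 0)).congr_fun
    (fun r hr => ?_) measurableSet_Ioi
  have hr' : (0 : ℝ) < r := hr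
  field_simp

/-- With a = |x|² and b = |x - y|² this separates the two factors: 2/(|z|²(1 + |z|²)) is integrable
in three dimensions, at the origin and at infinity. -/
theorem inv_mul_le_of_one_le {a b : ℝ} (ha : 1 ≤ a) (hb : 0 < b) :
    (a * b)⁻¹ ≤ 2 / (a * (1 + a)) + 2 / (b * (1 + b)) := by
  have ha0 : 0 < a := by linarith
  have h1 : 0 ≤ 2 / (a * (1 + a)) := by positivity
  have h2 : 0 ≤ 2 / (b * (1 + b)) := by positivity
  rcases le_total b 1 with h | h
  · have : (a * b)⁻¹ ≤ 2 / (b * (1 + b)) := by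
      rw [inv_eq_one_div, div_le_div_iff₀ (by positivity) (by positivity)]
      nlinarith
    linarith
  · rcases le_total a b with hab | hab
    · have : (a * b)⁻¹ ≤ 2 / (a * (1 + a)) := by
        rw [inv_eq_one_div, div_le_div_iff₀ (by positivity) (by positivity)]
        nlinarith
      linarith
    · have : (a * b)⁻¹ ≤ 2 / (b * (1 + b)) := by
        rw [inv_eq_one_div, div_le_div_iff₀ (by positivity) (by positivity)]
        nlinarith
      linarith

/-- The Newton potential of a density of zero total mass and finite first moment is square
integrable at infinity. -/
theorem memLp_newtonPotential_compl_ball {f : E3 → ℂ} (hf : Integrable f) (h0 : ∫ y, f y = 0)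
    (hf1 : Integrable fun y => ‖y‖ * ‖f y‖)
    (hm : AEStronglyMeasurable (newtonPotential f) volume) :
    MemLp (newtonPotential f) 2 (volume.restrict (Metric.closedBall 0 1)ᶜ) := by
  set g : E3 → ℝ := fun y => ‖y‖ * ‖f y‖ with hg
  have hg0 (y : E3) : 0 ≤ g y := by positivity
  have hs : MemLp (fun y => ((√(g y) : ℝ) : ℂ)) 2 volume := by
    refine memLp_two_of_integral (Complex.continuous_ofReal.comp_aestronglyMeasurable
      (Real.continuous_sqrt.comp_aestronglyMeasurable hf1.1)) (hf1.congr
        (Eventually.of_forall fun y => ?_))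
    simp only [Complex.norm_real, Real.norm_eq_abs, sq_abs, Real.sq_sqrt (hg0 y)]
  set S : Set E3 := (Metric.closedBall 0 1)ᶜ with hS
  have hSm : MeasurableSet S := Metric.isClosed_closedBall.measurableSet.compl
  -- The weight g(y) = |y||f(y)| is split as √g · √g: one root makes the kernel square integrable,
  -- the other is the L² function on which it acts.
  set k : E3 × E3 → ℝ := fun p =>
    S.indicator (fun x => (‖x‖)⁻¹) p.1 * (‖p.1 - p.2‖)⁻¹ * √(g p.2) with hk
  have hkm : AEStronglyMeasurable (fun p => (k p : ℂ)) (volume.prod volume) := by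
    refine Complex.continuous_ofReal.comp_aestronglyMeasurable (((Measurable.mul ?_ ?_
      ).aestronglyMeasurable).mul
      (Real.continuous_sqrt.comp_aestronglyMeasurable hf1.1).comp_snd)
    · exact (measurable_norm.inv.indicator hSm).comp measurable_fst
    · exact (measurable_fst.sub measurable_snd).norm.inv
  have hkL : MemLp (fun p => (k p : ℂ)) 2 (volume.prod volume) := by
    refine memLp_two_of_integral hkm ?_
    have j1 : Integrable (fun p : E3 × E3 => 2 / (‖p.1‖ ^ 2 * (1 + ‖p.1‖ ^ 2)) * g p.2)
        (volume.prod volume) := integrable_inv_quartic.mul_prod hf1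
    have j2 := hf1.convolution_integrand (ContinuousLinearMap.mul ℝ ℝ) integrable_inv_quartic
    refine (j1.add j2).mono' (hkm.norm.pow 2) ?_
    filter_upwards [ae_prod_fst_ne_snd] with p hp
    have hb : 0 < ‖p.1 - p.2‖ := norm_pos_iff.2 (sub_ne_zero.2 hp)
    rw [Real.norm_of_nonneg (by positivity), Complex.norm_real, Real.norm_eq_abs, sq_abs]
    simp only [hk, Pi.add_apply, ContinuousLinearMap.mul_apply']
    rw [mul_pow, Real.sq_sqrt (hg0 _), mul_comm (g p.2), ← add_mul]
    have := hg0 p.2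
    refine mul_le_mul_of_nonneg_right ?_ (hg0 _)
    by_cases hx : p.1 ∈ S
    · rw [indicator_of_mem hx]
      have hx' : 1 ≤ ‖p.1‖ := by
        simp only [hS, mem_compl_iff, Metric.mem_closedBall, dist_zero_right, not_le] at hx
        exact hx.le
      refine le_trans (le_of_eq ?_) (inv_mul_le_of_one_le (one_le_pow₀ hx' (n := 2))
        (pow_pos hb 2))
      rw [mul_pow, mul_inv, inv_pow, inv_pow]
    · rw [indicator_of_notMem hx]
      rw [zero_mul, zero_pow two_ne_zero]
      positivity
  have hL := memLp_kernel_integral hkL (hs.toLp _)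
  refine MemLp.mono (hL.restrict S) hm.restrict ?_
  rw [ae_restrict_iff' hSm]
  filter_upwards [ae_memLp_section hkL] with x hx hxS
  have hx1 : 1 < ‖x‖ := by simpa [hS] using hxS
  have i1 : Integrable fun y => (k (x, y) : ℂ) * (hs.toLp _) y :=
    integrable_kernel_mul hx (Lp.memLp _)
  have i2 : Integrable fun y => k (x, y) * √(g y) := by
    refine i1.re.congr ?_
    filter_upwards [hs.coeFn_toLp] with y hy
    rw [hy, ← Complex.ofReal_mul]
    exact Complex.ofReal_re _
  have e : ∫ y, (k (x, y) : ℂ) * (hs.toLp _) y = ((∫ y, k (x, y) * √(g y) : ℝ) : ℂ) := by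
    rw [← integral_complex_ofReal]
    refine integral_congr_ae ?_
    filter_upwards [hs.coeFn_toLp] with y hy
    rw [hy]
    exact (Complex.ofReal_mul _ _).symm
  rw [e, Complex.norm_real]
  refine le_trans ?_ (le_abs_self _)
  refine norm_newtonPotential_le hf h0 i2 ?_
  filter_upwards [Measure.ae_ne volume x] with y hy
  have hb : 0 < ‖x - y‖ := norm_pos_iff.2 (sub_ne_zero.2 hy.symm)
  have ha : 0 < ‖x‖ := by linarith
  have hc : |‖x‖ - ‖x - y‖| ≤ ‖y‖ := by
    simpa using abs_norm_sub_norm_le x (x - y)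
  have h1 := abs_inv_sub_inv_le ha hb hc
  have h2 : |yukawa 0 (x - y) - yukawa 0 x| ≤ |(‖x - y‖)⁻¹ - (‖x‖)⁻¹| := by
    rw [yukawa_zero_eq, yukawa_zero_eq, mul_inv _ ‖x - y‖, mul_inv _ ‖x‖, ← mul_sub, abs_mul,
      abs_of_pos (by positivity)]
    refine mul_le_of_le_one_left (abs_nonneg _) (inv_le_one_of_one_le₀ ?_)
    linarith [Real.pi_gt_three]
  calc |yukawa 0 (x - y) - yukawa 0 x| * ‖f y‖ ≤ ‖y‖ / (‖x‖ * ‖x - y‖) * ‖f y‖ := by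
        gcongr; exact h2.trans h1
    _ = (‖x‖)⁻¹ * (‖x - y‖)⁻¹ * g y := by simp only [hg]; field_simp
    _ = k (x, y) * √(g y) := by
      simp only [hk, indicator_of_mem hxS]
      rw [mul_assoc _ √(g y), Real.mul_self_sqrt (hg0 y)]

theorem IsBirmanSchwingerEigenfunction.norm_le {φ : L2} (h : IsBirmanSchwingerEigenfunction V φ) :
    ∀ᵐ x, ‖φ x‖ ≤ absRoot V x * ‖resonanceFunction V φ x‖ := by
  filter_upwards [h.2] with x hx
  rw [← norm_neg, ← hx, norm_mul, Complex.norm_real, signedRoot, norm_mul, Real.norm_eq_abs,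
    Real.norm_eq_abs, abs_of_nonneg (Real.sqrt_nonneg _)]
  refine mul_le_mul_of_nonneg_right ?_ (norm_nonneg _)
  exact mul_le_of_le_one_right (absRoot_nonneg V x) (abs_sign_le _)

theorem integrable_absRoot_mul (hV1 : Integrable V volume) (φ : L2) :
    Integrable fun y => (absRoot V y : ℂ) * φ y :=
  MemLp.integrable_mul (memLp_absRoot hV1) (Lp.memLp φ)

/-- The eigenfunction is bounded by √|V||ψ|, and for zero charge ψ is an integral against
differences of Newton kernels. The truncated weights pass under the integral at the cost of the
kernel √|V(x)|√|V(y)|/(4π), square integrable since V is in L¹. -/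
theorem memLp_norm_mul_eigenfunction (hV : IsRollnik V) (hV1 : Integrable V volume) {φ : L2}
    (h : IsBirmanSchwingerEigenfunction V φ) (h0 : ∫ y, (absRoot V y : ℂ) * φ y = 0) :
    MemLp (fun x => ((‖x‖ * ‖φ x‖ : ℝ) : ℂ)) 2 volume := by
  have hT := memLp_tensor (memLp_absRoot hV1) (memLp_absRoot hV1)
  have hk : MemLp (fun p : E3 × E3 => ((rollnikKernel V 0 p +
      (4 * Real.pi)⁻¹ * (absRoot V p.1 * absRoot V p.2) : ℝ) : ℂ)) 2 (volume.prod volume) := by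
    have := (memLp_rollnikKernel hV le_rfl).add (hT.const_smul (((4 * Real.pi)⁻¹ : ℝ) : ℂ))
    refine this.ae_eq (Eventually.of_forall fun p => ?_)
    simp
  have hv := absRoot_nonneg V
  refine memLp_norm_mul_of_le_integral hk
    (fun p => add_nonneg (rollnikKernel_nonneg V 0 p) ?_) fun n hn => ?_
  · exact mul_nonneg (by positivity) (mul_nonneg (hv _) (hv _))
  filter_upwards [h.norm_le, ae_memLp_section hk, Measure.ae_ne volume (0 : E3)] with x hx hkx hx0
  have ha : 0 < ‖x‖ := norm_pos_iff.2 hx0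
  have hn' : (1 : ℝ) ≤ n := by exact_mod_cast hn
  have hmem : MemLp (fun y : E3 => ((min ‖y‖ n * ‖φ y‖ : ℝ) : ℂ)) 2 volume := by
    have := memLp_two_bdd_mul (m := fun x : E3 => ((min ‖x‖ n : ℝ) : ℂ)) (C := n)
      (by
        have : Continuous fun x : E3 => ((min ‖x‖ n : ℝ) : ℂ) := by fun_prop
        exact this.aestronglyMeasurable)
      (Eventually.of_forall fun x => by
        rw [Complex.norm_real, Real.norm_of_nonneg (by positivity)]; exact min_le_right _ _)
      ((Lp.memLp φ).norm.ofReal (K := ℂ))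
    refine this.ae_eq (Eventually.of_forall fun y => ?_)
    simp
  have hi : Integrable fun y => (rollnikKernel V 0 (x, y) +
      (4 * Real.pi)⁻¹ * (absRoot V x * absRoot V y)) * (min ‖y‖ n * ‖φ y‖) := by
    refine (integrable_kernel_mul hkx hmem).re.congr (Eventually.of_forall fun y => ?_)
    simp only [← Complex.ofReal_mul]
    exact Complex.ofReal_re _
  rcases (hv x).eq_or_lt with hvx | hvx
  · have : ‖φ x‖ = 0 := by
      rw [← hvx, zero_mul] at hx
      exact le_antisymm hx (norm_nonneg _)
    rw [this, mul_zero]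
    refine integral_nonneg fun y => ?_
    have := rollnikKernel_nonneg V 0 (x, y)
    have := hv y
    have := hv x
    positivity
  · have hc : 0 < min ‖x‖ (n : ℝ) * absRoot V x := by
      have : 0 < min ‖x‖ (n : ℝ) := lt_min ha (by linarith)
      positivity
    have key := norm_newtonPotential_le (integrable_absRoot_mul hV1 φ) h0 (x := x)
      (hi.const_mul (min ‖x‖ (n : ℝ) * absRoot V x)⁻¹) (by
        filter_upwards [Measure.ae_ne volume x] with y hy
        have hb : 0 < ‖x - y‖ := norm_pos_iff.2 (sub_ne_zero.2 hy.symm)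
        have hxy : |‖x‖ - ‖x - y‖| ≤ ‖y‖ := by simpa using abs_norm_sub_norm_le x (x - y)
        have h1 := min_mul_abs_inv_sub_inv_le ha hb hxy hn'
        rw [← div_eq_inv_mul, le_div_iff₀ hc, norm_mul, Complex.norm_real,
          Real.norm_of_nonneg (hv y), yukawa_zero_eq, yukawa_zero_eq, mul_inv _ ‖x - y‖,
          mul_inv _ ‖x‖, ← mul_sub, abs_mul, abs_of_pos (by positivity : 0 < (4 * Real.pi)⁻¹)]
        have e : rollnikKernel V 0 (x, y) = (4 * Real.pi)⁻¹ * (absRoot V x * absRoot V y) *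
            (‖x - y‖)⁻¹ := by
          simp only [rollnikKernel, yukawa_zero_eq, mul_inv]; ring
        rw [e]
        have hvy := hv y
        have h2 := mul_le_mul_of_nonneg_left h1 (by positivity :
          0 ≤ (4 * Real.pi)⁻¹ * (absRoot V x * absRoot V y) * ‖φ y‖)
        nlinarith)
    rw [integral_const_mul, ← div_eq_inv_mul, le_div_iff₀ hc] at key
    refine le_trans ?_ key
    calc min ‖x‖ ↑n * ‖φ x‖ ≤ min ‖x‖ ↑n * (absRoot V x * ‖resonanceFunction V φ x‖) := by
          gcongr
      _ = ‖resonanceFunction V φ x‖ * (min ‖x‖ ↑n * absRoot V x) := by ring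

/-- A zero-energy solution that is not square integrable has nonzero total charge. -/
theorem IsSimpleResonance.integral_ne_zero (hV : IsRollnik V) (hV1 : Integrable V volume) {φ : L2}
    (h : IsSimpleResonance V φ) : ∫ y, (absRoot V y : ℂ) * φ y ≠ 0 := by
  intro h0
  refine h.not_L2 ?_
  have hd := memLp_norm_mul_eigenfunction hV hV1 h.eigen h0
  -- The density √|V| φ has a finite first moment, being √|V| times |y|φ up to modulus, a product of
  -- two L² functions.
  have hf1 : Integrable fun y => ‖y‖ * ‖(absRoot V y : ℂ) * φ y‖ := by
    refine (MemLp.integrable_mul (memLp_absRoot hV1) hd).norm.congr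
      (Eventually.of_forall fun y => ?_)
    simp only [Pi.mul_apply, norm_mul, Complex.norm_real, norm_norm]
    ring
  have hf := integrable_absRoot_mul hV1 φ
  have hm : AEStronglyMeasurable (resonanceFunction V φ) volume := by
    unfold resonanceFunction newtonPotential
    refine AEStronglyMeasurable.integral_prod_right'
      (f := fun p : E3 × E3 => (((4 * Real.pi * ‖p.1 - p.2‖)⁻¹ : ℝ) : ℂ) *
        ((absRoot V p.2 : ℂ) * φ p.2)) (AEStronglyMeasurable.mul ?_ hf.1.comp_snd)
    exact (Complex.measurable_ofReal.comp (by fun_prop)).aestronglyMeasurable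
  have h1 := memLp_newtonPotential_compl_ball hf h0 hf1 hm
  have h2 := h.locally_L2 _ (isCompact_closedBall (0 : E3) 1)
  have i1 := (memLp_two_iff_integrable_sq_norm h1.1).1 h1
  have i2 := (memLp_two_iff_integrable_sq_norm h2.1).1 h2
  refine memLp_two_of_integral hm ?_
  exact IntegrableOn.integrable_of_ae_notMem_eq_zero
    (s := Metric.closedBall 0 1 ∪ (Metric.closedBall 0 1)ᶜ) (IntegrableOn.union i2 i1)
    (Eventually.of_forall fun x hx => by simp at hx)


/-! ### Zero-energy resonances and the limit Hamiltonian -/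

open scoped InnerProduct

variable {V : E3 → ℝ} {κ : ℝ}

theorem coeFn_signOp_bsOp_zero (hV : IsRollnik V) (φ : L2) :
    signOp hV.1 (bsOp hV 0 φ) =ᵐ[volume] fun x =>
      (signedRoot V x : ℂ) * resonanceFunction V φ x := by
  filter_upwards [coeFn_signOp hV.1 (bsOp hV 0 φ), coeFn_bsOp hV le_rfl φ] with x h1 h2
  rw [h1, h2]
  simp only [yukawa_zero_eq, signedRoot, absRoot, resonanceFunction, newtonPotential]
  push_cast
  ring

theorem isBirmanSchwingerEigenfunction_iff (hV : IsRollnik V) (φ : L2) :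
    IsBirmanSchwingerEigenfunction V φ ↔ φ ≠ 0 ∧ φ + signOp hV.1 (bsOp hV 0 φ) = 0 := by
  refine and_congr_right fun _ => ⟨fun h => ?_, fun h => ?_⟩
  · rw [add_comm, ← eq_neg_iff_add_eq_zero]
    refine Lp.ext ?_
    filter_upwards [h, coeFn_signOp_bsOp_zero hV φ, Lp.coeFn_neg φ] with x h1 h2 h3
    rw [h2, h1, h3, Pi.neg_apply]
  · rw [add_comm, ← eq_neg_iff_add_eq_zero] at h
    filter_upwards [coeFn_signOp_bsOp_zero hV φ, Lp.coeFn_neg φ] with x h2 h3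
    rw [← h2, h, h3, Pi.neg_apply]

theorem isUnit_one_add_of_forall_not_eigenfunction (hV : IsRollnik V)
    (h : ¬ ∃ φ : L2, IsBirmanSchwingerEigenfunction V φ) :
    IsUnit (1 + signOp hV.1 ∘L bsOp hV 0) := by
  refine isUnit_one_add_of_isCompactOperator ((isCompactOperator_bsOp hV 0).clm_comp _)
    fun x hx => ?_
  by_contra hx0
  exact h ⟨x, (isBirmanSchwingerEigenfunction_iff hV x).2 ⟨hx0, hx⟩⟩

theorem signOp_signOp_eq (hV : AEStronglyMeasurable V volume) {f : L2} {g : E3 → ℂ}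
    (hf : f =ᵐ[volume] fun x => (absRoot V x : ℂ) * g x) : signOp hV (signOp hV f) = f := by
  refine Lp.ext ?_
  filter_upwards [coeFn_signOp hV f, coeFn_signOp hV (signOp hV f), hf] with x h1 h2 h3
  rw [h2, h1, h3, ← mul_assoc, ← mul_assoc]
  congr 1
  rw [mul_assoc]
  exact_mod_cast sign_mul_sign_mul_absRoot V x

theorem inner_signOp (hV : AEStronglyMeasurable V volume) (f g : L2) :
    inner ℂ (signOp hV f) g = inner ℂ f (signOp hV g) :=
  (isSelfAdjoint_signOp hV).isSymmetric f g

theorem adjoint_rankOne (x y : L2) : (rankOne x y)† = rankOne y x := by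
  symm
  rw [ContinuousLinearMap.eq_adjoint_iff]
  intro z w
  rw [rankOne_apply, rankOne_apply, inner_smul_left, inner_smul_right, inner_conj_symm, mul_comm]

theorem inner_absRootLp (hV1 : Integrable V volume) (φ : L2) :
    inner ℂ (absRootLp hV1) φ = ∫ y, (absRoot V y : ℂ) * φ y := by
  rw [L2_inner_eq]
  refine integral_congr_ae ?_
  filter_upwards [coeFn_absRootLp hV1] with y hy
  rw [hy, Complex.conj_ofReal]

/-- With u = √|V| sign V, the eigenvalue equation gives Vψ = √|V| uψ = -√|V| φ. -/
theorem integral_mul_resonanceFunction (hV1 : Integrable V volume) {φ : L2}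
    (h : IsBirmanSchwingerEigenfunction V φ) :
    ∫ x, (V x : ℂ) * resonanceFunction V φ x = -inner ℂ (absRootLp hV1) φ := by
  rw [inner_absRootLp, ← integral_neg]
  refine integral_congr_ae ?_
  filter_upwards [h.2] with x hx
  have e : V x = absRoot V x * signedRoot V x := by
    rw [signedRoot, ← mul_assoc, ← absRoot, ← sq, absRoot_sq, mul_comm, sign_mul_abs]
  rw [← mul_neg, ← hx, ← mul_assoc, ← Complex.ofReal_mul, ← e]

theorem inner_signOp_self (hV : AEStronglyMeasurable V volume) (φ : L2) :
    inner ℂ (signOp hV φ) φ = ((∫ x, Real.sign (V x) * ‖φ x‖ ^ 2 : ℝ) : ℂ) := by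
  rw [inner_signOp, L2_inner_eq, ← integral_complex_ofReal]
  refine integral_congr_ae ?_
  filter_upwards [coeFn_signOp hV φ] with x hx
  rw [hx, mul_left_comm, ← Complex.normSq_eq_conj_mul_self, Complex.normSq_eq_norm_sq]
  push_cast
  rfl

/-- First order expansion of the Birman-Schwinger operators of the critical scaling. -/
theorem tendsto_birmanFam_quotient (hV : IsRollnik V) (hV1 : Integrable V volume) (hκ : 0 < κ)
    {a : ℝ → ℝ} {β : ℝ}
    (hb : Tendsto (fun ε => ε⁻¹ * (a ε * ε ^ 2 - 1)) (𝓝[>] 0) (𝓝 β)) :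
    Tendsto (fun ε : ℝ => ((ε⁻¹ : ℝ) : ℂ) • (birmanFam hV κ a ε - (1 + signOp hV.1 ∘L bsOp hV 0)))
      (𝓝[>] 0) (𝓝 ((β : ℂ) • (signOp hV.1 ∘L bsOp hV 0) - ((κ / (4 * Real.pi) : ℝ) : ℂ) •
        (signOp hV.1 ∘L rankOne (absRootLp hV1) (absRootLp hV1)))) := by
  have hm := tendsto_mul_const_nhdsGT hκ
  have h1 := ((Complex.continuous_ofReal.tendsto _).comp hb).smul
    (tendsto_clm_comp (tendsto_const_nhds (x := signOp hV.1)) ((tendsto_bsOp_zero hV).comp hm))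
  have h2 := (tendsto_clm_comp (tendsto_const_nhds (x := signOp hV.1))
    ((tendsto_bsOp_quotient hV hV1).comp hm)).const_smul (κ : ℂ)
  have h3 := h1.add h2
  have e : (β : ℂ) • (signOp hV.1 ∘L bsOp hV 0) + (κ : ℂ) • (signOp hV.1 ∘L
      (((-(4 * Real.pi)⁻¹ : ℝ) : ℂ) • rankOne (absRootLp hV1) (absRootLp hV1))) =
      (β : ℂ) • (signOp hV.1 ∘L bsOp hV 0) - ((κ / (4 * Real.pi) : ℝ) : ℂ) •
        (signOp hV.1 ∘L rankOne (absRootLp hV1) (absRootLp hV1)) := by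
    rw [ContinuousLinearMap.comp_smul, smul_smul, sub_eq_add_neg, ← neg_smul]
    congr 2
    push_cast
    ring
  rw [e] at h3
  refine h3.congr' ?_
  filter_upwards [self_mem_nhdsWithin] with ε hε
  have hε0 : (ε : ℂ) ≠ 0 := by exact_mod_cast (ne_of_gt hε : ε ≠ 0)
  have hκ0 : (κ : ℂ) ≠ 0 := by exact_mod_cast hκ.ne'
  simp only [Function.comp_apply, birmanFam]
  rw [ContinuousLinearMap.comp_smul, ContinuousLinearMap.comp_sub, smul_smul]
  push_cast
  rw [show (κ : ℂ) * ((ε : ℂ) * κ)⁻¹ = (ε : ℂ)⁻¹ by field_simp]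
  module

theorem tendsto_potResFam_resonance (hV : IsRollnik V) (hV1 : Integrable V volume) (hκ : 0 < κ)
    {a : ℝ → ℝ} (ha : ∀ᶠ ε in 𝓝[>] 0, 0 ≤ a ε) {β : ℝ}
    (hb : Tendsto (fun ε => a ε * ε ^ 2) (𝓝[>] 0) (𝓝 1))
    (hb' : Tendsto (fun ε => ε⁻¹ * (a ε * ε ^ 2 - 1)) (𝓝[>] 0) (𝓝 β))
    {φ : L2} (hφ : IsSimpleResonance V φ) (hnorm : ∫ x, Real.sign (V x) * ‖φ x‖ ^ 2 = -1)
    (hακ : -β / ‖∫ x, (V x : ℂ) * resonanceFunction V φ x‖ ^ 2 + κ / (4 * Real.pi) ≠ 0) :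
    (∀ᶠ ε in 𝓝[>] 0, IsUnit (birmanFam hV κ a ε)) ∧
      Tendsto (potResFam hV hκ a) (𝓝[>] 0)
        (𝓝 (pointRes (-β / ‖∫ x, (V x : ℂ) * resonanceFunction V φ x‖ ^ 2) κ)) := by
  set s := signOp hV.1 with hs
  set K := bsOp hV 0 with hK
  set r := absRootLp hV1 with hr
  set c := inner ℂ r φ with hc
  set χ := s φ with hχ
  have hc0 : c ≠ 0 := by
    rw [hc, inner_absRootLp]; exact hφ.integral_ne_zero hV hV1
  rw [integral_mul_resonanceFunction hV1 hφ.eigen, norm_neg, ← hr, ← hc] at hακ ⊢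
  have hcn : ‖c‖ ^ 2 ≠ 0 := by positivity
  have heig : φ + s (K φ) = 0 := ((isBirmanSchwingerEigenfunction_iff hV φ).1 hφ.eigen).2
  have hssK (x : L2) : s (s (K x)) = K x := signOp_signOp_eq hV.1 (coeFn_bsOp hV le_rfl x)
  have hssr : s (s r) = r := signOp_signOp_eq hV.1 (g := fun _ => 1) (by
    simpa using coeFn_absRootLp hV1)
  have hsφ : s φ + K φ = 0 := by rw [← hssK φ, ← map_add, heig, map_zero]
  -- The left null vector is χ = sφ: applying s to φ + sKφ = 0 gives χ + Kφ = 0, while ⟨χ, sKx⟩ =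
  -- ⟨φ, Kx⟩ = ⟨Kφ, x⟩.
  have hχC (x : L2) : inner ℂ χ (x + (s ∘L K) x) = 0 := by
    have h1 : inner ℂ (K φ) x = inner ℂ φ (K x) := (isSelfAdjoint_bsOp hV 0).isSymmetric φ x
    rw [inner_add_right, ContinuousLinearMap.comp_apply, hχ, inner_signOp _ φ (s (K x)), hssK,
      ← h1, ← inner_add_left, hsφ, inner_zero_left]
  have hχφ : inner ℂ χ φ = -1 := by
    rw [hχ, hs, inner_signOp_self, hnorm]; simp
  have hχr : inner ℂ χ (s r) = conj c := by
    rw [hχ, inner_signOp, hssr, hc, inner_conj_symm]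
  have hT := tendsto_birmanFam_quotient hV hV1 hκ hb'
  have hcc : conj c * c = ((‖c‖ ^ 2 : ℝ) : ℂ) := by
    rw [← Complex.normSq_eq_conj_mul_self, Complex.normSq_eq_norm_sq]
  -- As sKφ = -φ and ⟨χ, φ⟩ = -1, the amplitude contributes β; the energy shift contributes
  -- -κ|c|²/(4π).
  have hm : inner ℂ χ (((β : ℂ) • (s ∘L K) - ((κ / (4 * Real.pi) : ℝ) : ℂ) •
      (s ∘L rankOne r r)) φ) = ((β - κ / (4 * Real.pi) * ‖c‖ ^ 2 : ℝ) : ℂ) := by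
    have h1 : s (K φ) = -φ := by rw [add_comm] at heig; exact eq_neg_of_add_eq_zero_left heig
    simp only [sub_apply, smul_apply, ContinuousLinearMap.comp_apply, rankOne_apply, map_smul]
    rw [h1, ← hc, inner_sub_right, inner_smul_right, inner_smul_right, inner_smul_right,
      inner_neg_right, hχφ, hχr, mul_comm c, hcc]
    push_cast
    ring
  have hm0 : β - κ / (4 * Real.pi) * ‖c‖ ^ 2 ≠ 0 := by
    intro h
    apply hακ
    rw [show β = κ / (4 * Real.pi) * ‖c‖ ^ 2 by linarith, neg_div, mul_div_cancel_right₀ _ hcn]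
    ring
  obtain ⟨hu, hlim⟩ := tendsto_smul_inverse_of_simple_kernel
    ((isCompactOperator_bsOp hV 0).clm_comp s) (T := birmanFam hV κ a) (φ := φ) (χ := χ) heig hχC
    (fun x hx => by
      by_cases hx0 : x = 0
      · exact ⟨0, by rw [hx0, zero_smul]⟩
      · exact hφ.simple x ((isBirmanSchwingerEigenfunction_iff hV x).2 ⟨hx0, hx⟩))
    hχφ hT (by rw [hm]; exact_mod_cast hm0)
  refine ⟨hu, ?_⟩
  rw [hm] at hlim
  have hL := ((Complex.continuous_ofReal.tendsto _).comp hb).smul hlim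
  -- Since a ε³ = (a ε²) ε with a ε² → 1, the vanishing prefactor meets the pole of order one.
  have hL' : Tendsto (fun ε => ((a ε * ε ^ 3 : ℝ) : ℂ) • Ring.inverse (birmanFam hV κ a ε))
      (𝓝[>] 0) (𝓝 (((β - κ / (4 * Real.pi) * ‖c‖ ^ 2 : ℝ) : ℂ)⁻¹ • rankOne φ χ)) := by
    rw [Complex.ofReal_one, one_smul] at hL
    refine hL.congr fun ε => ?_
    rw [Function.comp_apply, smul_smul, ← Complex.ofReal_mul]
    congr 2
    ring
  convert tendsto_potResFam hV hV1 hκ ha hu hL' using 2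
  ext1 h
  rw [pointRes_apply, gammaLim, adjoint_rankOne]
  simp only [sub_apply, smul_apply, ContinuousLinearMap.comp_apply, rankOne_apply, map_smul]
  rw [← hs, ← hr, hχr, ← hc, sub_eq_add_neg, ← neg_smul, smul_smul, smul_smul, smul_smul]
  congr 2
  -- With α = -β/|c|² the residue turns into the coefficient (α + κ/(4π))⁻¹ of Krein's formula.
  have e : (-β / ‖c‖ ^ 2 + κ / (4 * Real.pi))⁻¹ =
      -((β - κ / (4 * Real.pi) * ‖c‖ ^ 2)⁻¹ * ‖c‖ ^ 2) := by
    have : -β / ‖c‖ ^ 2 + κ / (4 * Real.pi) = -(β - κ / (4 * Real.pi) * ‖c‖ ^ 2) / ‖c‖ ^ 2 := by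
      rw [eq_div_iff hcn, add_mul, div_mul_cancel₀ _ hcn]; ring
    rw [this, inv_div, div_neg, div_eq_mul_inv]
    ring
  rw [e, Complex.ofReal_neg, Complex.ofReal_mul, ← hcc, Complex.ofReal_inv]
  ring

/-! ### Solutions for the scaled potentials -/

/-- The parameter κ may depend on ε, because the graph of the form sum does not involve it. -/
theorem exists_isUniqueHartreeSolution_formSum {w : E3 → ℝ} (hw : MemLp w ⊤ volume)
    (hV : IsRollnik V) {ε : ℝ} (hε : 0 < ε) {a : ℝ} (ha : 0 ≤ a) (u₀ : L2) :
    ∃ u, IsUniqueHartreeSolution (formSumGraph fun x => a * V (ε⁻¹ • x)) w u₀ u := by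
  obtain ⟨κ, hκ, hu⟩ := exists_isUnit_birmanOp hV hε ha
  have hu' := (isUnit_formOp_of_isUnit_birmanOp hu).1
  rw [formSumGraph_eq_potRes hV hκ hε ha hu']
  exact exists_isUniqueHartreeSolution hw (isSelfAdjoint_potRes hV hκ hε _)
    (injective_potRes hV hκ hε hu') u₀

/-! ### Asymptotics of the amplitude η(ε)/ε^σ. -/

section Scaling

variable {η : ℝ → ℝ} {σ : ℝ}

theorem Icc_mem_nhdsGT : Icc (0 : ℝ) 1 ∈ 𝓝[>] (0 : ℝ) :=
  mem_of_superset (Ioc_mem_nhdsGT one_pos) Ioc_subset_Icc_self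

theorem tendsto_nhdsGT_of_contDiffOn (hη : ContDiffOn ℝ ∞ η (Icc 0 1)) :
    Tendsto η (𝓝[>] 0) (𝓝 (η 0)) := by
  have h := (hη.continuousOn 0 (left_mem_Icc.2 zero_le_one)).tendsto
  exact h.mono_left (nhdsWithin_le_of_mem Icc_mem_nhdsGT)

theorem tendsto_quotient_of_contDiffOn (hη : ContDiffOn ℝ ∞ η (Icc 0 1)) :
    Tendsto (fun ε => ε⁻¹ * (η ε - η 0)) (𝓝[>] 0) (𝓝 (derivWithin η (Icc 0 1) 0)) := by
  have h := ((hη.differentiableOn (by simp)) 0 (left_mem_Icc.2 zero_le_one)).hasDerivWithinAt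
  have h' : HasDerivWithinAt η (derivWithin η (Icc 0 1) 0) (Ioi 0) 0 :=
    h.mono_of_mem_nhdsWithin Icc_mem_nhdsGT
  rw [hasDerivWithinAt_iff_tendsto_slope' (by simp)] at h'
  refine h'.congr fun ε => ?_
  rw [slope_def_field, sub_zero, div_eq_inv_mul]

theorem div_rpow_mul_pow {ε : ℝ} (hε : 0 < ε) (b : ℝ) (n : ℕ) :
    b / ε ^ σ * ε ^ n = b * ε ^ ((n : ℝ) - σ) := by
  rw [Real.rpow_sub hε, Real.rpow_natCast]
  ring

theorem tendsto_rpow_nhdsGT_zero {p : ℝ} (hp : 0 < p) :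
    Tendsto (fun ε : ℝ => ε ^ p) (𝓝[>] 0) (𝓝 0) := by
  have := (Real.continuousAt_rpow_const 0 p (Or.inr hp.le)).tendsto
  rw [Real.zero_rpow hp.ne'] at this
  exact this.mono_left nhdsWithin_le_nhds

theorem eventually_amplitude_nonneg (hη : ∀ ε ∈ Icc (0 : ℝ) 1, 0 ≤ η ε) :
    ∀ᶠ ε in 𝓝[>] 0, 0 ≤ η ε / ε ^ σ := by
  filter_upwards [Icc_mem_nhdsGT] with ε hε
  exact div_nonneg (hη ε hε) (Real.rpow_nonneg hε.1 _)

theorem tendsto_amplitude_of_lt (hη : ContDiffOn ℝ ∞ η (Icc 0 1)) (hσ : σ < 2) :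
    Tendsto (fun ε => η ε / ε ^ σ * ε ^ 2) (𝓝[>] 0) (𝓝 0) := by
  have h := (tendsto_nhdsGT_of_contDiffOn hη).mul
    (tendsto_rpow_nhdsGT_zero (by linarith : 0 < 2 - σ))
  rw [mul_zero] at h
  refine h.congr' ?_
  filter_upwards [self_mem_nhdsWithin] with ε hε
  have := div_rpow_mul_pow (σ := σ) hε (η ε) 2
  push_cast at this
  exact this.symm

theorem amplitude_two {ε : ℝ} (hε : 0 < ε) (b : ℝ) : b / ε ^ (2 : ℝ) * ε ^ 2 = b := by
  rw [Real.rpow_two]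
  exact div_mul_cancel₀ _ (by positivity)

/-- The quantity equals η(ε) ε^{3-σ}, which stays bounded precisely because σ ≤ 3. -/
theorem eventually_amplitude_le (hη : ContDiffOn ℝ ∞ η (Icc 0 1))
    (hη0 : ∀ ε ∈ Icc (0 : ℝ) 1, 0 ≤ η ε) (hσ : σ ≤ 3) :
    ∀ᶠ ε in 𝓝[>] 0, η ε / ε ^ σ * ε ^ 3 ≤ η 0 + 1 := by
  filter_upwards [self_mem_nhdsWithin, Icc_mem_nhdsGT, (tendsto_nhdsGT_of_contDiffOn hη).eventually
    (eventually_le_nhds (lt_add_one (η 0)))] with ε hε h1 h2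
  have := div_rpow_mul_pow (σ := σ) hε (η ε) 3
  push_cast at this
  rw [this]
  refine le_trans (mul_le_of_le_one_right (hη0 ε h1) ?_) h2
  exact Real.rpow_le_one h1.1 h1.2 (by linarith)

end Scaling

end ShrinkingHartree

end

theorem theorem2p2
    (T : ℝ) (hT : 0 < T)
    (w : E3 → ℝ) (hw_bdd : MemLp w ⊤ volume) (hw_sob : MemW1 3 w)
    (hw_even : ∀ᵐ x, w (-x) = w x)
    (V : E3 → ℝ) (hV_rollnik : IsRollnik V) (hV_int : Integrable V volume)
    (hV_add : ¬ w =ᵐ[volume] 0 → ∃ p : ℝ≥0∞, 3 / 2 < p ∧ MemLpAddLinfty p V)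
    (η : ℝ → ℝ) (hη_smooth : ContDiffOn ℝ ∞ η (Icc 0 1))
    (hη_nonneg : ∀ ε ∈ Icc (0 : ℝ) 1, 0 ≤ η ε) (hη_zero : η 0 = 1) (hη_one : η 1 = 1)
    (a : L2) (σ : ℝ) (hσ : 0 ≤ σ) :
    ∃ uε : ℝ → ℝ → L2,
      (∀ ε ∈ Ioc (0 : ℝ) 1,
        IsUniqueHartreeSolution (formSumGraph (scaledPotential η σ V ε)) w a (uε ε)) ∧
      (σ ≤ 3 →
        (σ = 2 → ¬ ∃ φ : L2, IsBirmanSchwingerEigenfunction V φ) →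
        (2 < σ → ∀ᵐ x, 0 ≤ V x) →
        ∃ u : ℝ → L2, IsUniqueHartreeSolution freeGraph w a u ∧
          Tendsto (fun ε => eLpNorm (fun t => uε ε t - u t) ⊤ (volume.restrict (Icc 0 T)))
            (𝓝[>] 0) (𝓝 0)) ∧
      (σ = 2 →
        ∀ φ : L2, IsSimpleResonance V φ →
          ∫ x, Real.sign (V x) * ‖φ x‖ ^ 2 = -1 →
          ∃ v : ℝ → L2,
            IsUniqueHartreeSolution
              (pointInteractionGraph
                (-derivWithin η (Icc 0 1) 0 / ‖∫ x, (V x : ℂ) * resonanceFunction V φ x‖ ^ 2))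
              w a v ∧
            Tendsto (fun ε => eLpNorm (fun t => uε ε t - v t) ⊤ (volume.restrict (Icc 0 T)))
              (𝓝[>] 0) (𝓝 0)) := by
  have hex (ε : ℝ) (hε : ε ∈ Ioc (0 : ℝ) 1) : ∃ u,
      IsUniqueHartreeSolution (formSumGraph (scaledPotential η σ V ε)) w a u :=
    exists_isUniqueHartreeSolution_formSum hw_bdd hV_rollnik hε.1
      (div_nonneg (hη_nonneg ε (Ioc_subset_Icc_self hε)) (Real.rpow_nonneg hε.1.le _)) a
  choose! uε huε using hex
  have hsol : ∀ᶠ ε in 𝓝[>] (0 : ℝ),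
      IsHartreeSolution (formSumGraph (scaledPotential η σ V ε)) w a (uε ε) := by
    filter_upwards [Ioc_mem_nhdsGT one_pos] with ε hε
    exact (huε ε hε).1
  have ha := eventually_amplitude_nonneg (σ := σ) hη_nonneg
  have hη1 : Tendsto η (𝓝[>] 0) (𝓝 1) := hη_zero ▸ tendsto_nhdsGT_of_contDiffOn hη_smooth
  have htwo : σ = 2 → ∀ᶠ ε in 𝓝[>] (0 : ℝ), η ε / ε ^ σ * ε ^ 2 = η ε := by
    rintro rfl
    filter_upwards [self_mem_nhdsWithin] with ε hε
    exact amplitude_two hε _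
  refine ⟨uε, huε, fun hσ3 hno hpos => ?_, fun hσ2 φ hφ hnorm => ?_⟩
  · obtain ⟨u, hu⟩ := exists_isUniqueHartreeSolution (κ := 1) hw_bdd (isSelfAdjoint_freeRes 1)
      (injective_freeRes one_pos) a
    refine ⟨u, (freeGraph_eq_resolventGraph one_pos).symm ▸ hu, ?_⟩
    have hnear {b : ℝ} (hb : Tendsto (fun ε => η ε / ε ^ σ * ε ^ 2) (𝓝[>] 0) (𝓝 b))
        (hb₀ : IsUnit (1 + (b : ℂ) • (signOp hV_rollnik.1 ∘L bsOp hV_rollnik 0))) :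
        Tendsto (fun ε => eLpNorm (fun t => uε ε t - u t) ⊤ (volume.restrict (Icc 0 T)))
          (𝓝[>] 0) (𝓝 0) := by
      obtain ⟨hunit, hlim⟩ := tendsto_potResFam_free hV_rollnik hV_int one_pos ha hb hb₀
      exact tendsto_hartreeSolution hw_bdd (isSelfAdjoint_freeRes 1) (injective_freeRes one_pos)
        (eventually_potResFam hV_rollnik one_pos ha hunit hlim)
        (fun x => ((ContinuousLinearMap.apply ℂ L2 x).continuous.tendsto _).comp hlim)
        hu.1 hsol T
    -- Below the critical exponent the coupling tends to 0 and the limiting Birman-Schwinger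
    -- operator is the identity. At σ = 2 it tends to η(0) = 1 and the Fredholm alternative is used.
    -- Above, the sign of V replaces invertibility.
    rcases lt_trichotomy σ 2 with h | h | h
    · exact hnear (tendsto_amplitude_of_lt hη_smooth h) (by simp)
    · refine hnear (b := 1) (hη1.congr' ((htwo h).mono fun ε hε => hε.symm)) ?_
      rw [Complex.ofReal_one, one_smul]
      exact isUnit_one_add_of_forall_not_eigenfunction hV_rollnik (hno h)
    · obtain ⟨⟨M, hM⟩, hlim⟩ := tendsto_potResFam_of_nonneg hV_rollnik hV_int (hpos h) one_pos ha
        (eventually_amplitude_le hη_smooth hη_nonneg hσ3)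
      exact tendsto_hartreeSolution hw_bdd (isSelfAdjoint_freeRes 1) (injective_freeRes one_pos)
        hM hlim hu.1 hsol T
  · set α := -derivWithin η (Icc 0 1) 0 / ‖∫ x, (V x : ℂ) * resonanceFunction V φ x‖ ^ 2 with hα
    obtain ⟨κ, hκ, hακ⟩ : ∃ κ : ℝ, 0 < κ ∧ α + κ / (4 * Real.pi) ≠ 0 := by
      -- This choice gives α + |α| + 1 > 0, so the denominator of the limiting resolvent does not
      -- vanish.
      refine ⟨4 * Real.pi * (|α| + 1), by positivity, ?_⟩
      rw [mul_div_cancel_left₀ _ (by positivity)]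
      linarith [neg_abs_le α]
    obtain ⟨v, hv⟩ := exists_isUniqueHartreeSolution (κ := κ) hw_bdd (isSelfAdjoint_pointRes α κ)
      (injective_pointRes hκ) a
    refine ⟨v, (pointInteractionGraph_eq_resolventGraph hκ hακ).symm ▸ hv, ?_⟩
    have hb : Tendsto (fun ε => η ε / ε ^ σ * ε ^ 2) (𝓝[>] 0) (𝓝 1) :=
      hη1.congr' ((htwo hσ2).mono fun ε hε => hε.symm)
    have hb' : Tendsto (fun ε => ε⁻¹ * (η ε / ε ^ σ * ε ^ 2 - 1)) (𝓝[>] 0)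
        (𝓝 (derivWithin η (Icc 0 1) 0)) := by
      refine (tendsto_quotient_of_contDiffOn hη_smooth).congr' ?_
      filter_upwards [htwo hσ2] with ε hε
      rw [hε, hη_zero]
    obtain ⟨hunit, hlim⟩ := tendsto_potResFam_resonance hV_rollnik hV_int hκ ha hb hb' hφ hnorm hακ
    exact tendsto_hartreeSolution hw_bdd (isSelfAdjoint_pointRes α κ) (injective_pointRes hκ)
      (eventually_potResFam hV_rollnik hκ ha hunit hlim)
      (fun x => ((ContinuousLinearMap.apply ℂ L2 x).continuous.tendsto _).comp hlim)
      hv.1 hsol T
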